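/- **Theorem.** The model of computation is the randomized word-RAM with $O(\log n)$-bit words. SETH states: for every $\epsilon>0$ there is a $K$ such that no randomized algorithm (error probability at most $1/3$; words logarithmic in the $2^{O(N)}$ memory size, i.e. $O(N)$ bits) decides $K$-SAT on $N$ variables in $2^{(1-\epsilon)N}\,\mathrm{poly}(N)$ time. An $\alpha$-approximation of all eccentricities of a connected graph $G$ assigns to every vertex $v$ an integer $e(v)$ with $e(v)\le \mathrm{ecc}_G(v)\le \alpha\, e(v)$, where $\mathrm{ecc}_G(v)=\max_y d_G(v,y)$. A dynamic algorithm preprocesses an $n$-vertex graph given as an edge list, and then handles edge insertions, edge deletions and queries; a query has to output an $\alpha$-approximation of all eccentricities of the current graph. It may be randomized, with failure probability at most $n^{-c}$ (for correctness of an answer and for the time bounds) on operation sequences that are fixed in advance and have length at most $n^c$, for all large $n$. (1) There is an absolute constant $C$ such that the following holds for all constants $t,\epsilon,\epsilon'>0$. SETH implies that, for some $c$ depending only on $t,\epsilon,\epsilon'$, there exists no fully dynamic $(5/3-\epsilon)$-approximation algorithm for all eccentricities on undirected unweighted graphs with $n$ vertices and $\tilde O(n)$ edges (not even on graphs that at all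 times are connected and have at most $Cn$ edges) which has preprocessing time $p(n)=O(n^t)$, amortized update time $u(n)=O(n^{2-\epsilon'})$ and amortized query time $q(n)=O(n^{2-\epsilon'})$; here amortized means that preprocessing followed by $k$ updates and $l$ queries takes total time at most $p(n)+k\,u(n)+l\,q(n)$. In particular no deterministic such algorithm exists. (2) The same result holds for incremental algorithms (only insertions and queries) and for decremental algorithms (only deletions and queries) with worst-case update time $u(n)=O(n^{2-\epsilon'})$ and worst-case query time $q(n)=O(n^{2-\epsilon'})$. (3) Let $a\ge1$ be an integer, $U,V\subseteq\{0,1\}^d$ finite, and $w\in\{0,1\}^d$. Let $G$ be the graph that has nodes $x$, and $c_U,c_V$ for every coordinate $c$; for every $u\in U$ a path of length $a$ from a node $u^0$ to a node $u^a$, and an edge $xu^0$; for every $v\in V$ a path of length $a$ from a node $v^0$ to a node $v^a$; a path of length $a$ between $u^a$ and $c_U$ whenever $u[c]=1$, and a path of length $a$ between $c_V$ and $v^0$ whenever $v[c]=1$; and an edge $c_Uc_V$ whenever $w[c]=1$ (all paths internally disjoint). If $u\in U$, $v\in V$ satisfy $\sum_c u[c]v[c]w[c]=0$, then $u^a$ has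 eccentricity at least $5a+1$ in $G$ (possibly $\infty$). If no vector of $U\cup V$ is zero, no coordinate vanishes on all of $U$ or on all of $V$, and $\sum_c u[c]v[c]w[c]\neq0$ for all $u\in U$, $v\in V$, then $u^a$ has eccentricity at most $3a+2$ in $G$ for every $u\in U$. -/

import Mathlib

/-! ## Structured word-RAM programs

A machine has countably many registers and countably many arrays, each cell holding a natural
number; a program uses finitely many of them.  With word length `w`, every number that a program
computes must be smaller than `2 ^ w`, otherwise the computation does not terminate properly.
Every elementary instruction and every evaluation of a branch condition costs one time step.
Randomness is available through a read-once tape of fair coin flips. -/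

namespace WordRAM

/-- The binary word operations (with `x / 0 = 0`, `x % 0 = x`, truncated subtraction). -/
inductive BinOp
  | add | sub | mul | div | mod | and | or | xor | shl | shr

def BinOp.eval : BinOp → ℕ → ℕ → ℕ
  | .add, x, y => x + y
  | .sub, x, y => x - y
  | .mul, x, y => x * y
  | .div, x, y => x / y
  | .mod, x, y => x % y
  | .and, x, y => x &&& y
  | .or, x, y => x ||| y
  | .xor, x, y => x ^^^ y
  | .shl, x, y => x <<< y
  | .shr, x, y => x >>> y

/-- Programs.  Registers and arrays are named by natural numbers. -/
inductive Cmd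
  /-- no operation -/
  | skip
  /-- `const x k`: put the constant `k` into register `x` -/
  | const (x k : ℕ)
  /-- `op x o y z`: put `o (reg y) (reg z)` into register `x` -/
  | op (x : ℕ) (o : BinOp) (y z : ℕ)
  /-- `load x a y`: put cell `reg y` of array `a` into register `x` -/
  | load (x a y : ℕ)
  /-- `store a y z`: put `reg z` into cell `reg y` of array `a` -/
  | store (a y z : ℕ)
  /-- `coin x`: put a fresh random bit into register `x` -/
  | coin (x : ℕ)
  /-- sequential composition -/
  | seq (p q : Cmd)
  /-- `ite x p q`: run `p` if register `x` is nonzero, otherwise run `q` -/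
  | ite (x : ℕ) (p q : Cmd)
  /-- `loop x p`: as long as register `x` is nonzero, run `p` -/
  | loop (x : ℕ) (p : Cmd)

/-- A memory state, together with the number of coin flips used so far. -/
structure State where
  reg : ℕ → ℕ
  arr : ℕ → ℕ → ℕ
  used : ℕ

def State.setReg (s : State) (x k : ℕ) : State :=
  { s with reg := Function.update s.reg x k }

def State.setArr (s : State) (a i k : ℕ) : State :=
  { s with arr := Function.update s.arr a (Function.update (s.arr a) i k) }

/-- `Exec w ω p s s' t`: with word length `w` and coin flips `ω`, program `p` started in state `s`
halts in state `s'` after exactly `t` steps. -/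
inductive Exec (w : ℕ) (ω : ℕ → Bool) : Cmd → State → State → ℕ → Prop
  | skip (s : State) : Exec w ω .skip s s 1
  | const (s : State) (x k : ℕ) (h : k < 2 ^ w) :
      Exec w ω (.const x k) s (s.setReg x k) 1
  | op (s : State) (x : ℕ) (o : BinOp) (y z : ℕ) (h : o.eval (s.reg y) (s.reg z) < 2 ^ w) :
      Exec w ω (.op x o y z) s (s.setReg x (o.eval (s.reg y) (s.reg z))) 1
  | load (s : State) (x a y : ℕ) :
      Exec w ω (.load x a y) s (s.setReg x (s.arr a (s.reg y))) 1
  | store (s : State) (a y z : ℕ) :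
      Exec w ω (.store a y z) s (s.setArr a (s.reg y) (s.reg z)) 1
  | coin (s : State) (x : ℕ) :
      Exec w ω (.coin x) s { s.setReg x (ω s.used).toNat with used := s.used + 1 } 1
  | seq {p q : Cmd} {s s' s'' : State} {t t' : ℕ}
      (hp : Exec w ω p s s' t) (hq : Exec w ω q s' s'' t') :
      Exec w ω (.seq p q) s s'' (t + t')
  | ite_true {x : ℕ} {p q : Cmd} {s s' : State} {t : ℕ} (hx : s.reg x ≠ 0)
      (hp : Exec w ω p s s' t) : Exec w ω (.ite x p q) s s' (t + 1)
  | ite_false {x : ℕ} {p q : Cmd} {s s' : State} {t : ℕ} (hx : s.reg x = 0)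
      (hq : Exec w ω q s s' t) : Exec w ω (.ite x p q) s s' (t + 1)
  | loop_true {x : ℕ} {p : Cmd} {s s' s'' : State} {t t' : ℕ} (hx : s.reg x ≠ 0)
      (hp : Exec w ω p s s' t) (hl : Exec w ω (.loop x p) s' s'' t') :
      Exec w ω (.loop x p) s s'' (t + t' + 1)
  | loop_false {x : ℕ} {p : Cmd} {s : State} (hx : s.reg x = 0) :
      Exec w ω (.loop x p) s s 1

/-- The distribution of an infinite sequence of independent fair coin flips. -/
noncomputable def coinMeasure : MeasureTheory.Measure (ℕ → Bool) :=
  MeasureTheory.Measure.infinitePi fun _ => (PMF.uniformOfFintype Bool).toMeasure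

end WordRAM

/-! ## The Strong Exponential Time Hypothesis -/

namespace KSat

/-- A clause of width `K` over `N` variables: `K` literals, that is, variables with a sign.
(Literals may be repeated, so that shorter nonempty clauses are included.) -/
abbrev Clause (K N : ℕ) := Fin K → Fin N × Bool

/-- A `K`-CNF formula on `N` variables: a list of distinct clauses. -/
structure Formula (K N : ℕ) where
  clauses : List (Clause K N)
  nodup : clauses.Nodup

def Formula.Satisfiable {K N : ℕ} (φ : Formula K N) : Prop :=
  ∃ x : Fin N → Bool, ∀ c ∈ φ.clauses, ∃ i : Fin K, x (c i).1 = (c i).2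

/-- The initial memory for input `φ`: register `0` holds the number of variables, register `1` the
number of clauses, and cell `j * K + i` of array `0` (of array `1`) holds the variable (the sign)
of the `i`-th literal of the `j`-th clause; all the rest is `0`. -/
def Formula.initState {K N : ℕ} (φ : Formula K N) : WordRAM.State where
  reg x := if x = 0 then N else if x = 1 then φ.clauses.length else 0
  arr a p :=
    if h : p / K < φ.clauses.length ∧ 0 < K then
      let l := (φ.clauses.get ⟨p / K, h.1⟩) ⟨p % K, Nat.mod_lt p h.2⟩
      if a = 0 then l.1.val else if a = 1 then l.2.toNat else 0
    else 0
  used := 0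

/-- The randomized program `P`, run with words of `b * (N + 1)` bits, decides satisfiability of
every `K`-CNF formula on `N` variables within `T N` steps, with error probability at most `1/3`.
The answer "satisfiable" is given by the value `1` of register `0`. -/
def Solves (K : ℕ) (P : WordRAM.Cmd) (b : ℕ) (T : ℕ → ℝ) : Prop :=
  ∀ (N : ℕ) (φ : Formula K N),
    WordRAM.coinMeasure {ω | ¬ ∃ (s : WordRAM.State) (τ : ℕ),
      WordRAM.Exec (b * (N + 1)) ω P φ.initState s τ ∧ (τ : ℝ) ≤ T N ∧
        (s.reg 0 = 1 ↔ φ.Satisfiable)} ≤ 1 / 3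

/-- The Strong Exponential Time Hypothesis (for randomized algorithms): for every `ε > 0` there is
a `K` such that `K`-SAT on `N` variables has no `2 ^ ((1 - ε) N) * poly(N)` time algorithm. -/
def SETH : Prop :=
  ∀ ε : ℝ, 0 < ε → ∃ K : ℕ, ¬ ∃ (P : WordRAM.Cmd) (b C k : ℕ),
    Solves K P b fun N => (2 : ℝ) ^ ((1 - ε) * (N : ℝ)) * (C * ((N : ℝ) + 1) ^ k)

end KSat

/-! ## Dynamic graph algorithms for all eccentricities -/

namespace DynGraph

/-- The operations on a dynamic graph with vertex set `Fin n`. -/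
inductive Op (n : ℕ)
  | insert (u v : Fin n)
  | delete (u v : Fin n)
  | query

variable {n : ℕ}

def Op.IsInsert : Op n → Prop
  | .insert _ _ => True
  | _ => False

def Op.IsDelete : Op n → Prop
  | .delete _ _ => True
  | _ => False

def Op.IsQuery : Op n → Prop
  | .query => True
  | _ => False

/-- The graph after an operation. -/
def Op.apply : Op n → SimpleGraph (Fin n) → SimpleGraph (Fin n)
  | .insert u v, G => G ⊔ SimpleGraph.edge u v
  | .delete u v, G => G.deleteEdges {s(u, v)}
  | .query, G => G

/-- Only non-edges are inserted, and only edges are deleted. -/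
def Op.Allowed : Op n → SimpleGraph (Fin n) → Prop
  | .insert u v, G => u ≠ v ∧ ¬ G.Adj u v
  | .delete u v, G => G.Adj u v
  | .query, _ => True

/-- The graph after a sequence of operations. -/
def applyAll (G : SimpleGraph (Fin n)) (σ : List (Op n)) : SimpleGraph (Fin n) :=
  σ.foldl (fun H o => o.apply H) G

/-- All operations of the sequence are allowed, and at all times the graph is connected and has at
most `C * n` edges. -/
def Legal (C : ℕ) : SimpleGraph (Fin n) → List (Op n) → Prop
  | G, [] => G.Connected ∧ G.edgeSet.ncard ≤ C * n
  | G, o :: σ => (G.Connected ∧ G.edgeSet.ncard ≤ C * n) ∧ o.Allowed G ∧ Legal C (o.apply G) σ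

/-- `L` lists every edge of `G` exactly once, in one of its two orientations. -/
def Presents (L : List (Fin n × Fin n)) (G : SimpleGraph (Fin n)) : Prop :=
  (∀ u v : Fin n, G.Adj u v ↔ (u, v) ∈ L ∨ (v, u) ∈ L) ∧ L.length = G.edgeSet.ncard

/-- The initial memory for a graph given by the edge list `L`: register `0` holds the number of
vertices, register `1` the number of edges, arrays `0` and `1` hold the two endpoints of the
edges; all the rest is `0`. -/
def initState (L : List (Fin n × Fin n)) : WordRAM.State where
  reg x := if x = 0 then n else if x = 1 then L.length else 0
  arr a i :=
    if h : i < L.length then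
      if a = 0 then (L[i]).1.val else if a = 1 then (L[i]).2.val else 0
    else 0
  used := 0

/-- The endpoints of an edge to be inserted or deleted are passed in registers `0` and `1`. -/
def Op.passArgs : Op n → WordRAM.State → WordRAM.State
  | .insert u v, s => (s.setReg 0 u.val).setReg 1 v.val
  | .delete u v, s => (s.setReg 0 u.val).setReg 1 v.val
  | .query, s => s

/-- A (randomized) dynamic graph algorithm: programs for preprocessing, insertions, deletions and
queries, which share the memory, and a factor `b`; on `n`-vertex graphs words have
`b * (⌊log₂ n⌋ + 1)` bits. -/
structure Algorithm where
  preprocess : WordRAM.Cmd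
  insert : WordRAM.Cmd
  delete : WordRAM.Cmd
  query : WordRAM.Cmd
  b : ℕ

def Algorithm.code (A : Algorithm) : Op n → WordRAM.Cmd
  | .insert _ _ => A.insert
  | .delete _ _ => A.delete
  | .query => A.query

def Algorithm.wordLength (A : Algorithm) (n : ℕ) : ℕ := A.b * (Nat.log 2 n + 1)

/-- `A.RunOps ω s σ ts s'`: with coin flips `ω`, from memory state `s`, the algorithm processes the
operations `σ`, the `i`-th of which takes `ts[i]` steps, and ends in memory state `s'`. -/
inductive Algorithm.RunOps (A : Algorithm) (ω : ℕ → Bool) :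
    WordRAM.State → List (Op n) → List ℕ → WordRAM.State → Prop
  | nil (s : WordRAM.State) : RunOps A ω s [] [] s
  | cons {s s' s'' : WordRAM.State} {o : Op n} {σ : List (Op n)} {t : ℕ} {ts : List ℕ}
      (ho : WordRAM.Exec (A.wordLength n) ω (A.code o) (o.passArgs s) s' t)
      (hσ : RunOps A ω s' σ ts s'') : RunOps A ω s (o :: σ) (t :: ts) s''

/-- `A.Run ω L σ t₀ ts s`: preprocessing of the graph given by `L` takes `t₀` steps, and then the
operations `σ` take `ts` steps and end in memory state `s`. -/
def Algorithm.Run (A : Algorithm) (ω : ℕ → Bool) (L : List (Fin n × Fin n)) (σ : List (Op n))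
    (t₀ : ℕ) (ts : List ℕ) (s : WordRAM.State) : Prop :=
  ∃ s₀, WordRAM.Exec (A.wordLength n) ω A.preprocess (initState L) s₀ t₀ ∧
    A.RunOps ω s₀ σ ts s

/-- Array `2` contains an `α`-approximation of all eccentricities of `G`: an estimate `e(v)` with
`e(v) ≤ ecc(v) ≤ α * e(v)` for every vertex `v` (used for connected `G`, where eccentricities are
finite). -/
def ApproxEcc (α : ℝ) (G : SimpleGraph (Fin n)) (s : WordRAM.State) : Prop :=
  ∀ v : Fin n, s.arr 2 v.val ≤ (G.eccent v).toNat ∧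
    ((G.eccent v).toNat : ℝ) ≤ α * (s.arr 2 v.val : ℝ)

/-- If the last operation of `σ` is a query, then it was answered correctly. -/
def LastAnswerCorrect (α : ℝ) (G : SimpleGraph (Fin n)) (σ : List (Op n)) (s : WordRAM.State) :
    Prop :=
  ∀ o ∈ σ.getLast?, o.IsQuery → ApproxEcc α (applyAll G σ) s

open Classical in
/-- Preprocessing together with the operations `σ` takes at most `p n` steps, plus `u n` steps per
update, plus `q n` steps per query. -/
def AmortizedTime (p u q : ℕ → ℝ) (σ : List (Op n)) (t₀ : ℕ) (ts : List ℕ) : Prop :=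
  ((t₀ + ts.sum : ℕ) : ℝ) ≤ p n + (σ.countP fun o => ¬ o.IsQuery : ℕ) * u n +
    (σ.countP fun o => o.IsQuery : ℕ) * q n

/-- Preprocessing takes at most `p n` steps, and the last operation of `σ` takes at most `u n`
steps if it is an update, and at most `q n` steps if it is a query. -/
def WorstCaseTime (p u q : ℕ → ℝ) (σ : List (Op n)) (t₀ : ℕ) (ts : List ℕ) : Prop :=
  (t₀ : ℝ) ≤ p n ∧
    ∀ o ∈ σ.getLast?, ∀ t ∈ ts.getLast?,
      (¬ o.IsQuery → (t : ℝ) ≤ u n) ∧ (o.IsQuery → (t : ℝ) ≤ q n)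

/-- For all large `n`, every initial graph on `n` vertices, and every legal sequence `σ` of at most
`n ^ c` operations of the admitted kind, fixed in advance, with probability at least `1 - 1 / n ^ c`
the time bound `time` holds for `σ` and the last query of `σ` (if `σ` ends with one) is answered
with an `α`-approximation of all eccentricities. -/
def Algorithm.Maintains (A : Algorithm) (α : ℝ) (C c : ℕ) (kind : ∀ n, Op n → Prop)
    (time : ∀ n, List (Op n) → ℕ → List ℕ → Prop) : Prop :=
  ∃ n₀ : ℕ, ∀ n ≥ n₀, ∀ (G : SimpleGraph (Fin n)) (L : List (Fin n × Fin n)), Presents L G →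
    ∀ σ : List (Op n), Legal C G σ → (∀ o ∈ σ, kind n o) → σ.length ≤ n ^ c →
      WordRAM.coinMeasure {ω | ¬ ∃ (t₀ : ℕ) (ts : List ℕ) (s : WordRAM.State),
        A.Run ω L σ t₀ ts s ∧ time n σ t₀ ts ∧ LastAnswerCorrect α G σ s} ≤
          ENNReal.ofReal (1 / (n : ℝ) ^ c)

/-- `A` is a fully dynamic `α`-approximation algorithm for all eccentricities with preprocessing
time `p`, amortized update time `u` and amortized query time `q`. -/
def Algorithm.FullyDynamic (A : Algorithm) (α : ℝ) (C c : ℕ) (p u q : ℕ → ℝ) : Prop :=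
  A.Maintains α C c (fun _ _ => True) (fun _ => AmortizedTime p u q)

/-- `A` is an incremental `α`-approximation algorithm for all eccentricities with preprocessing
time `p`, worst-case update time `u` and worst-case query time `q`. -/
def Algorithm.Incremental (A : Algorithm) (α : ℝ) (C c : ℕ) (p u q : ℕ → ℝ) : Prop :=
  A.Maintains α C c (fun _ o => o.IsInsert ∨ o.IsQuery) (fun _ => WorstCaseTime p u q)

/-- `A` is a decremental `α`-approximation algorithm for all eccentricities with preprocessing
time `p`, worst-case update time `u` and worst-case query time `q`. -/
def Algorithm.Decremental (A : Algorithm) (α : ℝ) (C c : ℕ) (p u q : ℕ → ℝ) : Prop :=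
  A.Maintains α C c (fun _ o => o.IsDelete ∨ o.IsQuery) (fun _ => WorstCaseTime p u q)

end DynGraph

/-! ## The gadget graph -/

namespace Gadget

/-- The generalized inner product of three 0/1 vectors. -/
def inner3 {d : ℕ} (u v w : Fin d → Bool) : ℕ :=
  ∑ i, (u i).toNat * (v i).toNat * (w i).toNat

/-- The named nodes: `x`, the coordinate nodes `c_U` and `c_V`, and the ends `u^0`, `u^a`, `v^0`,
`v^a` of the vector paths. -/
inductive Node {d : ℕ} (U V : Finset (Fin d → Bool))
  | x
  | coordU (c : Fin d)
  | coordV (c : Fin d)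
  | uStart (u : U)
  | uEnd (u : U)
  | vStart (v : V)
  | vEnd (v : V)

/-- The paths that join named nodes in the stage of `w`. -/
inductive Link {d : ℕ} (U V : Finset (Fin d → Bool)) (w : Fin d → Bool)
  /-- from `u^0` to `u^a` -/
  | uPath (u : U)
  /-- from `v^0` to `v^a` -/
  | vPath (v : V)
  /-- from `u^a` to `c_U`, if `u[c] = 1` -/
  | uCoord (u : U) (c : Fin d) (h : u.val c = true)
  /-- from `c_V` to `v^0`, if `v[c] = 1` -/
  | vCoord (v : V) (c : Fin d) (h : v.val c = true)
  /-- the edge from `x` to `u^0` -/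
  | hub (u : U)
  /-- the edge from `c_U` to `c_V`, if `w[c] = 1` -/
  | stage (c : Fin d) (h : w c = true)

variable {d : ℕ} {U V : Finset (Fin d → Bool)} {w : Fin d → Bool}

def Link.src : Link U V w → Node U V
  | .uPath u => .uStart u
  | .vPath v => .vStart v
  | .uCoord u _ _ => .uEnd u
  | .vCoord _ c _ => .coordV c
  | .hub _ => .x
  | .stage c _ => .coordU c

def Link.tgt : Link U V w → Node U V
  | .uPath u => .uEnd u
  | .vPath v => .vEnd v
  | .uCoord _ c _ => .coordU c
  | .vCoord v _ _ => .vStart v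
  | .hub u => .uStart u
  | .stage c _ => .coordV c

/-- The length of a link: `a` for the four kinds of paths, `1` for single edges. -/
def Link.len (a : ℕ) : Link U V w → ℕ
  | .uPath _ => a
  | .vPath _ => a
  | .uCoord _ _ _ => a
  | .vCoord _ _ _ => a
  | .hub _ => 1
  | .stage _ _ => 1

/-- The vertices: the named nodes and the `len - 1` inner nodes of each link. -/
abbrev Vertex (a : ℕ) (U V : Finset (Fin d → Bool)) (w : Fin d → Bool) :=
  Node U V ⊕ (Σ l : Link U V w, Fin (l.len a - 1))

/-- The node number `i` of a link, `0 ≤ i ≤ len`. -/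
def Link.node (a : ℕ) (l : Link U V w) (i : ℕ) : Vertex a U V w :=
  if i = 0 then .inl l.src
  else if h : i - 1 < l.len a - 1 then .inr ⟨l, ⟨i - 1, h⟩⟩
  else .inl l.tgt

/-- The gadget graph in the stage of `w`. -/
def graph (a : ℕ) (U V : Finset (Fin d → Bool)) (w : Fin d → Bool) :
    SimpleGraph (Vertex a U V w) :=
  SimpleGraph.fromRel fun y z =>
    ∃ (l : Link U V w) (i : ℕ), i < l.len a ∧ y = l.node a i ∧ z = l.node a (i + 1)

/-- No vector is zero, and no coordinate vanishes on all of `U` or on all of `V`. -/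
def Nondegenerate (U V : Finset (Fin d → Bool)) : Prop :=
  (∀ u ∈ U, ∃ c, u c = true) ∧ (∀ v ∈ V, ∃ c, v c = true) ∧
    ∀ c, (∃ u ∈ U, u c = true) ∧ ∃ v ∈ V, v c = true

end Gadget

/-! The lower bounds come from a reduction of `K`-SAT. The `N` variables are split into parts of
sizes `N₁`, `N₁`, `N₂`, with `N₁ = N / D` for a constant `D`. A partial assignment becomes a 0/1
vector with one coordinate per clause, equal to 1 when that part does not satisfy the clause.
Partial assignments `u`, `v`, `x` together satisfy the formula exactly if no clause carries a 1 in
all three vectors (`Reduction.satisfiable_iff`).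

All pairs `u`, `v` are put into one graph on about `2 ^ N₁` vertices, up to a polynomial factor, and
the choices of `x` become `2 ^ N₂` stages. Only the edges between `c_U` and `c_V` depend on the
stage. A pair without a common coordinate in stage `x` forces the eccentricity of the node of `u` up
to `5 * a`; if every pair has one, these eccentricities are at most `3 * a + 3`
(`Reduction.le_eccent`, `Reduction.eccent_le`). For large `a` an approximation factor below `5 / 3`
separates the cases (`Reduction.detects_iff`). The gadget graph of the last claim falls apart when
too few stage edges are present, so the reduction uses a variant in which every node is tied to a
hub by paths long enough not to create shortcuts. Both kinds of eccentricity bounds are proved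
alike: explicit routes from above, and from below a potential on the named nodes, interpolated along
the paths to a 1-Lipschitz function.

A fully dynamic algorithm inserts the edges of a stage, answers one query and deletes the edges
again. With update and query time `n ^ (2 - e)` all stages cost about `2 ^ (N₂ + (2 - e) * N₁)`,
which is `2 ^ ((1 - e / D) * N)` up to polynomial factors, and preprocessing is affordable once `t +
e ≤ D` (`Reduction.cost_le`). This contradicts SETH.

An incremental or decremental algorithm cannot return to the initial graph by itself. Its memory is
therefore rolled back to the state after preprocessing. Cells carry the number of the stage in which
they were written, so raising the stage number undoes everything in constant time
(`WordRAM.wp_simulate`, `Reduction.wp_resetCmd`). This needs worst-case bounds, since amortized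
credit would be spent again in every stage. Coin flips are recorded and replayed, so that every
stage is literally a run of the algorithm, with the same coins, on a sequence fixed in advance. A
union bound over these sequences, whose number is at most a third of `n ^ c`, controls the error
(`Reduction.coinMeasure_le`). No independence between stages is required.

The two halves meet in `Reduction.exists_exec_full` and `Reduction.exists_exec_monotone`: for good
coins the reduction program halts in time with the right answer. -/

theorem SimpleGraph.le_edist_of_lipschitz {V : Type*} {G : SimpleGraph V} (f : V → ℤ)
    (hf : ∀ x y, G.Adj x y → f y ≤ f x + 1) {x y : V} {k : ℕ} (hk : f x + k ≤ f y) :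
    (k : ℕ∞) ≤ G.edist x y := by
  refine le_iInf fun p => ?_
  have key : ∀ {x y : V} (p : G.Walk x y), f y ≤ f x + p.length := by
    intro x y p
    induction p with
    | nil => simp
    | cons h p ih =>
      have := hf _ _ h
      push_cast [SimpleGraph.Walk.length_cons]
      linarith
  have := key p
  exact_mod_cast (by linarith : (k : ℤ) ≤ p.length)

/-- The `1`-Lipschitz interpolation from `p` towards `e`. -/
def interp (p e i : ℤ) : ℤ := max (min e (p + i)) (p - i)

theorem interp_zero (p e : ℤ) : interp p e 0 = p := by
  unfold interp; omega

theorem interp_eq_right {p e i : ℤ} (h₁ : e ≤ p + i) (h₂ : p ≤ e + i) : interp p e i = e := by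
  unfold interp; omega

theorem interp_succ_le (p e i : ℤ) : interp p e (i + 1) ≤ interp p e i + 1 := by
  unfold interp; omega

theorem interp_le_succ (p e : ℤ) {i : ℤ} (hi : 0 ≤ i) :
    interp p e i ≤ interp p e (i + 1) + 1 := by
  unfold interp; omega

/-! ### Eccentricities in the gadget graph -/

namespace Gadget

variable {d : ℕ} {U V : Finset (Fin d → Bool)} {w : Fin d → Bool} {a : ℕ}

theorem Link.node_zero (l : Link U V w) : l.node a 0 = .inl l.src := by simp [Link.node]

theorem Link.len_pos (ha : 1 ≤ a) (l : Link U V w) : 1 ≤ l.len a := by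
  cases l <;> simp [Link.len, ha]

theorem Link.node_len (ha : 1 ≤ a) (l : Link U V w) : l.node a (l.len a) = .inl l.tgt := by
  have := l.len_pos ha
  rw [Link.node, if_neg (by omega), dif_neg (by omega)]

theorem Link.node_inner (l : Link U V w) (i : Fin (l.len a - 1)) :
    l.node a (i + 1) = .inr ⟨l, i⟩ := by
  rw [Link.node, if_neg (by omega), dif_pos (by simp)]
  simp

/-- The extension of a function on the named nodes to all vertices. -/
def extend (a : ℕ) (E : Node U V → ℤ) : Vertex a U V w → ℤ
  | .inl y => E y
  | .inr ⟨l, i⟩ => interp (E l.src) (E l.tgt) (i.val + 1 : ℕ)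

/-- The interpolation reaches the value at the target after `len` steps precisely because the two
end values differ by at most `len`; so the extension is consistent where links meet. -/
theorem extend_node {E : Node U V → ℤ}
    (hE : ∀ l : Link U V w, E l.tgt ≤ E l.src + l.len a ∧ E l.src ≤ E l.tgt + l.len a)
    (l : Link U V w) {i : ℕ} (hi : i ≤ l.len a) :
    extend a E (l.node a i) = interp (E l.src) (E l.tgt) i := by
  unfold Link.node
  split_ifs with h₁ h₂
  · simp [extend, h₁, interp_zero]
  · simp only [extend]
    congr 2
    omega
  · obtain rfl : i = l.len a := by omega
    exact (interp_eq_right (hE l).1 (hE l).2).symm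

/-- Interpolation moves by at most 1 per step, so a lower bound on distances only has to be checked
on links between named nodes. -/
theorem extend_lipschitz {E : Node U V → ℤ}
    (hE : ∀ l : Link U V w, E l.tgt ≤ E l.src + l.len a ∧ E l.src ≤ E l.tgt + l.len a)
    (y z : Vertex a U V w) (h : (graph a U V w).Adj y z) : extend a E z ≤ extend a E y + 1 := by
  rw [graph, SimpleGraph.fromRel_adj] at h
  rcases h with ⟨-, ⟨l, i, hi, rfl, rfl⟩ | ⟨l, i, hi, rfl, rfl⟩⟩ <;>
    rw [extend_node hE l hi.le, extend_node hE l hi] <;> push_cast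
  · exact interp_succ_le _ _ _
  · exact interp_le_succ _ _ (by positivity)

theorem inner3_eq_zero {u v w : Fin d → Bool} (h : inner3 u v w = 0) (c : Fin d)
    (hu : u c = true) (hv : v c = true) : w c = false := by
  have := (Finset.sum_eq_zero_iff.mp h) c (Finset.mem_univ c)
  simpa [hu, hv] using this

theorem exists_of_inner3_ne_zero {u v w : Fin d → Bool} (h : inner3 u v w ≠ 0) :
    ∃ c, u c = true ∧ v c = true ∧ w c = true := by
  obtain ⟨c, -, hc⟩ := Finset.exists_ne_zero_of_sum_ne_zero h
  refine ⟨c, ?_⟩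
  cases hu : u c <;> cases hv : v c <;> cases hw : w c <;> simp_all

open Classical in
/-- Lower bounds for the distances from `u^a`, for a pair `u`, `v` that is orthogonal with respect
to `w`. -/
noncomputable def potential (a : ℕ) (w : Fin d → Bool) (u : U) (v : V) : Node U V → ℤ
  | .x => a + 1
  | .coordU c => if u.val c then a else 3 * a
  | .coordV c => if u.val c ∧ w c then a + 1 else 3 * a + 1
  | .uStart u' => if u' = u then a else a + 1
  | .uEnd u' => if u' = u then 0 else 2 * a
  | .vStart v' => if v' = v then 4 * a + 1 else 2 * a + 1
  | .vEnd v' => if v' = v then 5 * a + 1 else 2 * a + 1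

/-- Orthogonality matters at one kind of link only: the paths `vCoord` at `v`. There the value `4 *
a + 1` of the start of `v` excludes the value `a + 1` at `c_V`, which would mean that `c` lies in
all three vectors. -/
theorem potential_link (ha : 1 ≤ a) {u : U} {v : V} (h : inner3 u.val v.val w = 0) (l : Link U V w) :
    potential a w u v l.tgt ≤ potential a w u v l.src + l.len a ∧
      potential a w u v l.src ≤ potential a w u v l.tgt + l.len a := by
  cases l with
  | uPath u' => simp only [Link.src, Link.tgt, Link.len, potential]; split_ifs <;> omega
  | vPath v' => simp only [Link.src, Link.tgt, Link.len, potential]; split_ifs <;> omega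
  | uCoord u' c hc =>
    simp only [Link.src, Link.tgt, Link.len, potential]
    split_ifs with h₁ h₂ h₂
    · omega
    · omega
    · subst h₂; simp [hc] at h₁
    · omega
  | vCoord v' c hc =>
    simp only [Link.src, Link.tgt, Link.len, potential]
    split_ifs with h₁ h₂ h₂
    · subst h₁
      have := inner3_eq_zero h c h₂.1 hc
      simp [this] at h₂
    · omega
    · omega
    · omega
  | hub u' => simp only [Link.src, Link.tgt, Link.len, potential]; split_ifs <;> omega
  | stage c hc =>
    simp only [Link.src, Link.tgt, Link.len, potential, hc, and_true]; split_ifs <;> omega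

theorem le_eccent_of_inner3_eq_zero (ha : 1 ≤ a) {u : U} {v : V} (h : inner3 u.val v.val w = 0) :
    ((5 * a + 1 : ℕ) : ℕ∞) ≤ (graph a U V w).eccent (.inl (.uEnd u)) := by
  refine le_trans ?_ (SimpleGraph.edist_le_eccent (v := .inl (.vEnd v)))
  refine SimpleGraph.le_edist_of_lipschitz (extend a (potential a w u v))
    (extend_lipschitz (potential_link ha h)) ?_
  simp [extend, potential]

theorem edist_node_le (l : Link U V w) {i : ℕ} (j : ℕ) (hi : i + j ≤ l.len a) :
    (graph a U V w).edist (l.node a i) (l.node a (i + j)) ≤ j := by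
  induction j with
  | zero => simp
  | succ j ih =>
    refine (SimpleGraph.edist_triangle (v := l.node a (i + j))).trans ?_
    push_cast
    refine add_le_add (ih (by omega)) (SimpleGraph.edist_le_one_iff_adj_or_eq.mpr ?_)
    by_cases h : l.node a (i + j) = l.node a (i + (j + 1))
    · exact Or.inr h
    · left
      rw [graph, SimpleGraph.fromRel_adj]
      exact ⟨h, Or.inl ⟨l, i + j, by omega, rfl, rfl⟩⟩

theorem edist_src_le (l : Link U V w) {i : ℕ} (hi : i ≤ l.len a) :
    (graph a U V w).edist (.inl l.src) (l.node a i) ≤ i := by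
  simpa [Link.node_zero] using edist_node_le l (i := 0) i (by omega)

theorem edist_tgt_le (ha : 1 ≤ a) (l : Link U V w) {i : ℕ} (hi : i ≤ l.len a) :
    (graph a U V w).edist (.inl l.tgt) (l.node a i) ≤ (l.len a - i : ℕ) := by
  have := edist_node_le (a := a) l (i := i) (l.len a - i) (by omega)
  rwa [Nat.add_sub_cancel' hi, Link.node_len ha, SimpleGraph.edist_comm] at this

theorem edist_src_tgt_le (ha : 1 ≤ a) (l : Link U V w) :
    (graph a U V w).edist (.inl l.src) (.inl l.tgt) ≤ l.len a := by
  simpa [Link.node_len ha] using edist_src_le (a := a) l le_rfl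

theorem edist_step {α : Type*} {G : SimpleGraph α} {x y z : α} {k l m : ℕ}
    (h₁ : G.edist x y ≤ k) (h₂ : G.edist y z ≤ l) (h : k + l ≤ m) : G.edist x z ≤ m :=
  (SimpleGraph.edist_triangle.trans (add_le_add h₁ h₂)).trans (by exact_mod_cast h)

/-- Two routes suffice: through `x` to the nodes of `U`, and through a common coordinate to the
nodes of `V`. The value `3 * a + 2` comes from `c_U`, which is reached through any `u'` having that
coordinate, in `(2 * a + 2) + a` steps. Inner nodes of a link are reached from the end with the
better bound. -/
theorem eccent_le_of_inner3_ne_zero (ha : 1 ≤ a) (hnd : Nondegenerate U V)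
    (h : ∀ (u : U) (v : V), inner3 u.val v.val w ≠ 0) (u : U) :
    (graph a U V w).eccent (.inl (.uEnd u)) ≤ ((3 * a + 2 : ℕ) : ℕ∞) := by
  have hx : (graph a U V w).edist (.inl (.uEnd u)) (.inl .x) ≤ (a + 1 : ℕ) := by
    refine edist_step (y := .inl (.uStart u)) (k := a) (l := 1) ?_ ?_ le_rfl
    · rw [SimpleGraph.edist_comm]; exact edist_src_tgt_le ha (.uPath u)
    · rw [SimpleGraph.edist_comm]; exact edist_src_tgt_le ha (.hub u)
  have huS (u' : U) : (graph a U V w).edist (.inl (.uEnd u)) (.inl (.uStart u')) ≤ (a + 2 : ℕ) :=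
    edist_step hx (edist_src_tgt_le ha (.hub u')) (by simp [Link.len])
  have huE (u' : U) : (graph a U V w).edist (.inl (.uEnd u)) (.inl (.uEnd u')) ≤
      (2 * a + 2 : ℕ) :=
    edist_step (huS u') (edist_src_tgt_le ha (.uPath u')) (by simp [Link.len]; omega)
  have hvS (v : V) : (graph a U V w).edist (.inl (.uEnd u)) (.inl (.vStart v)) ≤
      (2 * a + 1 : ℕ) := by
    obtain ⟨c, hu, hv, hw⟩ := exists_of_inner3_ne_zero (h u v)
    refine edist_step (edist_src_tgt_le ha (.uCoord u c hu)) (l := a + 1) ?_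
      (by simp [Link.len]; omega)
    exact edist_step (edist_src_tgt_le ha (.stage c hw)) (edist_src_tgt_le ha (.vCoord v c hv))
      (by simp [Link.len]; omega)
  have hvE (v : V) : (graph a U V w).edist (.inl (.uEnd u)) (.inl (.vEnd v)) ≤
      (3 * a + 1 : ℕ) :=
    edist_step (hvS v) (edist_src_tgt_le ha (.vPath v)) (by simp [Link.len]; omega)
  rw [SimpleGraph.eccent_le_iff]
  rintro ((_ | c | c | u' | u' | v | v) | ⟨l, i⟩)
  · exact hx.trans (by norm_cast; omega)
  · obtain ⟨u', hu', hc⟩ := (hnd.2.2 c).1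
    exact edist_step (huE ⟨u', hu'⟩) (edist_src_tgt_le ha (.uCoord ⟨u', hu'⟩ c hc))
      (by simp [Link.len]; omega)
  · obtain ⟨v, hv, hc⟩ := (hnd.2.2 c).2
    have := edist_src_tgt_le (w := w) ha (.vCoord (U := U) ⟨v, hv⟩ c hc)
    rw [SimpleGraph.edist_comm] at this
    exact edist_step (hvS ⟨v, hv⟩) this (by simp [Link.len]; omega)
  · exact (huS u').trans (by norm_cast; omega)
  · exact (huE u').trans (by norm_cast; omega)
  · exact (hvS v).trans (by norm_cast; omega)
  · exact (hvE v).trans (by norm_cast; omega)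
  · have hi := i.isLt
    rw [← Link.node_inner]
    cases l with
    | uPath u' =>
      exact edist_step (huS u') (edist_src_le (.uPath u') (i := i + 1) (by omega))
        (by simp only [Link.len] at hi; omega)
    | vPath v =>
      exact edist_step (hvS v) (edist_src_le (.vPath v) (i := i + 1) (by omega))
        (by simp only [Link.len] at hi; omega)
    | uCoord u' c hc =>
      exact edist_step (huE u') (edist_src_le (.uCoord u' c hc) (i := i + 1) (by omega))
        (by simp only [Link.len] at hi; omega)
    -- These are approached from the target, the start of `v`, because the bound for `c_V` is
    -- already `3 * a + 1`.
    | vCoord v c hc =>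
      exact edist_step (hvS v) (edist_tgt_le ha (.vCoord v c hc) (i := i + 1) (by omega))
        (by simp only [Link.len] at hi ⊢; omega)
    | hub u' => simp [Link.len] at hi
    | stage c hc => simp [Link.len] at hi

end Gadget

/-! ## Graphs made of segments

Node `k` is the vertex `k * a`; segment `s` is a path of length `a` from node `par s` to node
`s + 1`; if `ext s ≠ 0`, there is also an edge between the nodes `s + 1` and `ext s`. -/

namespace SegGraph

/-- The predecessor of the vertex `s * a + i + 1`. -/
def pre (a : ℕ) (par : ℕ → ℕ) (s i : ℕ) : ℕ := if i = 0 then par s * a else s * a + i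

/-- The edges of the segments, directed to the smaller endpoint. -/
def IsEdge (S a : ℕ) (par ext : ℕ → ℕ) (x y : ℕ) : Prop :=
  (∃ s < S, ∃ i < a, x = s * a + i + 1 ∧ y = pre a par s i) ∨
    ∃ s < S, ext s ≠ 0 ∧ x = (s + 1) * a ∧ y = ext s * a

def graph (S a : ℕ) (par ext : ℕ → ℕ) : SimpleGraph (Fin (S * a + 1)) :=
  SimpleGraph.fromRel fun x y => IsEdge S a par ext x.val y.val

/-- The edges of segment `s`. -/
def segList (a : ℕ) (par ext : ℕ → ℕ) (s : ℕ) : List (ℕ × ℕ) :=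
  (List.range a).map (fun i => (s * a + i + 1, pre a par s i)) ++
    if ext s = 0 then [] else [((s + 1) * a, ext s * a)]

def edgeList (S a : ℕ) (par ext : ℕ → ℕ) : List (ℕ × ℕ) :=
  (List.range S).flatMap (segList a par ext)

variable {S a : ℕ} {par ext : ℕ → ℕ}

theorem mem_segList {s : ℕ} {p : ℕ × ℕ} : p ∈ segList a par ext s ↔
    (∃ i < a, p.1 = s * a + i + 1 ∧ p.2 = pre a par s i) ∨
      ext s ≠ 0 ∧ p.1 = (s + 1) * a ∧ p.2 = ext s * a := by
  obtain ⟨x, y⟩ := p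
  unfold segList
  split_ifs with h <;> simp [h, eq_comm]

theorem mem_edgeList {p : ℕ × ℕ} :
    p ∈ edgeList S a par ext ↔ IsEdge S a par ext p.1 p.2 := by
  simp only [edgeList, List.mem_flatMap, List.mem_range, mem_segList, IsEdge]
  constructor
  · rintro ⟨s, hs, h | h⟩
    · exact Or.inl ⟨s, hs, h⟩
    · exact Or.inr ⟨s, hs, h⟩
  · rintro (⟨s, hs, h⟩ | ⟨s, hs, h⟩)
    · exact ⟨s, hs, Or.inl h⟩
    · exact ⟨s, hs, Or.inr h⟩

theorem length_edgeList_le : (edgeList S a par ext).length ≤ S * (a + 1) := by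
  have h (s : ℕ) : (segList a par ext s).length ≤ a + 1 := by
    unfold segList
    split_ifs <;> simp
  rw [edgeList, List.length_flatMap]
  refine (List.sum_le_card_nsmul _ (a + 1) ?_).trans (by simp)
  intro x hx
  obtain ⟨s, -, rfl⟩ := List.mem_map.mp hx
  exact h s

/-- The larger endpoint of an edge determines its segment, so the lists of different segments are
disjoint. -/
theorem div_of_mem_segList (ha : 1 ≤ a) {s : ℕ} {p : ℕ × ℕ} (h : p ∈ segList a par ext s) :
    (p.1 - 1) / a = s := by
  rcases mem_segList.mp h with ⟨i, hi, h, -⟩ | ⟨-, h, -⟩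
  · rw [h, Nat.add_sub_cancel]
    exact Nat.div_eq_of_lt_le (by lia) (by lia)
  · rw [h]
    refine Nat.div_eq_of_lt_le ?_ ?_ <;> (try rw [add_mul, one_mul]) <;> omega

theorem nodup_edgeList (ha : 2 ≤ a) : (edgeList S a par ext).Nodup := by
  rw [edgeList, List.nodup_flatMap]
  refine ⟨fun s _ => ?_, ?_⟩
  · unfold segList
    rw [List.nodup_append]
    refine ⟨?_, by split_ifs <;> simp, ?_⟩
    · refine (List.nodup_range).map ?_
      intro i j h
      simpa using congrArg Prod.fst h
    · rintro p hp q hq rfl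
      split_ifs at hq with h
      · simp at hq
      · simp only [List.mem_map, List.mem_range] at hp
        obtain ⟨i, hi, rfl⟩ := hp
        simp only [List.mem_singleton, Prod.mk.injEq, pre] at hq
        obtain ⟨h₁, h₂⟩ := hq
        have hi' : i = a - 1 := by rw [add_mul] at h₁; omega
        rw [if_neg (by omega)] at h₂
        -- The last path edge and the extra edge share their larger endpoint. Equal smaller
        -- endpoints would make `a` divide 1; hence the assumption `2 ≤ a`.
        have h₃ : s * a + a = ext s * a + 1 := by omega
        have h₄ : a ∣ 1 := (Nat.dvd_add_right (Dvd.intro_left (ext s) rfl)).mp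
          (h₃ ▸ ⟨s + 1, by ring⟩)
        have := Nat.le_of_dvd one_pos h₄
        omega
  · refine List.Pairwise.imp ?_ (List.nodup_range (n := S))
    intro s t hst p hs ht
    exact hst ((div_of_mem_segList (by omega) hs).symm.trans (div_of_mem_segList (by omega) ht))

/-- The standing assumptions on a segment graph. -/
structure Wf (a : ℕ) (par ext : ℕ → ℕ) : Prop where
  two_le : 2 ≤ a
  par_le : ∀ s, par s ≤ s
  ext_le : ∀ s, ext s ≤ s

/-- Both `par` and `ext` point backwards. So every edge has one orientation, loops are impossible,
and the edge list has no repetitions even up to swapping endpoints. -/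
theorem IsEdge.lt (h : Wf a par ext) {x y : ℕ} (he : IsEdge S a par ext x y) :
    y < x ∧ x < S * a + 1 := by
  have ha := h.two_le
  rcases he with ⟨s, hs, i, hi, rfl, rfl⟩ | ⟨s, hs, -, rfl, rfl⟩
  · have h₁ : par s * a ≤ s * a := Nat.mul_le_mul_right _ (h.par_le s)
    have h₂ : (s + 1) * a ≤ S * a := Nat.mul_le_mul_right _ hs
    rw [add_mul] at h₂
    unfold pre
    split_ifs <;> omega
  · have h₁ : ext s * a ≤ s * a := Nat.mul_le_mul_right _ (h.ext_le s)
    have h₂ : (s + 1) * a ≤ S * a := Nat.mul_le_mul_right _ hs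
    rw [add_mul] at h₂ ⊢
    omega

theorem adj_iff (h : Wf a par ext) {x y : Fin (S * a + 1)} :
    (graph S a par ext).Adj x y ↔
      IsEdge S a par ext x.val y.val ∨ IsEdge S a par ext y.val x.val := by
  rw [graph, SimpleGraph.fromRel_adj, and_iff_right_iff_imp]
  rintro (he | he) rfl <;> exact absurd (he.lt h).1 (lt_irrefl _)

/-- The vertex with a given number. -/
def vtx (S a x : ℕ) : Fin (S * a + 1) := Fin.ofNat (S * a + 1) x

theorem val_vtx {x : ℕ} (hx : x ≤ S * a) : (vtx S a x).val = x := by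
  simp only [vtx, Fin.val_ofNat]
  exact Nat.mod_eq_of_lt (by omega)

theorem vtx_val (x : Fin (S * a + 1)) : vtx S a x.val = x := by
  ext
  rw [val_vtx (by omega)]

def finEdgeList (S a : ℕ) (par ext : ℕ → ℕ) : List (Fin (S * a + 1) × Fin (S * a + 1)) :=
  (edgeList S a par ext).map fun p => (vtx S a p.1, vtx S a p.2)

theorem mem_finEdgeList (h : Wf a par ext) {p : Fin (S * a + 1) × Fin (S * a + 1)} :
    p ∈ finEdgeList S a par ext ↔ IsEdge S a par ext p.1.val p.2.val := by
  obtain ⟨x, y⟩ := p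
  simp only [finEdgeList, List.mem_map, mem_edgeList]
  constructor
  · rintro ⟨⟨x', y'⟩, he, heq⟩
    have := he.lt h
    simp only [Prod.mk.injEq] at heq this
    rw [← heq.1, ← heq.2, val_vtx (by omega), val_vtx (by omega)]
    exact he
  · intro he
    exact ⟨(x.val, y.val), he, by simp [vtx_val]⟩

theorem nodup_finEdgeList (h : Wf a par ext) : (finEdgeList S a par ext).Nodup := by
  refine List.Nodup.map_on ?_ (nodup_edgeList h.two_le)
  rintro ⟨x, y⟩ hp ⟨x', y'⟩ hq heq
  have h₁ := (mem_edgeList.mp hp).lt h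
  have h₂ := (mem_edgeList.mp hq).lt h
  simp only [Prod.mk.injEq] at heq h₁ h₂ ⊢
  have h₃ := congrArg Fin.val heq.1
  have h₄ := congrArg Fin.val heq.2
  rw [val_vtx (by omega), val_vtx (by omega)] at h₃ h₄
  exact ⟨h₃, h₄⟩

theorem edgeSet_eq (h : Wf a par ext) : (graph S a par ext).edgeSet =
    (fun p => s(p.1, p.2)) '' {p | p ∈ finEdgeList S a par ext} := by
  ext e
  induction e using Sym2.ind with
  | _ x y =>
    simp only [SimpleGraph.mem_edgeSet, adj_iff h, Set.mem_image, Set.mem_ofPred_eq,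
      mem_finEdgeList h, Prod.exists]
    constructor
    · rintro (he | he)
      · exact ⟨x, y, he, rfl⟩
      · exact ⟨y, x, he, Sym2.eq_swap⟩
    · rintro ⟨x', y', he, heq⟩
      rcases Sym2.eq_iff.mp heq with ⟨rfl, rfl⟩ | ⟨rfl, rfl⟩
      · exact Or.inl he
      · exact Or.inr he

theorem ncard_edgeSet (h : Wf a par ext) :
    (graph S a par ext).edgeSet.ncard = (finEdgeList S a par ext).length := by
  rw [edgeSet_eq h, Set.InjOn.ncard_image]
  · have : {p | p ∈ finEdgeList S a par ext} = ((finEdgeList S a par ext).toFinset : Set _) := by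
      ext; simp
    rw [this, Set.ncard_coe_finset, List.toFinset_card_of_nodup (nodup_finEdgeList h)]
  · rintro ⟨x, y⟩ hp ⟨x', y'⟩ hq heq
    have h₁ := ((mem_finEdgeList h).mp hp).lt h
    have h₂ := ((mem_finEdgeList h).mp hq).lt h
    rcases Sym2.eq_iff.mp heq with ⟨h₃, h₄⟩ | ⟨h₃, h₄⟩ <;> simp only at h₁ h₂ h₃ h₄
    · rw [h₃, h₄]
    · subst h₃ h₄
      omega

theorem presents (h : Wf a par ext) :
    DynGraph.Presents (finEdgeList S a par ext) (graph S a par ext) :=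
  ⟨fun x y => by rw [adj_iff h, mem_finEdgeList h, mem_finEdgeList h], (ncard_edgeSet h).symm⟩

theorem ncard_edgeSet_le (h : Wf a par ext) :
    (graph S a par ext).edgeSet.ncard ≤ 2 * (S * a + 1) := by
  rw [ncard_edgeSet h, finEdgeList, List.length_map]
  refine length_edgeList_le.trans ?_
  have := h.two_le
  nlinarith [Nat.mul_le_mul_left S (show 1 ≤ a by omega)]

theorem exists_isEdge (x : ℕ) (h₀ : x ≠ 0) (hx : x ≤ S * a) : ∃ y, IsEdge S a par ext x y := by
  have ha : 0 < a := Nat.pos_of_ne_zero (by rintro rfl; simp at hx; omega)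
  refine ⟨_, Or.inl ⟨(x - 1) / a, ?_, (x - 1) % a, Nat.mod_lt _ ha, ?_, rfl⟩⟩
  · exact Nat.div_lt_of_lt_mul (by rw [mul_comm]; omega)
  · have := Nat.div_add_mod' (x - 1) a
    omega

/-- Every vertex other than 0 has a smaller neighbour on its own segment, so descent reaches 0. The
extra edges play no role, and connectivity therefore survives all updates. -/
theorem connected (h : Wf a par ext) : (graph S a par ext).Connected := by
  rw [SimpleGraph.connected_iff_exists_forall_reachable]
  refine ⟨vtx S a 0, fun y => ?_⟩
  suffices ∀ x ≤ S * a, (graph S a par ext).Reachable (vtx S a 0) (vtx S a x) by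
    rw [← vtx_val y]
    exact this _ (by omega)
  intro x
  induction x using Nat.strong_induction_on with
  | _ x ih =>
    intro hx
    rcases eq_or_ne x 0 with rfl | h₀
    · rfl
    · obtain ⟨y, hy⟩ := exists_isEdge (par := par) (ext := ext) x h₀ hx
      have hlt := hy.lt h
      refine (ih y hlt.1 (by omega)).trans (SimpleGraph.Adj.reachable ?_)
      rw [adj_iff h, val_vtx hx, val_vtx (by omega)]
      exact Or.inr hy

theorem isEdge_node (ha : 2 ≤ a) {s y : ℕ} (hs : s < S) : IsEdge S a par ext ((s + 1) * a) y ↔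
    y = s * a + (a - 1) ∨ ext s ≠ 0 ∧ y = ext s * a := by
  constructor
  · rintro (⟨t, -, i, hi, h₁, rfl⟩ | ⟨t, -, h, h₁, rfl⟩)
    · have : t = s := by
        -- The larger endpoint of a path edge does not depend on `par` and `ext`, so any functions
        -- may be inserted here.
        have h₂ := div_of_mem_segList (par := fun _ => 0) (ext := fun _ => 0)
          (p := (t * a + i + 1, pre a (fun _ => 0) t i)) (by omega)
          (mem_segList.mpr (Or.inl ⟨i, hi, rfl, rfl⟩))
        rw [← h₂]
        simp only [← h₁]
        exact Nat.div_eq_of_lt_le (by rw [add_mul]; omega) (by rw [add_mul]; omega)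
      subst this
      have hi' : i = a - 1 := by rw [add_mul] at h₁; omega
      left
      rw [pre, if_neg (by omega), hi']
    · have := Nat.eq_of_mul_eq_mul_right (by omega) h₁
      obtain rfl : t = s := by omega
      exact Or.inr ⟨h, rfl⟩
  · rintro (rfl | ⟨h, rfl⟩)
    · refine Or.inl ⟨s, hs, a - 1, by omega, by rw [add_mul]; omega, ?_⟩
      rw [pre, if_neg (by omega)]
    · exact Or.inr ⟨s, hs, h, rfl, rfl⟩

theorem mul_ne_mul_add (ha : 2 ≤ a) (k s : ℕ) : k * a ≠ s * a + (a - 1) := by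
  intro h
  have h₃ : s * a + a = k * a + 1 := by omega
  have h₄ : a ∣ 1 := (Nat.dvd_add_right (Dvd.intro_left k rfl)).mp (h₃ ▸ ⟨s + 1, by ring⟩)
  have := Nat.le_of_dvd one_pos h₄
  omega

theorem isEdge_update {s k : ℕ} (hs : s < S) (hk : k ≠ 0) (h₀ : ext s = 0) (x y : ℕ) :
    IsEdge S a par (Function.update ext s k) x y ↔
      IsEdge S a par ext x y ∨ x = (s + 1) * a ∧ y = k * a := by
  unfold IsEdge
  rw [or_assoc]
  refine or_congr_right ⟨?_, ?_⟩
  · rintro ⟨t, ht, h⟩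
    rcases eq_or_ne t s with rfl | hts
    · simp only [Function.update_self] at h
      exact Or.inr h.2
    · rw [Function.update_of_ne hts] at h
      exact Or.inl ⟨t, ht, h⟩
  · rintro (⟨t, ht, h⟩ | h)
    · have hts : t ≠ s := by
        rintro rfl
        exact h.1 h₀
      refine ⟨t, ht, ?_⟩
      rw [Function.update_of_ne hts]
      exact h
    · refine ⟨s, hs, ?_⟩
      simp only [Function.update_self]
      exact ⟨hk, h⟩

theorem Wf.update (h : Wf a par ext) {s k : ℕ} (hk : k ≤ s) :
    Wf a par (Function.update ext s k) := by
  refine ⟨h.two_le, h.par_le, fun t => ?_⟩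
  rcases eq_or_ne t s with rfl | hts
  · simpa using hk
  · rw [Function.update_of_ne hts]
    exact h.ext_le t

theorem node_le {k : ℕ} (hk : k ≤ S) : k * a ≤ S * a := Nat.mul_le_mul_right _ hk

theorem adj_node (h : Wf a par ext) {s : ℕ} (hs : s < S) (h₀ : ext s ≠ 0) :
    (graph S a par ext).Adj (vtx S a ((s + 1) * a)) (vtx S a (ext s * a)) := by
  rw [adj_iff h, val_vtx (node_le hs), val_vtx (node_le ((h.ext_le s).trans hs.le))]
  exact Or.inl (Or.inr ⟨s, hs, h₀, rfl, rfl⟩)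

theorem not_adj_node (h : Wf a par ext) {s k : ℕ} (hs : s < S) (hk : k ≤ s) (h₀ : ext s = 0) :
    ¬ (graph S a par ext).Adj (vtx S a ((s + 1) * a)) (vtx S a (k * a)) := by
  rw [adj_iff h, val_vtx (node_le hs), val_vtx (node_le (hk.trans hs.le)),
    isEdge_node h.two_le hs]
  rintro ((he | he) | he)
  · exact mul_ne_mul_add h.two_le _ _ he
  · exact he.1 h₀
  · have := Nat.lt_of_mul_lt_mul_right (he.lt h).1
    omega

theorem vtx_node_ne {s k : ℕ} (ha : 2 ≤ a) (hs : s < S) (hk : k ≤ s) :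
    vtx S a ((s + 1) * a) ≠ vtx S a (k * a) := by
  intro h
  have := congrArg Fin.val h
  rw [val_vtx (node_le hs), val_vtx (node_le (hk.trans hs.le))] at this
  have := Nat.eq_of_mul_eq_mul_right (by omega) this
  omega

/-- An update of the dynamic graph is a change of one value of `ext`; this keeps all intermediate
graphs within the same family. -/
theorem graph_update (h : Wf a par ext) {s k : ℕ} (hs : s < S) (hk₀ : k ≠ 0) (hk : k ≤ s)
    (h₀ : ext s = 0) :
    graph S a par (Function.update ext s k) =
      graph S a par ext ⊔ SimpleGraph.edge (vtx S a ((s + 1) * a)) (vtx S a (k * a)) := by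
  ext x y
  have hv (x : Fin (S * a + 1)) {k : ℕ} (hk : k ≤ S) : x = vtx S a (k * a) ↔ x.val = k * a := by
    rw [Fin.ext_iff, val_vtx (node_le hk)]
  rw [SimpleGraph.sup_adj, adj_iff (h.update hk), adj_iff h, isEdge_update hs hk₀ h₀,
    isEdge_update hs hk₀ h₀, SimpleGraph.edge_adj, ← hv x hs, ← hv y hs,
    ← hv x (hk.trans hs.le), ← hv y (hk.trans hs.le)]
  have hne := vtx_node_ne h.two_le hs hk
  constructor
  · rintro ((h | ⟨rfl, rfl⟩) | (h | ⟨rfl, rfl⟩))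
    · exact Or.inl (Or.inl h)
    · exact Or.inr ⟨by simp, hne⟩
    · exact Or.inl (Or.inr h)
    · exact Or.inr ⟨by simp, hne.symm⟩
  · rintro ((h | h) | ⟨⟨rfl, rfl⟩ | ⟨rfl, rfl⟩, -⟩)
    · exact Or.inl (Or.inl h)
    · exact Or.inr (Or.inl h)
    · exact Or.inl (Or.inr ⟨rfl, rfl⟩)
    · exact Or.inr (Or.inr ⟨rfl, rfl⟩)

/-- A deletion is an insertion read backwards: putting the edge back recovers the original `ext`. -/
theorem graph_update_zero (h : Wf a par ext) {s : ℕ} (hs : s < S) (h₀ : ext s ≠ 0) :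
    graph S a par (Function.update ext s 0) =
      (graph S a par ext).deleteEdges {s(vtx S a ((s + 1) * a), vtx S a (ext s * a))} := by
  have h' : Wf a par (Function.update ext s 0) := h.update (Nat.zero_le _)
  have h₁ := graph_update h' hs h₀ (h.ext_le s) (by simp)
  rw [Function.update_idem, Function.update_eq_self] at h₁
  have h₂ := not_adj_node h' hs (h.ext_le s) (by simp)
  rw [h₁]
  ext x y
  simp only [SimpleGraph.deleteEdges_adj, SimpleGraph.sup_adj, SimpleGraph.edge_adj,
    Set.mem_singleton_iff, Sym2.eq_iff]
  constructor
  · intro hxy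
    refine ⟨Or.inl hxy, ?_⟩
    rintro (⟨rfl, rfl⟩ | ⟨rfl, rfl⟩)
    · exact h₂ hxy
    · exact h₂ hxy.symm
  · rintro ⟨hxy | ⟨hxy, -⟩, hne⟩
    · exact hxy
    · exact absurd hxy hne

/-! ### Distances -/

/-- The extension to the vertices of a function on the nodes. -/
def extend (a : ℕ) (par : ℕ → ℕ) (E : ℕ → ℤ) (x : ℕ) : ℤ :=
  if x = 0 then E 0 else
    interp (E (par ((x - 1) / a))) (E ((x - 1) / a + 1)) ((x - 1) % a + 1 : ℕ)

theorem extend_inner {E : ℕ → ℤ} {s i : ℕ} (hi : i < a) : extend a par E (s * a + i + 1) =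
    interp (E (par s)) (E (s + 1)) (i + 1 : ℕ) := by
  rw [extend, if_neg (by omega), Nat.add_sub_cancel, mul_comm s a,
    Nat.mul_add_div (by omega), Nat.mul_add_mod, Nat.div_eq_of_lt hi, Nat.mod_eq_of_lt hi,
    add_zero]

theorem extend_node {E : ℕ → ℤ} (ha : 2 ≤ a)
    (hE : ∀ s < S, E (s + 1) ≤ E (par s) + a ∧ E (par s) ≤ E (s + 1) + a) {k : ℕ} (hk : k ≤ S) :
    extend a par E (k * a) = E k := by
  rcases k with _ | s
  · simp [extend]
  · have : (s + 1) * a = s * a + (a - 1) + 1 := by rw [add_mul]; omega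
    rw [this, extend_inner (by omega), Nat.sub_add_cancel (by omega)]
    exact interp_eq_right (hE s hk).1 (hE s hk).2

/-- Interpolation along the segments reduces a lower bound for distances to inequalities between
nodes, one for each segment and one for each extra edge. -/
theorem le_edist_node {E : ℕ → ℤ} (h : Wf a par ext)
    (hE : ∀ s < S, E (s + 1) ≤ E (par s) + a ∧ E (par s) ≤ E (s + 1) + a)
    (hE' : ∀ s < S, ext s ≠ 0 → E (s + 1) ≤ E (ext s) + 1 ∧ E (ext s) ≤ E (s + 1) + 1)
    {k l d : ℕ} (hk : k ≤ S) (hl : l ≤ S) (hd : E k + d ≤ E l) :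
    (d : ℕ∞) ≤ (graph S a par ext).edist (vtx S a (k * a)) (vtx S a (l * a)) := by
  have ha := h.two_le
  refine SimpleGraph.le_edist_of_lipschitz (fun x => extend a par E x.val) ?_ ?_
  · have key (x y : ℕ) (he : IsEdge S a par ext x y) : extend a par E y ≤ extend a par E x + 1 ∧
        extend a par E x ≤ extend a par E y + 1 := by
      rcases he with ⟨s, hs, i, hi, rfl, rfl⟩ | ⟨s, hs, h₀, rfl, rfl⟩
      · have : extend a par E (pre a par s i) = interp (E (par s)) (E (s + 1)) i := by
          unfold pre
          split_ifs with hi₀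
          · rw [extend_node ha hE ((h.par_le s).trans hs.le), hi₀]
            simp [interp_zero]
          · obtain ⟨j, rfl⟩ := Nat.exists_eq_succ_of_ne_zero hi₀
            exact extend_inner (by omega)
        rw [this, extend_inner hi]
        push_cast
        exact ⟨interp_le_succ _ _ (by positivity), interp_succ_le _ _ _⟩
      · rw [extend_node ha hE hs, extend_node ha hE ((h.ext_le s).trans hs.le)]
        exact (hE' s hs h₀).symm
    intro x y hxy
    rcases (adj_iff h).mp hxy with he | he
    · exact (key _ _ he).1
    · exact (key _ _ he).2
  · simp only [val_vtx (node_le hk), val_vtx (node_le hl)]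
    rw [extend_node ha hE hk, extend_node ha hE hl]
    exact hd

theorem edist_step {α : Type*} {G : SimpleGraph α} {x y z : α} {k l m : ℕ}
    (h₁ : G.edist x y ≤ k) (h₂ : G.edist y z ≤ l) (h : k + l ≤ m) : G.edist x z ≤ m :=
  (SimpleGraph.edist_triangle.trans (add_le_add h₁ h₂)).trans (by exact_mod_cast h)

theorem edist_isEdge_le (h : Wf a par ext) {x y : ℕ} (he : IsEdge S a par ext x y) :
    (graph S a par ext).edist (vtx S a y) (vtx S a x) ≤ (1 : ℕ) := by
  have hlt := he.lt h
  refine SimpleGraph.edist_le_one_iff_adj_or_eq.mpr (Or.inl ?_)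
  rw [adj_iff h, val_vtx (by omega), val_vtx (by omega)]
  exact Or.inr he

theorem edist_par_le (h : Wf a par ext) {s : ℕ} (hs : s < S) (i : ℕ) (hi : i < a) :
    (graph S a par ext).edist (vtx S a (par s * a)) (vtx S a (s * a + i + 1)) ≤ (i + 1 : ℕ) := by
  induction i with
  | zero => exact edist_isEdge_le h (Or.inl ⟨s, hs, 0, hi, rfl, by simp [pre]⟩)
  | succ i ih =>
    refine edist_step (ih (by omega)) (edist_isEdge_le h ?_) le_rfl
    exact Or.inl ⟨s, hs, i + 1, hi, rfl, by simp [pre, add_assoc]⟩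

theorem edist_end_le (h : Wf a par ext) {s : ℕ} (hs : s < S) (k : ℕ) (hk : k < a) :
    (graph S a par ext).edist (vtx S a ((s + 1) * a)) (vtx S a ((s + 1) * a - k)) ≤ k := by
  induction k with
  | zero => simp
  | succ k ih =>
    refine edist_step (ih (by omega)) ?_ (l := 1) le_rfl
    rw [SimpleGraph.edist_comm]
    refine edist_isEdge_le h (Or.inl ⟨s, hs, a - 1 - k, by omega, ?_, ?_⟩)
    · rw [add_mul]; omega
    · rw [pre, if_neg (by omega), add_mul]; omega

theorem edist_seg_le (h : Wf a par ext) {s : ℕ} (hs : s < S) :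
    (graph S a par ext).edist (vtx S a (par s * a)) (vtx S a ((s + 1) * a)) ≤ a := by
  have ha := h.two_le
  have := edist_par_le h hs (a - 1) (by omega)
  rwa [Nat.sub_add_cancel (by omega), show s * a + (a - 1) + 1 = (s + 1) * a by
    rw [add_mul]; omega] at this

theorem edist_ext_le (h : Wf a par ext) {s : ℕ} (hs : s < S) (h₀ : ext s ≠ 0) :
    (graph S a par ext).edist (vtx S a ((s + 1) * a)) (vtx S a (ext s * a)) ≤ (1 : ℕ) := by
  rw [SimpleGraph.edist_comm]
  exact edist_isEdge_le h (Or.inr ⟨s, hs, h₀, rfl, rfl⟩)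

/-- Every vertex except 0 lies on a segment and is within `a` of either end; so it is enough that
each segment has one end close to `x`. -/
theorem eccent_le (h : Wf a par ext) {x : Fin (S * a + 1)} {d : ℕ}
    (h₀ : (graph S a par ext).edist x (vtx S a 0) ≤ d)
    (hp : ∀ s < S, (graph S a par ext).edist x (vtx S a (par s * a)) ≤ d ∨
      (graph S a par ext).edist x (vtx S a ((s + 1) * a)) ≤ d) :
    (graph S a par ext).eccent x ≤ (d + a : ℕ) := by
  rw [SimpleGraph.eccent_le_iff]
  intro y
  rw [← vtx_val y]
  rcases eq_or_ne y.val 0 with hy | hy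
  · rw [hy]
    exact h₀.trans (by norm_cast; omega)
  · have hyS : y.val ≤ S * a := by omega
    have ha := h.two_le
    obtain ⟨s, hs, i, hi, hx⟩ : ∃ s < S, ∃ i < a, y.val = s * a + i + 1 := by
      refine ⟨(y.val - 1) / a, Nat.div_lt_of_lt_mul (by have := mul_comm a S; omega),
        (y.val - 1) % a, Nat.mod_lt _ (by omega), ?_⟩
      have := Nat.div_add_mod' (y.val - 1) a
      omega
    rcases hp s hs with hp | hp
    · rw [hx]
      exact edist_step hp (edist_par_le h hs i hi) (by omega)
    · rw [show y.val = (s + 1) * a - (a - 1 - i) by rw [add_mul]; omega]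
      exact edist_step hp (edist_end_le h hs (a - 1 - i) (by omega)) (by omega)

end SegGraph

/-! ## The graphs of the reduction

Segments come in blocks of `m + 4`.  Block `b < m` belongs to coordinate `b` and contains the two
coordinate nodes; the next `M` blocks belong to the first family of vectors, the following `M`
blocks to the second one, and the rest is padding. -/

namespace Reduction

/-- Node 0 is the hub. In the block of coordinate `c`, nodes 2 and 4 (counted from the start of the
block) are `c_U` and `c_V`, each at the end of two consecutive segments from the hub. In the block
of `u`, node 1 represents `u`, and all further segments start there. In the block of `v`, segments
0, 1, 2 run from the hub to the start `v^0` of `v` (node 3), segment 3 leads to its end `v^a` (node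
4), and the segments from 4 on start at `v^0`. The paths to the hub make the graph connected
whatever the stage. -/
def parBJ (m M b j : ℕ) : ℕ :=
  if b < m then if j % 2 = 1 then b * (m + 4) + j else 0
  else if b < m + M then if j = 0 then 0 else b * (m + 4) + 1
  else if b < m + 2 * M then if j = 0 then 0 else b * (m + 4) + min j 3
  else 0

/-- Segment `c + 4` of a vector is its arm for coordinate `c`. The arm is present in any case, which
keeps the numbering arithmetical, and its tip is joined to `c_U` or `c_V` if the vector has that
coordinate. Segment 3 of a coordinate block carries the stage edge between `c_V` and `c_U`. -/
def extBJ (m M : ℕ) (bu bv : ℕ → ℕ → Bool) (T : ℕ → Bool) (b j : ℕ) : ℕ :=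
  if b < m then if j = 3 ∧ T b then b * (m + 4) + 2 else 0
  else if b < m + M then if 4 ≤ j ∧ bu (b - m) (j - 4) then (j - 4) * (m + 4) + 2 else 0
  else if b < m + 2 * M then
    if 4 ≤ j ∧ bv (b - m - M) (j - 4) then (j - 4) * (m + 4) + 4 else 0
  else 0

def par (m M s : ℕ) : ℕ := parBJ m M (s / (m + 4)) (s % (m + 4))

def ext (m M : ℕ) (bu bv : ℕ → ℕ → Bool) (T : ℕ → Bool) (s : ℕ) : ℕ :=
  extBJ m M bu bv T (s / (m + 4)) (s % (m + 4))

/-- The number of segments. -/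
def segs (m M pad : ℕ) : ℕ := (m + 2 * M + pad) * (m + 4)

/-- The graph in the stage `T`. -/
def stageGraph (a m M pad : ℕ) (bu bv : ℕ → ℕ → Bool) (T : ℕ → Bool) :
    SimpleGraph (Fin (segs m M pad * a + 1)) :=
  SegGraph.graph (segs m M pad) a (par m M) (ext m M bu bv T)

/-- The vertex at node `k`. -/
def node (a m M pad k : ℕ) : Fin (segs m M pad * a + 1) := SegGraph.vtx (segs m M pad) a (k * a)

variable {a m M pad : ℕ} {bu bv : ℕ → ℕ → Bool} {T : ℕ → Bool}

theorem divmod {J b j : ℕ} (hj : j < J) : (b * J + j) / J = b ∧ (b * J + j) % J = j := by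
  rw [mul_comm, Nat.mul_add_div (by omega), Nat.mul_add_mod, Nat.div_eq_of_lt hj,
    Nat.mod_eq_of_lt hj]
  simp

theorem par_eq {b j : ℕ} (hj : j < m + 4) : par m M (b * (m + 4) + j) = parBJ m M b j := by
  rw [par, (divmod hj).1, (divmod hj).2]

theorem ext_eq {b j : ℕ} (hj : j < m + 4) :
    ext m M bu bv T (b * (m + 4) + j) = extBJ m M bu bv T b j := by
  rw [ext, (divmod hj).1, (divmod hj).2]

theorem exists_block (m s : ℕ) : ∃ b j, j < m + 4 ∧ s = b * (m + 4) + j :=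
  ⟨s / (m + 4), s % (m + 4), Nat.mod_lt _ (by omega), (Nat.div_add_mod' _ _).symm⟩

theorem block_lt {b B J j : ℕ} (hb : b < B) (hj : j < J) : b * J + j < B * J := by
  have : (b + 1) * J ≤ B * J := Nat.mul_le_mul_right _ hb
  rw [add_mul] at this
  omega

theorem wf (ha : 2 ≤ a) : SegGraph.Wf a (par m M) (ext m M bu bv T) := by
  refine ⟨ha, fun s => ?_, fun s => ?_⟩
  · obtain ⟨b, j, hj, rfl⟩ := exists_block m s
    rw [par_eq hj, parBJ]
    split_ifs <;> omega
  · obtain ⟨b, j, hj, rfl⟩ := exists_block m s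
    rw [ext_eq hj, extBJ]
    split_ifs with h₁ h₂ h₃ h₄ h₅ h₆
    · omega
    · omega
    · have := block_lt (b := j - 4) (B := b) (J := m + 4) (j := 2) (by omega) (by omega)
      omega
    · omega
    · have := Nat.mul_le_mul_right (m + 4) (show j - 4 ≤ b by omega)
      omega
    · omega
    · omega

/-- One bit of the stage is one value of `ext`, so passing to another stage costs one update per
changed coordinate. -/
theorem ext_update {c : ℕ} (hc : c < m) (t : Bool) :
    ext m M bu bv (Function.update T c t) =
      Function.update (ext m M bu bv T) (c * (m + 4) + 3)
        (if t then c * (m + 4) + 2 else 0) := by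
  funext s
  obtain ⟨b, j, hj, rfl⟩ := exists_block m s
  rw [ext_eq hj]
  rcases eq_or_ne (b * (m + 4) + j) (c * (m + 4) + 3) with h | h
  · have h₁ := (divmod (b := b) hj).1
    have h₂ := (divmod (b := b) hj).2
    rw [h] at h₁ h₂ ⊢
    rw [(divmod (by omega)).1] at h₁
    rw [(divmod (by omega)).2] at h₂
    subst h₁ h₂
    simp [extBJ, hc]
  · rw [Function.update_of_ne h, ext_eq hj, extBJ, extBJ]
    have : j = 3 ∧ Function.update T c t b = true ↔ j = 3 ∧ T b = true := by
      refine and_congr_right fun h₃ => ?_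
      rw [Function.update_of_ne]
      rintro rfl
      exact h (by rw [h₃])
    simp only [this]

theorem block_lt_segs {b j : ℕ} (hb : b < m + 2 * M) (hj : j < m + 4) :
    b * (m + 4) + j < segs m M pad :=
  block_lt (by omega) hj

theorem ext_coord {c : ℕ} (hc : c < m) :
    ext m M bu bv T (c * (m + 4) + 3) = if T c then c * (m + 4) + 2 else 0 := by
  rw [ext_eq (by omega), extBJ, if_pos hc]
  simp

/-- Inserting the stage edge at coordinate `c`. -/
theorem stageGraph_insert (ha : 2 ≤ a) {c : ℕ} (hc : c < m) (hT : T c = false) :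
    (DynGraph.Op.insert (node a m M pad (c * (m + 4) + 4))
      (node a m M pad (c * (m + 4) + 2))).Allowed (stageGraph a m M pad bu bv T) ∧
    (DynGraph.Op.insert (node a m M pad (c * (m + 4) + 4))
      (node a m M pad (c * (m + 4) + 2))).apply (stageGraph a m M pad bu bv T) =
      stageGraph a m M pad bu bv (Function.update T c true) := by
  have hw : SegGraph.Wf a (par m M) (ext m M bu bv T) := wf ha
  have hs : c * (m + 4) + 3 < segs m M pad := block_lt_segs (by omega) (by omega)
  have h₀ : ext m M bu bv T (c * (m + 4) + 3) = 0 := by rw [ext_coord hc, hT]; rfl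
  refine ⟨⟨SegGraph.vtx_node_ne ha hs (by omega), SegGraph.not_adj_node hw hs (by omega) h₀⟩, ?_⟩
  rw [stageGraph, stageGraph, ext_update hc, if_pos rfl,
    SegGraph.graph_update hw hs (by omega) (by omega) h₀]
  rfl

theorem stageGraph_delete (ha : 2 ≤ a) {c : ℕ} (hc : c < m) (hT : T c = true) :
    (DynGraph.Op.delete (node a m M pad (c * (m + 4) + 4))
      (node a m M pad (c * (m + 4) + 2))).Allowed (stageGraph a m M pad bu bv T) ∧
    (DynGraph.Op.delete (node a m M pad (c * (m + 4) + 4))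
      (node a m M pad (c * (m + 4) + 2))).apply (stageGraph a m M pad bu bv T) =
      stageGraph a m M pad bu bv (Function.update T c false) := by
  have hw : SegGraph.Wf a (par m M) (ext m M bu bv T) := wf ha
  have hs : c * (m + 4) + 3 < segs m M pad := block_lt_segs (by omega) (by omega)
  have h₀ : ext m M bu bv T (c * (m + 4) + 3) = c * (m + 4) + 2 := by
    rw [ext_coord hc, hT]; rfl
  constructor
  · have := SegGraph.adj_node hw hs (by omega)
    rw [h₀] at this
    exact this
  · rw [stageGraph, stageGraph, ext_update hc, if_neg (by simp),
      SegGraph.graph_update_zero hw hs (by omega), h₀]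
    rfl

theorem stageGraph_connected (ha : 2 ≤ a) : (stageGraph a m M pad bu bv T).Connected :=
  SegGraph.connected (wf ha)

theorem stageGraph_ncard_le (ha : 2 ≤ a) : (stageGraph a m M pad bu bv T).edgeSet.ncard ≤
    2 * (segs m M pad * a + 1) :=
  SegGraph.ncard_edgeSet_le (wf ha)

/-! ### Eccentricities -/

/-- Lower bounds for the distances from the node of `u`, for a pair `u`, `v` that is orthogonal
with respect to `T`. -/
def potBJ (a m M : ℕ) (bu : ℕ → ℕ → Bool) (T : ℕ → Bool) (u v b j : ℕ) : ℤ :=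
  if b < m then
    if j = 1 then if bu u b then a else 3 * a
    else if j = 3 then if bu u b ∧ T b then a else 3 * a
    else 2 * a
  else if b = m + u then if j = 0 then 0 else a
  else if b < m + M then
    if 4 ≤ j then if bu u (j - 4) then a else 3 * a else 2 * a
  else if b = m + M + v then
    if j ≤ 3 then (2 + j) * a else 3 * a
  else if b < m + 2 * M then
    if 4 ≤ j then if bu u (j - 4) ∧ T (j - 4) then a else 3 * a else 2 * a
  else 2 * a

def pot (a m M : ℕ) (bu : ℕ → ℕ → Bool) (T : ℕ → Bool) (u v : ℕ) : ℕ → ℤ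
  | 0 => a
  | s + 1 => potBJ a m M bu T u v (s / (m + 4)) (s % (m + 4))

theorem pot_eq {u v b j : ℕ} (hj : j < m + 4) :
    pot a m M bu T u v (b * (m + 4) + j + 1) = potBJ a m M bu T u v b j := by
  rw [pot, (divmod hj).1, (divmod hj).2]

theorem pot_par {u v b j : ℕ} (hj : j < m + 4) :
    pot a m M bu T u v (parBJ m M b j) =
      if b < m then if j % 2 = 1 then potBJ a m M bu T u v b (j - 1) else a
      else if b < m + M then if j = 0 then (a : ℤ) else potBJ a m M bu T u v b 0
      else if b < m + 2 * M then
        if j = 0 then (a : ℤ) else potBJ a m M bu T u v b (min j 3 - 1)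
      else a := by
  unfold parBJ
  split_ifs with h₁ h₂ h₃ h₄ h₅ h₆
  · rw [← pot_eq (by omega)]; congr 1; omega
  · rfl
  · rfl
  · rw [← pot_eq (by omega)]
  · rfl
  · rw [← pot_eq (by omega)]; congr 1; omega
  · rfl

/-- All values are multiples of `a`, and an intermediate node has value `2 * a`, so that its
continuation may end at `a` or at `3 * a`. Towards `v` the values climb from `a` at the hub to `5 *
a` in four segments: the path through the hub gives no shortcut. -/
theorem pot_par_near {u v b j : ℕ} (hu : u < M) (hv : v < M) (hj : j < m + 4) :
    potBJ a m M bu T u v b j ≤ pot a m M bu T u v (parBJ m M b j) + a ∧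
      pot a m M bu T u v (parBJ m M b j) ≤ potBJ a m M bu T u v b j + a := by
  rw [pot_par hj]
  by_cases h₁ : b < m
  · simp only [potBJ, h₁, if_true]
    split_ifs <;> omega
  · by_cases h₂ : b = m + u
    · simp only [potBJ, h₂, show ¬ m + u < m by omega, if_true, if_false,
        show m + u < m + M by omega]
      split_ifs <;> omega
    · by_cases h₃ : b < m + M
      · simp only [potBJ, h₁, h₂, h₃, if_true, if_false]
        split_ifs <;> omega
      · by_cases h₄ : b = m + M + v
        · simp only [potBJ, h₁, h₂, h₃, if_false, if_pos h₄]
          rw [if_pos (show b < m + 2 * M by omega)]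
          rcases Nat.lt_or_ge j 4 with h | h
          · interval_cases j <;> norm_num <;> omega
          · rw [if_neg (by omega), if_neg (by omega),
              show min j 3 - 1 = 2 by omega]
            push_cast
            omega
        · by_cases h₅ : b < m + 2 * M
          · simp only [potBJ, h₁, h₂, h₃, h₄, h₅, if_true, if_false]
            split_ifs <;> omega
          · simp only [potBJ, h₁, h₂, h₃, h₄, h₅, if_true, if_false]
            omega

/-- Extra edges join nodes of equal potential and so contribute nothing to the lower bound.
Orthogonality is needed for the arms of `v`: their tips have value `3 * a`, so an adjacent `c_V`
must not have value `a`. -/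
theorem pot_ext_near {u v b j : ℕ} (hu : u < M) (hj : j < m + 4)
    (h : ∀ c < m, ¬ (bu u c ∧ bv v c ∧ T c)) (h₀ : extBJ m M bu bv T b j ≠ 0) :
    potBJ a m M bu T u v b j = pot a m M bu T u v (extBJ m M bu bv T b j) := by
  have h₂ (c : ℕ) : pot a m M bu T u v (c * (m + 4) + 2) = potBJ a m M bu T u v c 1 :=
    pot_eq (by omega)
  have h₄ (c : ℕ) : pot a m M bu T u v (c * (m + 4) + 4) = potBJ a m M bu T u v c 3 :=
    pot_eq (by omega)
  by_cases g₁ : b < m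
  · have e : extBJ m M bu bv T b j = if j = 3 ∧ T b then b * (m + 4) + 2 else 0 := by
      simp [extBJ, g₁]
    rw [e] at h₀ ⊢
    split_ifs at h₀ ⊢ with g₂
    · rw [h₂]
      simp [potBJ, g₁, g₂]
    · exact absurd rfl h₀
  by_cases g₃ : b < m + M
  · have e : extBJ m M bu bv T b j =
        if 4 ≤ j ∧ bu (b - m) (j - 4) then (j - 4) * (m + 4) + 2 else 0 := by
      simp [extBJ, g₁, g₃]
    rw [e] at h₀ ⊢
    split_ifs at h₀ ⊢ with g₄
    · rw [h₂]
      simp only [potBJ, g₁, g₃, g₄.1, show j - 4 < m by omega, if_true, if_false]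
      by_cases k₁ : b = m + u
      · have := g₄.2
        rw [k₁, Nat.add_sub_cancel_left] at this
        simp [k₁, this]
        omega
      · simp [k₁]
    · exact absurd rfl h₀
  by_cases g₅ : b < m + 2 * M
  · have e : extBJ m M bu bv T b j =
        if 4 ≤ j ∧ bv (b - m - M) (j - 4) then (j - 4) * (m + 4) + 4 else 0 := by
      simp [extBJ, g₁, g₃, g₅]
    rw [e] at h₀ ⊢
    split_ifs at h₀ ⊢ with g₆
    · rw [h₄]
      have hc := h (j - 4) (by omega)
      simp only [potBJ, g₁, g₃, g₅, g₆.1, show j - 4 < m by omega, if_true, if_false,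
        show ¬ b = m + u by omega]
      by_cases k₁ : b = m + M + v
      · have := g₆.2
        rw [k₁, show m + M + v - m - M = v by omega] at this
        have hc' : ¬ (bu u (j - 4) = true ∧ T (j - 4) = true) := fun k => hc ⟨k.1, this, k.2⟩
        simp [k₁, hc']
        omega
      · simp [k₁]
    · exact absurd rfl h₀
  · simp [extBJ, g₁, g₃, g₅] at h₀

/-- The potential is 0 at the node of `u` and `5 * a` at the far end of `v`. -/
theorem le_eccent (ha : 2 ≤ a) {u v : ℕ} (hu : u < M) (hv : v < M)
    (h : ∀ c < m, ¬ (bu u c ∧ bv v c ∧ T c)) :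
    ((5 * a : ℕ) : ℕ∞) ≤ (stageGraph a m M pad bu bv T).eccent
      (node a m M pad ((m + u) * (m + 4) + 1)) := by
  refine le_trans ?_ (SimpleGraph.edist_le_eccent
    (v := node a m M pad ((m + M + v) * (m + 4) + 4)))
  refine SegGraph.le_edist_node (E := pot a m M bu T u v) (wf ha) ?_ ?_
    (block_lt_segs (b := m + u) (j := 0) (by omega) (by omega))
    (block_lt_segs (b := m + M + v) (j := 3) (by omega) (by omega)) ?_
  · intro s hs
    obtain ⟨b, j, hj, rfl⟩ := exists_block m s
    rw [pot_eq hj, par_eq hj]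
    exact pot_par_near hu hv hj
  · intro s hs h₀
    obtain ⟨b, j, hj, rfl⟩ := exists_block m s
    rw [ext_eq hj] at h₀ ⊢
    rw [pot_eq hj, pot_ext_near hu hj h h₀]
    omega
  · have h₁ := pot_eq (a := a) (M := M) (bu := bu) (T := T) (u := u) (v := v) (b := m + u) (j := 0)
      (show 0 < m + 4 by omega)
    have h₂ := pot_eq (a := a) (M := M) (bu := bu) (T := T) (u := u) (v := v) (b := m + M + v)
      (j := 3) (show 3 < m + 4 by omega)
    simp only [add_zero, add_assoc, Nat.reduceAdd] at h₁ h₂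
    simp only [← add_assoc] at h₁ h₂
    rw [h₁, h₂]
    simp only [potBJ, show ¬ m + u < m by omega, show ¬ m + M + v < m by omega,
      show ¬ m + M + v = m + u by omega, show ¬ m + M + v < m + M by omega, if_true, if_false]
    norm_num

/-- A common coordinate leads from `u` to the start of any `v` in `2 * a + 3` steps: two arms and
three single edges. The other relevant nodes are close to the hub, which is at distance at most `a`.
So every segment has an end within `2 * a + 3`. -/
theorem eccent_le (ha : 2 ≤ a) (h : ∀ u < M, ∀ v < M, ∃ c < m, bu u c ∧ bv v c ∧ T c)
    {u : ℕ} (hu : u < M) :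
    (stageGraph a m M pad bu bv T).eccent (node a m M pad ((m + u) * (m + 4) + 1)) ≤
      ((3 * a + 3 : ℕ) : ℕ∞) := by
  have hw : SegGraph.Wf a (par m M) (ext m M bu bv T) := wf ha
  set x := node a m M pad ((m + u) * (m + 4) + 1) with hx
  set G := stageGraph a m M pad bu bv T with hG
  have seg {b j : ℕ} (hb : b < m + 2 * M) (hj : j < m + 4) :
      G.edist (node a m M pad (parBJ m M b j)) (node a m M pad (b * (m + 4) + j + 1)) ≤ a := by
    have := SegGraph.edist_seg_le hw (block_lt_segs (pad := pad) hb hj)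
    rwa [par_eq hj] at this
  have extE {b j : ℕ} (hb : b < m + 2 * M) (hj : j < m + 4)
      (h₀ : extBJ m M bu bv T b j ≠ 0) :
      G.edist (node a m M pad (b * (m + 4) + j + 1))
        (node a m M pad (extBJ m M bu bv T b j)) ≤ (1 : ℕ) := by
    have := SegGraph.edist_ext_le hw (block_lt_segs (pad := pad) hb hj)
    rw [ext_eq hj] at this
    exact this h₀
  have root : G.edist x (node a m M pad 0) ≤ a := by
    have := seg (b := m + u) (j := 0) (by omega) (by omega)
    rw [show parBJ m M (m + u) 0 = 0 by simp [parBJ]] at this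
    rw [SimpleGraph.edist_comm]
    exact this
  have uNode {u' : ℕ} (hu' : u' < M) :
      G.edist x (node a m M pad ((m + u') * (m + 4) + 1)) ≤ (2 * a : ℕ) := by
    have := seg (b := m + u') (j := 0) (by omega) (by omega)
    rw [show parBJ m M (m + u') 0 = 0 by simp [parBJ]] at this
    exact SegGraph.edist_step root this (by omega)
  have vNode {v : ℕ} (hv : v < M) :
      G.edist x (node a m M pad ((m + M + v) * (m + 4) + 3)) ≤ (2 * a + 3 : ℕ) := by
    obtain ⟨c, hc, h₁, h₂, h₃⟩ := h u hu v hv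
    have s₁ := seg (b := m + u) (j := 4 + c) (by omega) (by omega)
    have e₁ : parBJ m M (m + u) (4 + c) = (m + u) * (m + 4) + 1 := by
      simp [parBJ, hu]
    have s₂ := extE (b := m + u) (j := 4 + c) (by omega) (by omega)
    have e₂ : extBJ m M bu bv T (m + u) (4 + c) = c * (m + 4) + 2 := by
      simp [extBJ, hu, h₁]
    have s₃ := extE (b := c) (j := 3) (by omega) (by omega)
    have e₃ : extBJ m M bu bv T c 3 = c * (m + 4) + 2 := by
      simp [extBJ, hc, h₃]
    have s₄ := extE (b := m + M + v) (j := 4 + c) (by omega) (by omega)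
    have e₄ : extBJ m M bu bv T (m + M + v) (4 + c) = c * (m + 4) + 4 := by
      simp [extBJ, show ¬ m + M + v < m by omega, show m + M + v < m + 2 * M by omega,
        show m + M + v - m - M = v by omega, h₂]
    have s₅ := seg (b := m + M + v) (j := 4 + c) (by omega) (by omega)
    have e₅ : parBJ m M (m + M + v) (4 + c) = (m + M + v) * (m + 4) + 3 := by
      simp [parBJ, show ¬ m + M + v < m by omega, show m + M + v < m + 2 * M by omega]
      omega
    rw [e₁] at s₁
    rw [e₂] at s₂
    rw [e₃] at s₃
    rw [e₄] at s₄
    rw [e₅] at s₅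
    rw [SimpleGraph.edist_comm] at s₃ s₄ s₅
    exact SegGraph.edist_step (SegGraph.edist_step (SegGraph.edist_step (SegGraph.edist_step s₁
      (s₂ (by omega)) le_rfl) (s₃ (by omega)) le_rfl) (s₄ (by omega)) le_rfl) s₅ (by omega)
  have root' : G.edist x (node a m M pad 0) ≤ (2 * a + 3 : ℕ) :=
    root.trans (by norm_cast; omega)
  have main := SegGraph.eccent_le (S := segs m M pad) (x := x) (d := 2 * a + 3) hw
    (by rw [node, zero_mul] at root'; exact root') ?_
  · exact main.trans (by norm_cast; omega)
  · intro s hs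
    obtain ⟨b, j, hj, rfl⟩ := exists_block m s
    rw [par_eq hj]
    change G.edist x (node a m M pad (parBJ m M b j)) ≤ _ ∨
      G.edist x (node a m M pad (b * (m + 4) + j + 1)) ≤ _
    -- The one segment to be entered from its far end: its first node lies two segments behind the
    -- hub, whereas its last node is the start of `v`.
    by_cases hb : m + M ≤ b ∧ b < m + 2 * M ∧ j = 2
    · right
      have := vNode (v := b - m - M) (by omega)
      rw [hb.2.2]
      rwa [show m + M + (b - m - M) = b by omega] at this
    left
    by_cases h₁ : b < m
    · by_cases h₂ : j % 2 = 1
      · have h₃ := seg (b := b) (j := j - 1) (by omega) (by omega)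
        rw [show parBJ m M b (j - 1) = 0 by simp [parBJ, h₁]; omega,
          show b * (m + 4) + (j - 1) + 1 = b * (m + 4) + j by omega] at h₃
        rw [show parBJ m M b j = b * (m + 4) + j by simp [parBJ, h₁, h₂]]
        exact SegGraph.edist_step root h₃ (by omega)
      · rw [show parBJ m M b j = 0 by simp [parBJ, h₁, h₂]]
        exact root'
    · by_cases h₂ : b < m + M
      · by_cases h₃ : j = 0
        · rw [show parBJ m M b j = 0 by simp [parBJ, h₁, h₂, h₃]]
          exact root'
        · rw [show parBJ m M b j = b * (m + 4) + 1 by simp [parBJ, h₁, h₂, h₃]]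
          have := uNode (u' := b - m) (by omega)
          rw [show m + (b - m) = b by omega] at this
          exact this.trans (by norm_cast; omega)
      · by_cases h₃ : b < m + 2 * M
        · by_cases h₄ : j = 0
          · rw [show parBJ m M b j = 0 by simp [parBJ, h₁, h₂, h₃, h₄]]
            exact root'
          · rw [show parBJ m M b j = b * (m + 4) + min j 3 by simp [parBJ, h₁, h₂, h₃, h₄]]
            have s₁ := seg (b := b) (j := 0) (by omega) (by omega)
            rw [show parBJ m M b 0 = 0 by simp [parBJ, h₁, h₂, h₃]] at s₁
            have s₂ := SegGraph.edist_step root s₁ le_rfl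
            by_cases h₅ : j = 1
            · rw [h₅]
              exact s₂.trans (by norm_cast; omega)
            · rw [show min j 3 = 3 by omega]
              have := vNode (v := b - m - M) (by omega)
              rwa [show m + M + (b - m - M) = b by omega] at this
        · rw [show parBJ m M b j = 0 by simp [parBJ, h₁, h₂, h₃]]
          exact root'

end Reduction

/-! ## Reasoning about programs -/

namespace WordRAM

infixr:60 " ;; " => Cmd.seq

@[simp] theorem State.reg_setReg (s : State) (x k y : ℕ) :
    (s.setReg x k).reg y = if y = x then k else s.reg y := by
  simp [State.setReg, Function.update_apply]

@[simp] theorem State.arr_setReg (s : State) (x k : ℕ) : (s.setReg x k).arr = s.arr := rfl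

@[simp] theorem State.used_setReg (s : State) (x k : ℕ) : (s.setReg x k).used = s.used := rfl

@[simp] theorem State.reg_setArr (s : State) (a i k : ℕ) : (s.setArr a i k).reg = s.reg := rfl

theorem State.arr_setArr (s : State) (a i k b j : ℕ) :
    (s.setArr a i k).arr b j = if b = a ∧ j = i then k else s.arr b j := by
  rcases eq_or_ne b a with rfl | h
  · simp [State.setArr, Function.update_apply]
  · simp [State.setArr, h]

theorem State.arr_setArr_of_ne (s : State) {a b : ℕ} (i k : ℕ) (h : b ≠ a) :
    (s.setArr a i k).arr b = s.arr b := by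
  simp [State.setArr, h]

@[simp] theorem State.used_setArr (s : State) (a i k : ℕ) : (s.setArr a i k).used = s.used := rfl

theorem Exec.used_le {w : ℕ} {ω : ℕ → Bool} {p : Cmd} {s s' : State} {t : ℕ}
    (h : Exec w ω p s s' t) : s.used ≤ s'.used ∧ s'.used ≤ s.used + t := by
  induction h <;> (try simp only [State.used_setReg, State.used_setArr]) <;> omega

/-- The promises about an algorithm concern one sequence of operations at a time. Determinism for
fixed coins glues them together, because runs on different sequences agree on common prefixes. -/
theorem Exec.det {w : ℕ} {ω : ℕ → Bool} {p : Cmd} {s s₁ : State} {t₁ : ℕ}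
    (h₁ : Exec w ω p s s₁ t₁) : ∀ {s₂ : State} {t₂ : ℕ}, Exec w ω p s s₂ t₂ →
      s₁ = s₂ ∧ t₁ = t₂ := by
  induction h₁ with
  | seq hp hq ihp ihq =>
    intro s₂ t₂ h
    cases h with
    | seq hp' hq' =>
      obtain ⟨rfl, rfl⟩ := ihp hp'
      obtain ⟨rfl, rfl⟩ := ihq hq'
      exact ⟨rfl, rfl⟩
  | ite_true hx hp ih =>
    intro s₂ t₂ h
    cases h with
    | ite_true hx' hp' => obtain ⟨rfl, rfl⟩ := ih hp'; exact ⟨rfl, rfl⟩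
    | ite_false hx' hp' => exact absurd hx' hx
  | ite_false hx hp ih =>
    intro s₂ t₂ h
    cases h with
    | ite_true hx' hp' => exact absurd hx hx'
    | ite_false hx' hp' => obtain ⟨rfl, rfl⟩ := ih hp'; exact ⟨rfl, rfl⟩
  | loop_true hx hp hl ihp ihl =>
    intro s₂ t₂ h
    cases h with
    | loop_true hx' hp' hl' =>
      obtain ⟨rfl, rfl⟩ := ihp hp'
      obtain ⟨rfl, rfl⟩ := ihl hl'
      exact ⟨rfl, rfl⟩
    | loop_false hx' => exact absurd hx' hx
  | loop_false hx =>
    intro s₂ t₂ h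
    cases h with
    | loop_true hx' hp' hl' => exact absurd hx hx'
    | loop_false hx' => exact ⟨rfl, rfl⟩
  | _ => intro s₂ t₂ h; cases h; exact ⟨rfl, rfl⟩

/-- Program `p` started in `s` halts, and the final state and the running time satisfy `Q`. -/
def WP (w : ℕ) (ω : ℕ → Bool) (p : Cmd) (s : State) (Q : State → ℕ → Prop) : Prop :=
  ∃ s' t, Exec w ω p s s' t ∧ Q s' t

section WP

variable {w : ℕ} {ω : ℕ → Bool} {s : State} {Q Q' : State → ℕ → Prop}

theorem WP.mono {p : Cmd} (h : WP w ω p s Q) (hQ : ∀ s' t, Q s' t → Q' s' t) : WP w ω p s Q' := by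
  obtain ⟨s', t, h₁, h₂⟩ := h
  exact ⟨s', t, h₁, hQ _ _ h₂⟩

theorem wp_skip (h : Q s 1) : WP w ω .skip s Q := ⟨_, _, .skip s, h⟩

theorem wp_const {x k : ℕ} (hk : k < 2 ^ w) (h : Q (s.setReg x k) 1) : WP w ω (.const x k) s Q :=
  ⟨_, _, .const s x k hk, h⟩

theorem wp_op {x y z : ℕ} {o : BinOp} (hk : o.eval (s.reg y) (s.reg z) < 2 ^ w)
    (h : Q (s.setReg x (o.eval (s.reg y) (s.reg z))) 1) : WP w ω (.op x o y z) s Q :=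
  ⟨_, _, .op s x o y z hk, h⟩

theorem wp_load {x a y : ℕ} (h : Q (s.setReg x (s.arr a (s.reg y))) 1) :
    WP w ω (.load x a y) s Q :=
  ⟨_, _, .load s x a y, h⟩

theorem wp_store {a y z : ℕ} (h : Q (s.setArr a (s.reg y) (s.reg z)) 1) :
    WP w ω (.store a y z) s Q :=
  ⟨_, _, .store s a y z, h⟩

theorem wp_seq {p q : Cmd} (h : WP w ω p s fun s' t => WP w ω q s' fun s'' t' => Q s'' (t + t')) :
    WP w ω (p ;; q) s Q := by
  obtain ⟨s', t, h₁, s'', t', h₂, h₃⟩ := h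
  exact ⟨_, _, .seq h₁ h₂, h₃⟩

theorem wp_ite {x : ℕ} {p q : Cmd} (h₁ : s.reg x ≠ 0 → WP w ω p s fun s' t => Q s' (t + 1))
    (h₂ : s.reg x = 0 → WP w ω q s fun s' t => Q s' (t + 1)) : WP w ω (.ite x p q) s Q := by
  by_cases hx : s.reg x = 0
  · obtain ⟨s', t, h, hQ⟩ := h₂ hx
    exact ⟨_, _, .ite_false hx h, hQ⟩
  · obtain ⟨s', t, h, hQ⟩ := h₁ hx
    exact ⟨_, _, .ite_true hx h, hQ⟩

end WP

/-- `for i < n do p`, with auxiliary register `j`; register `2` has to hold the number `1`. -/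
def forLoop (i j n : ℕ) (p : Cmd) : Cmd :=
  .const i 0 ;; .op j .sub n i ;; .loop j (p ;; .op i .add i 2 ;; .op j .sub n i)

/-- Induction on the number of remaining passes, which register `j` holds. The invariant must ignore
the loop registers, and the body must leave `i` alone. Each pass costs 3 extra steps, two updates
and one test; the last 3 are the initialization and the failing test. -/
theorem wp_forLoop {w : ℕ} {ω : ℕ → Bool} {i j n : ℕ} {p : Cmd} {N : ℕ} (I : ℕ → State → Prop)
    (T : ℕ → ℕ) (hN : N < 2 ^ w) (hij : i ≠ j) (hin : i ≠ n)
    (hI : ∀ k s, I k s → s.reg n = N ∧ s.reg 2 = 1)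
    (hIi : ∀ k s v, I k s → I k (s.setReg i v)) (hIj : ∀ k s v, I k s → I k (s.setReg j v))
    (hp : ∀ k s, k < N → I k s → s.reg i = k →
      WP w ω p s fun s' t => I (k + 1) s' ∧ s'.reg i = k ∧ t ≤ T k)
    {s : State} (hs : I 0 s) :
    WP w ω (forLoop i j n p) s fun s' t => I N s' ∧ t ≤ (∑ k ∈ Finset.range N, (T k + 3)) + 3 := by
  have key : ∀ d k s, k + d = N → I k s → s.reg i = k → s.reg j = d →
      WP w ω (.loop j (p ;; .op i .add i 2 ;; .op j .sub n i)) s fun s' t =>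
        I N s' ∧ t ≤ (∑ l ∈ Finset.Ico k N, (T l + 3)) + 1 := by
    intro d
    induction d with
    | zero =>
      intro k s hk hIk _ hj
      obtain rfl : k = N := by omega
      exact ⟨s, 1, .loop_false hj, hIk, by simp⟩
    | succ d ih =>
      intro k s hk hIk hki hj
      obtain ⟨s₁, t₁, he₁, hI₁, hi₁, ht₁⟩ := hp k s (by omega) hIk hki
      have h₁ := hI _ _ hI₁
      have hI₂ := hIi _ _ (k + 1) hI₁
      have hI₃ := hIj _ _ d hI₂
      obtain ⟨s₄, t₄, he₄, hI₄, ht₄⟩ := ih (k + 1) _ (by omega) hI₃ (by simp [hij]) (by simp)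
      have e₂ : Exec w ω (.op i .add i 2) s₁ (s₁.setReg i (k + 1)) 1 := by
        have := Exec.op (ω := ω) (w := w) s₁ i .add i 2
          (by simp only [BinOp.eval, hi₁, h₁.2]; omega)
        simpa only [BinOp.eval, hi₁, h₁.2] using this
      have e₃ : Exec w ω (.op j .sub n i) (s₁.setReg i (k + 1))
          ((s₁.setReg i (k + 1)).setReg j d) 1 := by
        have hd : BinOp.eval .sub ((s₁.setReg i (k + 1)).reg n) ((s₁.setReg i (k + 1)).reg i) =
            d := by
          simp [BinOp.eval, hin.symm, h₁.1]; omega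
        have := Exec.op (ω := ω) (w := w) (s₁.setReg i (k + 1)) j .sub n i (by rw [hd]; omega)
        rwa [hd] at this
      refine ⟨s₄, _, .loop_true (by omega) (.seq he₁ (.seq e₂ e₃)) he₄, hI₄, ?_⟩
      rw [Finset.sum_eq_sum_Ico_succ_bot (by omega)]
      omega
  refine wp_seq (wp_const (by omega) (wp_seq (wp_op ?_ ?_)))
  · simp [BinOp.eval, hin.symm, (hI _ _ hs).1, hN]
  · have h₁ := hIi _ _ 0 hs
    have h₂ := hIj _ _ N h₁
    have hd : BinOp.eval .sub ((s.setReg i 0).reg n) ((s.setReg i 0).reg i) = N := by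
      simp [BinOp.eval, hin.symm, (hI _ _ hs).1]
    rw [hd]
    refine (key N 0 _ (by omega) h₂ (by simp [hij]) (by simp)).mono ?_
    rintro s' t ⟨h₃, h₄⟩
    refine ⟨h₃, ?_⟩
    rw [Finset.range_eq_Ico]
    omega

theorem wp_forLoop_const {w : ℕ} {ω : ℕ → Bool} {i j n : ℕ} {p : Cmd} {N : ℕ}
    (I : ℕ → State → Prop) (T : ℕ) (hN : N < 2 ^ w) (hij : i ≠ j) (hin : i ≠ n)
    (hI : ∀ k s, I k s → s.reg n = N ∧ s.reg 2 = 1)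
    (hIi : ∀ k s v, I k s → I k (s.setReg i v)) (hIj : ∀ k s v, I k s → I k (s.setReg j v))
    (hp : ∀ k s, k < N → I k s → s.reg i = k →
      WP w ω p s fun s' t => I (k + 1) s' ∧ s'.reg i = k ∧ t ≤ T)
    {s : State} (hs : I 0 s) :
    WP w ω (forLoop i j n p) s fun s' t => I N s' ∧ t ≤ N * (T + 3) + 3 := by
  have := wp_forLoop I (fun _ => T) hN hij hin hI hIi hIj hp hs
  simpa using this

/-! ## Simulation with resets

The registers and arrays of a simulated program are kept in the arrays `3 * k + 3`, where `k = 0`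
for the registers and `k = a + 1` for the array `a`.  Once register `51` is nonzero, these arrays
are only read; new values go to the arrays `3 * k + 4`, and are valid where the array `3 * k + 5`
contains the number of the current stage (register `50`).  The coin flips are recorded in array
`2`; register `64` counts them, and register `65` is the number of coin flips used by the
simulated program. -/

/-- The contents of the memory as a family of arrays. -/
def State.mem (s : State) : ℕ → ℕ → ℕ
  | 0, i => s.reg i
  | k + 1, i => s.arr k i

/-- Writing into the memory. -/
def State.write (s : State) : ℕ → ℕ → ℕ → State
  | 0, i, v => s.setReg i v
  | k + 1, i, v => s.setArr k i v

theorem State.mem_write (s : State) (k i v l j : ℕ) :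
    (s.write k i v).mem l j = if l = k ∧ j = i then v else s.mem l j := by
  rcases k with _ | k <;> rcases l with _ | l <;>
    simp [State.write, State.mem, State.arr_setArr]

@[simp] theorem State.used_write (s : State) (k i v : ℕ) : (s.write k i v).used = s.used := by
  rcases k with _ | k <;> rfl

/-- Stamps never exceed the stage number, so their truncated difference vanishes exactly for cells
written in the current stage. -/
def readCell (x k y : ℕ) : Cmd :=
  .load 63 (3 * k + 5) y ;; .op 63 .sub 50 63 ;;
    .ite 63 (.load x (3 * k + 3) y) (.load x (3 * k + 4) y)

def writeCell (k y z : ℕ) : Cmd :=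
  .ite 51 (.store (3 * k + 4) y z ;; .store (3 * k + 5) y 50) (.store (3 * k + 3) y z)

/-- A coin instruction replays a recorded flip while the simulated counter (register `65`) is behind
the number of recorded flips (register `64`); otherwise it draws a new one and records it. In a loop
the condition is read again at the end of the body. -/
def simulate : Cmd → Cmd
  | .skip => .skip
  | .const x k => .const 60 x ;; .const 61 k ;; writeCell 0 60 61
  | .op x o y z => .const 60 y ;; readCell 61 0 60 ;; .const 60 z ;; readCell 62 0 60 ;;
      .op 61 o 61 62 ;; .const 60 x ;; writeCell 0 60 61
  | .load x a y => .const 60 y ;; readCell 60 0 60 ;; readCell 61 (a + 1) 60 ;; .const 60 x ;;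
      writeCell 0 60 61
  | .store a y z => .const 60 z ;; readCell 61 0 60 ;; .const 60 y ;; readCell 60 0 60 ;;
      writeCell (a + 1) 60 61
  | .coin x => .op 63 .sub 64 65 ;;
      .ite 63 (.load 61 2 65) (.coin 61 ;; .store 2 64 61 ;; .op 64 .add 64 2) ;;
      .op 65 .add 65 2 ;; .const 60 x ;; writeCell 0 60 61
  | .seq p q => simulate p ;; simulate q
  | .ite x p q => .const 60 x ;; readCell 61 0 60 ;; .ite 61 (simulate p) (simulate q)
  | .loop x p => .const 60 x ;; readCell 61 0 60 ;;
      .loop 61 (simulate p ;; .const 60 x ;; readCell 61 0 60)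

/-- A bound for the names of the registers in a program. -/
def Cmd.regBound : Cmd → ℕ
  | .skip => 0
  | .const x _ => x
  | .op x _ y z => max x (max y z)
  | .load x _ y => max x y
  | .store _ y z => max y z
  | .coin x => x
  | .seq p q => max p.regBound q.regBound
  | .ite x p q => max x (max p.regBound q.regBound)
  | .loop x p => max x p.regBound

/-- The state `s` represents the state `r` of the simulated program. -/
structure Rep (ω : ℕ → Bool) (s r : State) : Prop where
  mem : ∀ k i, r.mem k i =
    if s.arr (3 * k + 5) i = s.reg 50 then s.arr (3 * k + 4) i else s.arr (3 * k + 3) i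
  stamp : ∀ k i, s.arr (3 * k + 5) i ≤ s.reg 50
  mode : s.reg 51 = 0 → 0 < s.reg 50 ∧ ∀ k i, s.arr (3 * k + 5) i = 0
  pos : s.reg 65 = r.used
  cnt : s.reg 64 = s.used
  le : r.used ≤ s.used
  coins : ∀ i < s.used, s.arr 2 i = (ω i).toNat

/-- What a simulation does not change. -/
structure SimFrame (s s' : State) : Prop where
  reg : ∀ y < 60, s'.reg y = s.reg y
  arr : ∀ k < 2, s'.arr k = s.arr k
  base : s.reg 51 ≠ 0 → ∀ k, s'.arr (3 * k + 3) = s.arr (3 * k + 3)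
  used : s.used ≤ s'.used

theorem SimFrame.refl (s : State) : SimFrame s s :=
  ⟨fun _ _ => rfl, fun _ _ => rfl, fun _ _ => rfl, le_rfl⟩

theorem SimFrame.trans {s s' s'' : State} (h : SimFrame s s') (h' : SimFrame s' s'') :
    SimFrame s s'' :=
  ⟨fun y hy => (h'.reg y hy).trans (h.reg y hy), fun k hk => (h'.arr k hk).trans (h.arr k hk),
    fun hm k => (h'.base (by rwa [h.reg 51 (by norm_num)]) k).trans (h.base hm k),
    h.used.trans h'.used⟩

theorem SimFrame.setReg {s : State} {x : ℕ} (v : ℕ) (hx : 60 ≤ x) : SimFrame s (s.setReg x v) :=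
  ⟨fun y hy => by simp; omega, fun _ _ => rfl, fun _ _ => rfl, le_rfl⟩

variable {w : ℕ} {ω : ℕ → Bool} {s r : State} {Q : State → ℕ → Prop}

theorem Rep.setReg (h : Rep ω s r) {x : ℕ} (v : ℕ) (h₁ : x ≠ 50) (h₂ : x ≠ 51) (h₃ : x ≠ 64)
    (h₄ : x ≠ 65) : Rep ω (s.setReg x v) r := by
  obtain ⟨a₁, a₂, a₃, a₄, a₅, a₆, a₇⟩ := h
  constructor <;> simpa [h₁.symm, h₂.symm, h₃.symm, h₄.symm]

theorem wp_readCell (h : Rep ω s r) (hw : s.reg 50 < 2 ^ w) {x k y : ℕ} (hy : y ≠ 63)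
    (hQ : ∀ v, Q ((s.setReg 63 v).setReg x (r.mem k (s.reg y))) 4) :
    WP w ω (readCell x k y) s Q := by
  refine wp_seq (wp_load (wp_seq (wp_op ?_ (wp_ite ?_ ?_))))
  · simp [BinOp.eval]; omega
  all_goals
    intro h₀
    simp [BinOp.eval] at h₀
    have h₁ := h.stamp k (s.reg y)
    refine wp_load ?_
    have h₂ := hQ (s.reg 50 - s.arr (3 * k + 5) (s.reg y))
    rw [h.mem] at h₂
    simp only [State.reg_setReg, BinOp.eval, hy, if_true, if_false, State.arr_setReg]
    norm_num
  · rw [if_neg (by omega)] at h₂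
    convert h₂ using 2
    simp [State.setReg]
  · rw [if_pos (by omega)] at h₂
    convert h₂ using 2
    simp [State.setReg]

theorem wp_writeCell (h : Rep ω s r) {k y z : ℕ}
    (hQ : ∀ s' t, Rep ω s' (r.write k (s.reg y) (s.reg z)) → SimFrame s s' → s'.used = s.used →
      s'.reg = s.reg → t ≤ 3 → Q s' t) : WP w ω (writeCell k y z) s Q := by
  have hne₁ (l l' : ℕ) : 3 * l + 5 ≠ 3 * l' + 4 := by omega
  have hne₂ (l l' : ℕ) : 3 * l + 5 ≠ 3 * l' + 3 := by omega
  have hne₃ (l l' : ℕ) : 3 * l + 4 ≠ 3 * l' + 3 := by omega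
  have hne₄ (l : ℕ) : 2 ≠ 3 * l + 5 ∧ 2 ≠ 3 * l + 4 ∧ 2 ≠ 3 * l + 3 := by omega
  refine wp_ite (fun h₀ => wp_seq (wp_store (wp_store ?_))) (fun h₀ => wp_store ?_)
  · refine hQ _ _ ⟨?_, ?_, ?_, ?_, ?_, ?_, ?_⟩ ⟨?_, ?_, ?_, ?_⟩ rfl rfl (by norm_num)
    · intro l i
      rw [State.mem_write, h.mem]
      simp only [State.arr_setArr, State.reg_setArr, Nat.add_right_cancel_iff,
        Nat.mul_left_cancel_iff (show 0 < 3 by norm_num), hne₁, (hne₁ _ _).symm,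
        (hne₂ _ _).symm, (hne₃ _ _).symm, false_and, if_false]
      by_cases hl : l = k ∧ i = s.reg y <;> simp [hl]
    · intro l i
      simp only [State.arr_setArr, State.reg_setArr, hne₁, false_and, if_false]
      split_ifs
      · exact le_rfl
      · exact h.stamp l i
    · exact fun h₁ => absurd h₁ h₀
    · simpa using h.pos
    · simpa using h.cnt
    · simpa using h.le
    · intro i hi
      rw [State.arr_setArr_of_ne _ _ _ (hne₄ k).1, State.arr_setArr_of_ne _ _ _ (hne₄ k).2.1]
      exact h.coins i hi
    · exact fun _ _ => rfl
    · intro l hl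
      rw [State.arr_setArr_of_ne _ _ _ (by omega), State.arr_setArr_of_ne _ _ _ (by omega)]
    · intro _ l
      rw [State.arr_setArr_of_ne _ _ _ (by omega), State.arr_setArr_of_ne _ _ _ (by omega)]
    · exact le_rfl
  · obtain ⟨h₁, h₂⟩ := h.mode h₀
    refine hQ _ _ ⟨?_, ?_, ?_, ?_, ?_, ?_, ?_⟩ ⟨?_, ?_, ?_, ?_⟩ rfl rfl (by norm_num)
    · intro l i
      rw [State.mem_write, h.mem]
      simp only [State.arr_setArr, State.reg_setArr, Nat.add_right_cancel_iff,
        Nat.mul_left_cancel_iff (show 0 < 3 by norm_num), hne₂, hne₃,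
        false_and, if_false, h₂, h₁.ne]
    · intro l i
      simpa only [State.arr_setArr, State.reg_setArr, hne₂, false_and, if_false] using h.stamp l i
    · intro _
      simpa only [State.arr_setArr, State.reg_setArr, hne₂, false_and, if_false] using ⟨h₁, h₂⟩
    · simpa using h.pos
    · simpa using h.cnt
    · simpa using h.le
    · intro i hi
      rw [State.arr_setArr_of_ne _ _ _ (hne₄ k).2.2]
      exact h.coins i hi
    · exact fun _ _ => rfl
    · intro l hl
      rw [State.arr_setArr_of_ne _ _ _ (by omega)]
    · exact fun h₁ => absurd h₀ h₁
    · exact le_rfl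

/-- The postcondition of a simulation. -/
def SimPost (ω : ℕ → Bool) (s r' : State) (T : ℕ) (s' : State) (t : ℕ) : Prop :=
  Rep ω s' r' ∧ SimFrame s s' ∧ s'.used ≤ max s.used r'.used ∧ t ≤ 20 * T

theorem Rep.setTemp (h : Rep ω s r) {x : ℕ} (v : ℕ) (h₁ : 60 ≤ x) (h₂ : x < 64) :
    Rep ω (s.setReg x v) r :=
  h.setReg v (by omega) (by omega) (by omega) (by omega)

theorem wp_readReg_seq (h : Rep ω s r) (hw : s.reg 50 < 2 ^ w) {x y : ℕ} (hx : x < 2 ^ w)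
    {p : Cmd} (hQ : ∀ v, WP w ω p (((s.setReg 60 x).setReg 63 v).setReg y (r.reg x))
      fun s' t => Q s' (1 + (4 + t))) :
    WP w ω (.const 60 x ;; readCell y 0 60 ;; p) s Q := by
  refine wp_seq (wp_const hx (wp_seq (wp_readCell (h.setTemp _ (by norm_num) (by norm_num))
    (by simpa using hw) (by norm_num) fun v => ?_)))
  simpa [State.mem] using hQ v

/-- Most simulated instructions end by writing one cell. The time bound in `SimPost` is left open,
since the steps before the write have yet to be added. -/
theorem wp_finish {s₁ : State} (h : Rep ω s₁ r) (f : SimFrame s s₁)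
    {k y z T : ℕ} {r' : State} (hu : s₁.used ≤ max s.used r'.used)
    (hr' : r.write k (s₁.reg y) (s₁.reg z) = r')
    (hQ : ∀ s' t, t ≤ 3 → (∀ t', t' ≤ 20 * T → SimPost ω s r' T s' t') → Q s' t) :
    WP w ω (writeCell k y z) s₁ Q :=
  wp_writeCell h fun s' t h₁ h₂ h₃ _ h₅ => hQ s' t h₅ fun _ ht =>
    ⟨hr' ▸ h₁, f.trans h₂, h₃ ▸ hu, ht⟩

/-- Induction on the execution; 20 steps suffice for each simulated one. The host may have consumed
more coins than the simulated program, and draws new ones only when the latter overtakes it; this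
explains the maximum in `SimPost`. -/
theorem wp_simulate {w₀ : ℕ} (hw₀ : w₀ ≤ w) {p : Cmd} {r r' : State} {T : ℕ}
    (he : Exec w₀ ω p r r' T) : ∀ {s : State}, Rep ω s r → s.reg 2 = 1 → s.reg 50 < 2 ^ w →
      p.regBound < 2 ^ w → s.used < 2 ^ w → r'.used < 2 ^ w →
      WP w ω (simulate p) s (SimPost ω s r' T) := by
  have hpow : 2 ^ w₀ ≤ 2 ^ w := Nat.pow_le_pow_right (by norm_num) hw₀
  induction he with
  | skip r =>
    intro s hr _ _ _ _ _
    exact wp_skip ⟨hr, .refl s, by simp, by norm_num⟩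
  | const r x k h =>
    intro s hr _ _ hb _ _
    refine wp_seq (wp_const hb (wp_seq (wp_const (h.trans_le hpow) ?_)))
    exact wp_finish ((hr.setTemp _ (by norm_num) (by norm_num)).setTemp _ (by norm_num)
      (by norm_num)) ((SimFrame.setReg _ (by norm_num)).trans (SimFrame.setReg _ (by norm_num)))
      (by simp) (by simp [State.write]) fun s' t ht hS => hS _ (by omega)
  | op r x o y z h =>
    intro s hr _ h50 hb _ _
    simp only [Cmd.regBound, max_lt_iff] at hb
    refine wp_readReg_seq hr h50 hb.2.1 fun v => ?_
    have hr₁ := ((hr.setTemp y (x := 60) (by norm_num) (by norm_num)).setTemp v (x := 63)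
      (by norm_num) (by norm_num)).setTemp (r.reg y) (x := 61) (by norm_num) (by norm_num)
    refine wp_readReg_seq hr₁ (by simpa using h50) hb.2.2 fun v' => ?_
    have hr₂ := ((hr₁.setTemp z (x := 60) (by norm_num) (by norm_num)).setTemp v' (x := 63)
      (by norm_num) (by norm_num)).setTemp (r.reg z) (x := 62) (by norm_num) (by norm_num)
    refine wp_seq (wp_op (by simpa using h.trans_le hpow) (wp_seq (wp_const hb.1 ?_)))
    refine wp_finish (s := s) ((hr₂.setTemp _ (by norm_num) (by norm_num)).setTemp _ (by norm_num)
      (by norm_num)) ⟨fun i hi => ?_, fun _ _ => rfl, fun _ _ => rfl, le_rfl⟩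
      (by simp) (by simp [State.write]) fun s' t ht hS => hS _ (by omega)
    simp only [State.reg_setReg]
    repeat rw [if_neg (by omega)]
  | load r x a y =>
    intro s hr _ h50 hb _ _
    simp only [Cmd.regBound, max_lt_iff] at hb
    refine wp_readReg_seq hr h50 hb.2 fun v => ?_
    have hr₁ := ((hr.setTemp y (x := 60) (by norm_num) (by norm_num)).setTemp v (x := 63)
      (by norm_num) (by norm_num)).setTemp (r.reg y) (x := 60) (by norm_num) (by norm_num)
    refine wp_seq (wp_readCell hr₁ (by simpa using h50) (by norm_num) fun v' => ?_)
    have hr₂ := (hr₁.setTemp v' (x := 63) (by norm_num) (by norm_num)).setTemp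
      (r.mem (a + 1) ((((s.setReg 60 y).setReg 63 v).setReg 60 (r.reg y)).reg 60)) (x := 61)
      (by norm_num) (by norm_num)
    refine wp_seq (wp_const hb.1 ?_)
    refine wp_finish (s := s) (hr₂.setTemp _ (by norm_num) (by norm_num))
      ⟨fun i hi => ?_, fun _ _ => rfl, fun _ _ => rfl, le_rfl⟩
      (by simp) (by simp [State.write, State.mem]) fun s' t ht hS => hS _ (by omega)
    simp only [State.reg_setReg]
    repeat rw [if_neg (by omega)]
  | store r a y z =>
    intro s hr _ h50 hb _ _
    simp only [Cmd.regBound, max_lt_iff] at hb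
    refine wp_readReg_seq hr h50 hb.2 fun v => ?_
    have hr₁ := ((hr.setTemp z (x := 60) (by norm_num) (by norm_num)).setTemp v (x := 63)
      (by norm_num) (by norm_num)).setTemp (r.reg z) (x := 61) (by norm_num) (by norm_num)
    refine wp_readReg_seq hr₁ (by simpa using h50) hb.1 fun v' => ?_
    have hr₂ := ((hr₁.setTemp y (x := 60) (by norm_num) (by norm_num)).setTemp v' (x := 63)
      (by norm_num) (by norm_num)).setTemp (r.reg y) (x := 60) (by norm_num) (by norm_num)
    refine wp_finish (s := s) hr₂ ⟨fun i hi => ?_, fun _ _ => rfl, fun _ _ => rfl, le_rfl⟩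
      (by simp) (by simp [State.write]) fun s' t ht hS => hS _ (by omega)
    simp only [State.reg_setReg]
    repeat rw [if_neg (by omega)]
  | coin r x =>
    intro s hr h2 h50 hb hs hu
    change r.used + 1 < 2 ^ w at hu
    have hc := hr.cnt
    have hp := hr.pos
    have hle := hr.le
    -- The part common to replayed and fresh flips: once the flip is in register `61`, the simulated
    -- counter advances and the bit is stored.
    have tail {s₁ : State} (h₁ : ∀ k, s₁.arr (3 * k + 3) = s.arr (3 * k + 3) ∧
        s₁.arr (3 * k + 4) = s.arr (3 * k + 4) ∧ s₁.arr (3 * k + 5) = s.arr (3 * k + 5))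
        (h₂ : ∀ k < 2, s₁.arr k = s.arr k) (h₃ : ∀ y < 60, s₁.reg y = s.reg y)
        (h₄ : s₁.reg 61 = (ω r.used).toNat) (h₅ : s₁.reg 65 = r.used)
        (h₆ : s₁.reg 64 = s₁.used) (h₇ : s₁.used = max s.used (r.used + 1))
        (h₈ : ∀ i < s₁.used, s₁.arr 2 i = (ω i).toNat) :
        WP w ω (.op 65 .add 65 2 ;; .const 60 x ;; writeCell 0 60 61) s₁ fun s' t =>
          ∀ t', t' ≤ 20 * 1 → t ≤ 5 ∧ SimPost ω s
            { r.setReg x (ω r.used).toNat with used := r.used + 1 } 1 s' t' := by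
      have h2' : s₁.reg 2 = 1 := (h₃ 2 (by norm_num)).trans h2
      refine wp_seq (wp_op (by simp only [BinOp.eval, h₅, h2']; exact hu)
        (wp_seq (wp_const hb ?_)))
      have hr₁ : Rep ω (s₁.setReg 65 (r.used + 1)) { r with used := r.used + 1 } := by
        refine ⟨fun k i => ?_, fun k i => ?_, fun h₀ => ?_, by simp, by simpa using h₆, ?_, h₈⟩
        · have : State.mem { r with used := r.used + 1 } k i = r.mem k i := by
            rcases k with _ | k <;> rfl
          rw [this, hr.mem]
          simp [(h₁ k).1, (h₁ k).2.1, (h₁ k).2.2, h₃]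
        · simpa [(h₁ k).2.2, h₃] using hr.stamp k i
        · simp only [State.reg_setReg, Nat.reduceEqDiff, if_false, h₃ 51 (by norm_num),
            h₃ 50 (by norm_num), State.arr_setReg, h₁] at h₀ ⊢
          exact hr.mode h₀
        · simp [h₇]
      simp only [BinOp.eval, h₅, h2']
      refine wp_finish (s := s) (hr₁.setTemp _ (by norm_num) (by norm_num))
        ⟨fun i hi => ?_, h₂, fun _ k => (h₁ k).1, ?_⟩ ?_ ?_
        fun s' t ht hS t' ht' => ⟨by omega, hS _ ht'⟩
      · simp only [State.reg_setReg]
        repeat rw [if_neg (by omega)]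
        exact h₃ i hi
      · simp [h₇]
      · simp [h₇]
      · simp [State.write, h₄, State.setReg]
    refine wp_seq (wp_op (by simp only [BinOp.eval]; omega) (wp_seq (wp_ite (fun h₀ => ?_)
      fun h₀ => ?_)))
    · simp only [BinOp.eval, State.reg_setReg, if_true] at h₀
      refine wp_load ((tail ?_ ?_ ?_ ?_ ?_ ?_ ?_ ?_).mono fun s' t hS => (hS _ ?_).2)
      · exact fun _ => ⟨rfl, rfl, rfl⟩
      · exact fun _ _ => rfl
      · intro y hy
        simp only [State.reg_setReg]
        repeat rw [if_neg (by omega)]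
      · simp only [State.reg_setReg, State.arr_setReg, if_true]
        norm_num
        rw [hp]
        exact hr.coins _ (by omega)
      · simpa using hp
      · simpa using hc
      · simp only [State.used_setReg]
        omega
      · exact hr.coins
      · have := (hS _ (Nat.zero_le _)).1
        omega
    · simp only [BinOp.eval, State.reg_setReg, if_true] at h₀
      have hu₁ : r.used = s.used := by omega
      refine wp_seq ⟨_, _, .coin _ 61, wp_seq (wp_store (wp_op ?_ ((tail ?_ ?_ ?_ ?_ ?_ ?_ ?_
        ?_).mono fun s' t hS => (hS _ ?_).2)))⟩
      · simp [BinOp.eval, h2, hc, ← hu₁, hu]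
      · intro k
        simp only [State.setArr, State.setReg]
        refine ⟨?_, ?_, ?_⟩ <;> rw [Function.update_of_ne (by omega)]
      · intro k hk
        simp only [State.setArr, State.setReg]
        rw [Function.update_of_ne (by omega)]
      · intro y hy
        simp only [State.reg_setReg, State.reg_setArr]
        repeat rw [if_neg (by omega)]
      · simp [hu₁]
      · simpa using hp
      · simp [BinOp.eval, h2, hc]
      · simp [hu₁]
      · intro i hi
        simp only [State.arr_setReg, State.arr_setArr, State.used_setReg, State.used_setArr] at hi ⊢
        simp only [State.reg_setReg, true_and]
        norm_num
        rw [hc]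
        split_ifs with h
        · rw [h]
        · exact hr.coins i (by omega)
      · have := (hS _ (Nat.zero_le _)).1
        omega
  | seq hp hq ihp ihq =>
    intro s hr h2 h50 hb hs hu
    simp only [Cmd.regBound, max_lt_iff] at hb
    have hu' := hq.used_le.1
    refine wp_seq ((ihp hr h2 h50 hb.1 hs (by omega)).mono ?_)
    rintro s₁ t₁ ⟨r₁, f₁, u₁, c₁⟩
    refine (ihq r₁ ((f₁.reg 2 (by norm_num)).trans h2)
      (by rwa [f₁.reg 50 (by norm_num)]) hb.2 (by omega) hu).mono ?_
    rintro s₂ t₂ ⟨r₂, f₂, u₂, c₂⟩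
    exact ⟨r₂, f₁.trans f₂, by omega, by omega⟩
  | ite_true hx hp ih =>
    intro s hr h2 h50 hb hs hu
    simp only [Cmd.regBound, max_lt_iff] at hb
    refine wp_readReg_seq hr h50 hb.1 fun v => wp_ite (fun _ => ?_) fun h₀ => ?_
    · refine (ih (((hr.setTemp _ (by norm_num) (by norm_num)).setTemp _ (by norm_num)
        (by norm_num)).setTemp _ (by norm_num) (by norm_num)) (by simpa using h2)
        (by simpa using h50) hb.2.1 hs hu).mono ?_
      rintro s' t ⟨r', f, u, c⟩
      exact ⟨r', (((SimFrame.setReg _ (by norm_num)).trans (SimFrame.setReg _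
        (by norm_num))).trans (SimFrame.setReg _ (by norm_num))).trans f, by simpa using u,
        by omega⟩
    · simp [hx] at h₀
  | ite_false hx hp ih =>
    intro s hr h2 h50 hb hs hu
    simp only [Cmd.regBound, max_lt_iff] at hb
    refine wp_readReg_seq hr h50 hb.1 fun v => wp_ite (fun h₀ => ?_) fun _ => ?_
    · simp [hx] at h₀
    · refine (ih (((hr.setTemp _ (by norm_num) (by norm_num)).setTemp _ (by norm_num)
        (by norm_num)).setTemp _ (by norm_num) (by norm_num)) (by simpa using h2)
        (by simpa using h50) hb.2.2 hs hu).mono ?_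
      rintro s' t ⟨r', f, u, c⟩
      exact ⟨r', (((SimFrame.setReg _ (by norm_num)).trans (SimFrame.setReg _
        (by norm_num))).trans (SimFrame.setReg _ (by norm_num))).trans f, by simpa using u,
        by omega⟩
  | @loop_true y _ r₀ _ _ _ _ hx hp hl ihp ihl =>
    intro s hr h2 h50 hb hs hu
    have hb' := hb
    simp only [Cmd.regBound, max_lt_iff] at hb
    have hu' := hl.used_le.1
    refine wp_readReg_seq hr h50 hb.1 fun v => ?_
    have hr₁ := ((hr.setTemp y (x := 60) (by norm_num) (by norm_num)).setTemp v (x := 63)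
      (by norm_num) (by norm_num)).setTemp (r₀.reg y) (x := 61) (by norm_num) (by norm_num)
    obtain ⟨s₁, t₁, e₁, r₁, f₁, u₁, c₁⟩ := ihp hr₁ (by simpa using h2) (by simpa using h50) hb.2
      (by simpa using hs) (by omega)
    have f₁' := (((SimFrame.setReg _ (by norm_num)).trans (SimFrame.setReg _
        (by norm_num))).trans (SimFrame.setReg _ (by norm_num))).trans f₁
    have h50₁ : s₁.reg 50 < 2 ^ w := by rwa [f₁'.reg 50 (by norm_num)]
    simp only [State.used_setReg] at u₁
    obtain ⟨s₂, t₂, e₂, r₂, f₂, u₂, c₂⟩ := ihl r₁ ((f₁'.reg 2 (by norm_num)).trans h2) h50₁ hb'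
      (by omega) hu
    -- The hypothesis for the rest of the loop begins by reading the condition. This reading is
    -- moved to the end of the current pass.
    cases e₂ with
    | seq ec er =>
      cases er with
      | seq er el =>
        refine ⟨s₂, _, .loop_true (by simpa using hx) (.seq e₁ (.seq ec er)) el, r₂,
          f₁'.trans f₂, ?_, by omega⟩
        omega
  | loop_false hx =>
    intro s hr h2 h50 hb hs hu
    simp only [Cmd.regBound, max_lt_iff] at hb
    refine wp_readReg_seq hr h50 hb.1 fun v => ⟨_, _, .loop_false (by simp [hx]), ?_, ?_, ?_, ?_⟩
    · exact ((hr.setTemp _ (by norm_num) (by norm_num)).setTemp _ (by norm_num)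
        (by norm_num)).setTemp _ (by norm_num) (by norm_num)
    · exact ((SimFrame.setReg _ (by norm_num)).trans (SimFrame.setReg _
        (by norm_num))).trans (SimFrame.setReg _ (by norm_num))
    · simp
    · omega

end WordRAM

/-! ### Rules as equivalences, so that `simp` can execute straight-line code -/

namespace WordRAM

section

variable {w : ℕ} {ω : ℕ → Bool} {s : State} {Q : State → ℕ → Prop}

theorem wp_skip_iff : WP w ω .skip s Q ↔ Q s 1 :=
  ⟨fun ⟨_, _, h, hQ⟩ => by cases h; exact hQ, wp_skip⟩

theorem wp_const_iff {x k : ℕ} : WP w ω (.const x k) s Q ↔ k < 2 ^ w ∧ Q (s.setReg x k) 1 :=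
  ⟨fun ⟨_, _, h, hQ⟩ => by cases h; exact ⟨by assumption, hQ⟩, fun h => wp_const h.1 h.2⟩

theorem wp_op_iff {x y z : ℕ} {o : BinOp} : WP w ω (.op x o y z) s Q ↔
    o.eval (s.reg y) (s.reg z) < 2 ^ w ∧ Q (s.setReg x (o.eval (s.reg y) (s.reg z))) 1 :=
  ⟨fun ⟨_, _, h, hQ⟩ => by cases h; exact ⟨by assumption, hQ⟩, fun h => wp_op h.1 h.2⟩

theorem wp_load_iff {x a y : ℕ} :
    WP w ω (.load x a y) s Q ↔ Q (s.setReg x (s.arr a (s.reg y))) 1 :=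
  ⟨fun ⟨_, _, h, hQ⟩ => by cases h; exact hQ, wp_load⟩

theorem wp_store_iff {a y z : ℕ} :
    WP w ω (.store a y z) s Q ↔ Q (s.setArr a (s.reg y) (s.reg z)) 1 :=
  ⟨fun ⟨_, _, h, hQ⟩ => by cases h; exact hQ, wp_store⟩

theorem wp_seq_iff {p q : Cmd} : WP w ω (p ;; q) s Q ↔
    WP w ω p s fun s' t => WP w ω q s' fun s'' t' => Q s'' (t + t') :=
  ⟨fun ⟨_, _, h, hQ⟩ => by
    cases h with
    | seq hp hq => exact ⟨_, _, hp, _, _, hq, hQ⟩, wp_seq⟩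

theorem wp_ite_iff {x : ℕ} {p q : Cmd} : WP w ω (.ite x p q) s Q ↔
    (s.reg x ≠ 0 → WP w ω p s fun s' t => Q s' (t + 1)) ∧
      (s.reg x = 0 → WP w ω q s fun s' t => Q s' (t + 1)) := by
  refine ⟨fun ⟨_, _, h, hQ⟩ => ?_, fun h => wp_ite h.1 h.2⟩
  cases h with
  | ite_true hx hp => exact ⟨fun _ => ⟨_, _, hp, hQ⟩, fun h => absurd h hx⟩
  | ite_false hx hp => exact ⟨fun h => absurd hx h, fun _ => ⟨_, _, hp, hQ⟩⟩

end

end WordRAM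

/-! ## The program of the reduction -/

namespace Reduction

open WordRAM

/-- The data of an instance: `m` clauses of width `K` on `N` variables, given by the arrays `var`
and `sgn`; the length `a` of the segments; the number of blocks used for padding; and the numbers
of variables in the three parts, `N₁`, `N₁` and `N₂`. -/
structure Params where
  (K N m a pad N₁ N₂ : ℕ)
  (var sgn : ℕ → ℕ)

/-- The contents of the registers `0, …, 18`. -/
def Params.reg (P : Params) : ℕ → ℕ
  | 0 => P.N
  | 1 => P.m
  | 2 => 1
  | 3 => P.a
  | 4 => P.K
  | 5 => P.m + 4
  | 6 => P.N₁
  | 7 => 2 ^ P.N₁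
  | 8 => 2 ^ P.N₁ - 1
  | 9 => P.m + 2 ^ P.N₁
  | 10 => P.m + 2 * 2 ^ P.N₁
  | 11 => P.m + 2 * 2 ^ P.N₁ + P.pad
  | 12 => P.N₂
  | 13 => 2 ^ P.N₂
  | 14 => 2 ^ P.N₂ - 1
  | 15 => 2 * P.N₁
  | 16 => 3
  | 17 => 0
  | 18 => 3 * P.a + 4
  | _ => 0

structure Env (P : Params) (s : State) : Prop where
  reg : ∀ y < 19, s.reg y = P.reg y
  var : s.arr 0 = P.var
  sgn : s.arr 1 = P.sgn

/-- The `p`-th literal is true, for the bit vectors of the true and of the false variables. -/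
def Params.lit (P : Params) (pos neg p : ℕ) : Bool :=
  (if P.sgn p ≠ 0 then pos else neg).testBit (P.var p)

/-- Clause `c` is not satisfied by the assignment `x` to a part of the variables, which is described
by its first variable `sh` and the number `mk` with all bits equal to `1`. -/
def Params.bit (P : Params) (sh mk x c : ℕ) : Bool :=
  decide (∀ i < P.K, P.lit (x <<< sh) ((mk - x) <<< sh) (c * P.K + i) = false)

/-- Register `30` holds the position of the literal. Registers `31` and `32` hold the bit vectors of
the true and of the false variables, so a literal is tested by one shift and one mask. Any true
literal clears register `33`. -/
def litCmd : Cmd :=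
  .load 34 0 30 ;; .load 35 1 30 ;; .ite 35 (.op 36 .shr 31 34) (.op 36 .shr 32 34) ;;
    .op 36 .and 36 2 ;; .ite 36 (.const 33 0) .skip ;; .op 30 .add 30 2

/-- Unrolled, because the clause width is a constant of the program. -/
def litsCmd : ℕ → Cmd
  | 0 => .skip
  | k + 1 => litsCmd k ;; litCmd

/-- Inputs are the partial assignment (register `37`), its first variable (`38`), the all-ones mask
(`39`) and the clause (`40`). Subtraction from the mask is the bitwise complement. -/
def bitCmd (K : ℕ) : Cmd :=
  .op 31 .shl 37 38 ;; .op 32 .sub 39 37 ;; .op 32 .shl 32 38 ;; .op 30 .mul 40 4 ;; .const 33 1 ;;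
    litsCmd K

variable {P : Params} {w : ℕ} {ω : ℕ → Bool} {s s₀ : State}

theorem wp_litCmd {p pos neg bit : ℕ} (h₂ : s.reg 2 = 1) (hvar : s.arr 0 = P.var)
    (hsgn : s.arr 1 = P.sgn) (h₃₀ : s.reg 30 = p) (h₃₁ : s.reg 31 = pos) (h₃₂ : s.reg 32 = neg)
    (h₃₃ : s.reg 33 = bit) (hpos : pos < 2 ^ w) (hneg : neg < 2 ^ w) (hp : p + 1 < 2 ^ w) :
    WP w ω litCmd s fun s' t => s'.arr = s.arr ∧ s'.used = s.used ∧
      (∀ y, y < 30 ∨ 36 < y → s'.reg y = s.reg y) ∧ s'.reg 30 = p + 1 ∧ s'.reg 31 = pos ∧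
      s'.reg 32 = neg ∧ s'.reg 33 = (if P.lit pos neg p then 0 else bit) ∧ t ≤ 8 := by
  have hlit (x v : ℕ) : (x >>> v) &&& 1 = (x.testBit v).toNat := by
    rw [Nat.and_one_is_mod, Nat.testBit_eq_decide_div_mod_eq, Nat.shiftRight_eq_div_pow]
    rcases Nat.mod_two_eq_zero_or_one (x / 2 ^ v) with h | h <;> simp [h]
  have hle (x v : ℕ) (hx : x < 2 ^ w) : x >>> v < 2 ^ w :=
    (Nat.shiftRight_le x v).trans_lt hx
  have h1 : 1 < 2 ^ w := by omega
  have hle' (b : Bool) : b.toNat < 2 ^ w := by cases b <;> simp [h1]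
  simp only [litCmd, wp_seq_iff, wp_load_iff, wp_op_iff, wp_ite_iff, wp_const_iff, wp_skip_iff,
    State.reg_setReg, State.arr_setReg, State.used_setReg, BinOp.eval, h₃₀, h₃₁, h₃₂, h₂, hvar,
    hsgn, Nat.reduceEqDiff, if_true, if_false, hlit, true_and]
  constructor <;> intro hs <;> refine ⟨hle _ _ ‹_›, hle' _, fun h => ⟨by omega, hp, ?_, ?_,
    by norm_num⟩, fun h => ⟨hp, ?_, ?_, by norm_num⟩⟩
  any_goals
    intro y hy
    repeat rw [if_neg (by omega)]
  all_goals
    simp only [Params.lit, hs, ne_eq, not_true, if_false, if_true, not_false_iff]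
    rcases hb : Nat.testBit _ _ <;> simp_all

theorem wp_litsCmd {p pos neg : ℕ} (k : ℕ) (h₂ : s.reg 2 = 1) (hvar : s.arr 0 = P.var)
    (hsgn : s.arr 1 = P.sgn) (h₃₀ : s.reg 30 = p) (h₃₁ : s.reg 31 = pos) (h₃₂ : s.reg 32 = neg)
    (h₃₃ : s.reg 33 = 1) (hpos : pos < 2 ^ w) (hneg : neg < 2 ^ w) (hp : p + k + 1 < 2 ^ w) :
    WP w ω (litsCmd k) s fun s' t => s'.arr = s.arr ∧ s'.used = s.used ∧
      (∀ y, y < 30 ∨ 36 < y → s'.reg y = s.reg y) ∧ s'.reg 30 = p + k ∧ s'.reg 31 = pos ∧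
      s'.reg 32 = neg ∧
      s'.reg 33 = (decide (∀ i < k, P.lit pos neg (p + i) = false)).toNat ∧ t ≤ 8 * k + 1 := by
  induction k with
  | zero => exact wp_skip ⟨rfl, rfl, fun _ _ => rfl, h₃₀, h₃₁, h₃₂, by simp [h₃₃], by norm_num⟩
  | succ k ih =>
    refine wp_seq ((ih (by omega)).mono ?_)
    rintro s₁ t₁ ⟨a₁, u₁, r₁, b₁, b₂, b₃, b₄, c₁⟩
    refine (wp_litCmd ((r₁ 2 (by norm_num)).trans h₂) (by rw [a₁, hvar]) (by rw [a₁, hsgn]) b₁ b₂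
      b₃ b₄ hpos hneg (by omega)).mono ?_
    rintro s₂ t₂ ⟨a₂, u₂, r₂, d₁, d₂, d₃, d₄, c₂⟩
    refine ⟨a₂.trans a₁, u₂.trans u₁, fun y hy => (r₂ y hy).trans (r₁ y hy), d₁, d₂, d₃, ?_,
      by omega⟩
    rw [d₄]
    have : (∀ i < k + 1, P.lit pos neg (p + i) = false) ↔
        P.lit pos neg (p + k) = false ∧ ∀ i < k, P.lit pos neg (p + i) = false := by
      constructor
      · exact fun h => ⟨h k (by omega), fun i hi => h i (by omega)⟩
      · rintro ⟨h, h'⟩ i hi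
        rcases Nat.lt_succ_iff_lt_or_eq.mp hi with hi | rfl
        · exact h' i hi
        · exact h
    simp only [this]
    cases P.lit pos neg (p + k) <;> simp

/-- The final state of a computation that only changes registers between `30` and `36`. -/
structure TempFrame (s s' : State) : Prop where
  arr : s'.arr = s.arr
  used : s'.used = s.used
  reg : ∀ y, y < 30 ∨ 36 < y → s'.reg y = s.reg y

theorem wp_bitCmd {x sh mk c k : ℕ} (hE : Env P s) (h₃₇ : s.reg 37 = x) (h₃₈ : s.reg 38 = sh)
    (h₃₉ : s.reg 39 = mk) (h₄₀ : s.reg 40 = c) (hx : x ≤ mk) (hmk : mk < 2 ^ k)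
    (hk : k + sh ≤ w) (hc : c < P.m) (hm : P.m * P.K + 1 < 2 ^ w) :
    WP w ω (bitCmd P.K) s fun s' t => TempFrame s s' ∧
      s'.reg 33 = (P.bit sh mk x c).toNat ∧ t ≤ 8 * P.K + 6 := by
  have hsh {y : ℕ} (hy : y ≤ mk) : y <<< sh < 2 ^ w := by
    rw [Nat.shiftLeft_eq]
    calc y * 2 ^ sh < 2 ^ k * 2 ^ sh := Nat.mul_lt_mul_of_pos_right (by omega) (by positivity)
      _ = 2 ^ (k + sh) := (pow_add ..).symm
      _ ≤ 2 ^ w := Nat.pow_le_pow_right (by norm_num) hk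
  have hcK : c * P.K + P.K + 1 < 2 ^ w := by
    have := Nat.mul_le_mul_right P.K (show c + 1 ≤ P.m from hc)
    rw [add_mul] at this
    omega
  have e₄ : s.reg 4 = P.K := hE.reg 4 (by norm_num)
  have hmk' : mk < 2 ^ w := hmk.trans_le (Nat.pow_le_pow_right (by norm_num) (by omega))
  simp only [bitCmd, wp_seq_iff, wp_op_iff, wp_const_iff, State.reg_setReg, BinOp.eval,
    Nat.reduceEqDiff, if_true, if_false, h₃₇, h₃₈, h₃₉, h₄₀, e₄]
  refine ⟨hsh hx, by omega, hsh (by omega), by omega, by omega, ?_⟩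
  refine WP.mono (wp_litsCmd (P := P) (p := c * P.K) (pos := x <<< sh) (neg := (mk - x) <<< sh) P.K
    (hE.reg 2 (by norm_num)) hE.var hE.sgn (by simp) (by simp) (by simp) (by simp) (hsh hx)
    (hsh (by omega)) hcK) ?_
  rintro s' t ⟨h₁, h₂, h₃, -, -, -, h₄, h₅⟩
  refine ⟨⟨h₁, h₂, fun y hy => ?_⟩, h₄, by omega⟩
  rw [h₃ y hy]
  simp only [State.reg_setReg]
  repeat rw [if_neg (by omega)]

end Reduction

/-! ### Computing the segments of the initial graph -/

namespace Reduction

open WordRAM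

/-- The number of vertices. -/
def Params.n (P : Params) : ℕ := segs P.m (2 ^ P.N₁) P.pad * P.a + 1

/-- The words are long enough for the instance. -/
structure Fits (P : Params) (w : ℕ) : Prop where
  two_le : 2 ≤ P.a
  size : 4 * P.n < 2 ^ w
  clauses : P.m * P.K + 1 < 2 ^ w
  vars : 2 * P.N₁ + P.N₂ < w
  stages : 2 ^ P.N₂ + 3 < 2 ^ w

def Params.bu (P : Params) : ℕ → ℕ → Bool := P.bit 0 (2 ^ P.N₁ - 1)

def Params.bv (P : Params) : ℕ → ℕ → Bool := P.bit P.N₁ (2 ^ P.N₁ - 1)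

def Params.bw (P : Params) : ℕ → ℕ → Bool := P.bit (2 * P.N₁) (2 ^ P.N₂ - 1)

/-- Registers `off` and `sh` hold the first block and the first variable of the family; `e` selects
`c_U` (2) or `c_V` (4). The difference `j - 3` is nonzero exactly for arms, and the coordinate is
one less. -/
def extCmd (K off sh e : ℕ) : Cmd :=
  .op 45 .sub 23 16 ;; .ite 45 (.op 37 .sub 22 off ;; .op 38 .add sh 17 ;; .op 39 .add 8 17 ;;
    .op 40 .sub 45 2 ;; bitCmd K ;;
    .ite 33 (.const 45 e ;; .op 29 .mul 40 5 ;; .op 29 .add 29 45) .skip) .skip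

/-- For `dec` the initial graph has all stage edges. The test for `j = 3` adds the two truncated
differences of `j` and 3. -/
def coordCmd (dec : Bool) : Cmd :=
  .op 45 .and 23 2 ;; .op 46 .add 43 23 ;; .op 28 .mul 45 46 ;;
    if dec then .op 45 .sub 23 16 ;; .op 46 .sub 16 23 ;; .op 45 .add 45 46 ;;
      .ite 45 .skip (.op 29 .add 43 2 ;; .op 29 .add 29 2)
    else .skip

/-- Compute `par` and `ext` for segment `j` of block `b`. -/
def segCmd (K : ℕ) (dec : Bool) : Cmd :=
  .op 43 .mul 22 5 ;; .const 28 0 ;; .const 29 0 ;; .op 44 .sub 1 22 ;;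
    .ite 44 (coordCmd dec) (.op 44 .sub 9 22 ;;
      .ite 44 (.ite 23 (.op 28 .add 43 2) .skip ;; extCmd K 1 17 2)
        (.op 44 .sub 10 22 ;;
          .ite 44 (.ite 23 (.op 44 .sub 23 16 ;; .op 44 .sub 23 44 ;; .op 28 .add 43 44) .skip ;;
            extCmd K 9 6 4) .skip))

variable {P : Params} {w : ℕ} {ω : ℕ → Bool} {s s₀ : State}

theorem Env.congr {s' : State} (hE : Env P s) (h : ∀ y < 19, s'.reg y = s.reg y)
    (h₀ : s'.arr 0 = s.arr 0) (h₁ : s'.arr 1 = s.arr 1) : Env P s' :=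
  ⟨fun y hy => (h y hy).trans (hE.reg y hy), h₀.trans hE.var, h₁.trans hE.sgn⟩

theorem Fits.segs_lt (h : Fits P w) : 4 * segs P.m (2 ^ P.N₁) P.pad + 4 < 2 ^ w := by
  have h₁ := h.size
  have h₂ := Nat.mul_le_mul_left (segs P.m (2 ^ P.N₁) P.pad) (show 1 ≤ P.a by
    have := h.two_le; omega)
  unfold Params.n at h₁
  omega

theorem Fits.block_le {b j : ℕ} (hb : b < P.m + 2 * 2 ^ P.N₁ + P.pad) (hj : j < P.m + 4) :
    b * (P.m + 4) + j < segs P.m (2 ^ P.N₁) P.pad :=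
  block_lt hb hj

theorem blocks_le : P.m + 2 * 2 ^ P.N₁ + P.pad ≤ segs P.m (2 ^ P.N₁) P.pad :=
  Nat.le_mul_of_pos_right _ (by omega)

theorem wp_extCmd {b j off sh e x x' : ℕ} (hF : Fits P w) (hE : Env P s) (h₂₂ : s.reg 22 = b)
    (h₂₃ : s.reg 23 = j) (h₂₉ : s.reg 29 = 0) (hoff : b - s.reg off = x) (hoff' : off < 19)
    (hsh : s.reg sh = x') (hsh' : sh < 19) (hx' : x' ≤ P.N₁) (hx : x < 2 ^ P.N₁)
    (hb : b < P.m + 2 * 2 ^ P.N₁ + P.pad) (hj : j < P.m + 4) (he : e ≤ 4) :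
    WP w ω (extCmd P.K off sh e) s fun s' t => s'.arr = s.arr ∧ s'.used = s.used ∧
      (∀ y, y < 29 ∨ 45 < y → s'.reg y = s.reg y) ∧
      s'.reg 29 = (if 4 ≤ j ∧ P.bit x' (2 ^ P.N₁ - 1) x (j - 4) then (j - 4) * (P.m + 4) + e else 0)
      ∧ t ≤ 8 * P.K + 20 := by
  have hsegs := hF.segs_lt
  have hbl := Fits.block_le (j := P.m + 3) hb (by omega)
  have hbJ : b ≤ b * (P.m + 4) := Nat.le_mul_of_pos_right b (by omega)
  have hpow : 2 ^ P.N₁ ≤ 2 ^ w := Nat.pow_le_pow_right (by norm_num) (by have := hF.vars; omega)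
  have hxw : x' < 2 ^ w := lt_of_le_of_lt (b := w) (by have := hF.vars; omega) Nat.lt_two_pow_self
  have e₁₆ : s.reg 16 = 3 := hE.reg 16 (by norm_num)
  have e₁₇ : s.reg 17 = 0 := hE.reg 17 (by norm_num)
  have e₈ : s.reg 8 = 2 ^ P.N₁ - 1 := hE.reg 8 (by norm_num)
  have e₂ : s.reg 2 = 1 := hE.reg 2 (by norm_num)
  have e₅ : s.reg 5 = P.m + 4 := hE.reg 5 (by norm_num)
  have n₁ (k : ℕ) (hk : 19 ≤ k) : (off = k) = False := by simp; omega
  have n₂ (k : ℕ) (hk : 19 ≤ k) : (sh = k) = False := by simp; omega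
  simp only [extCmd, wp_seq_iff (p := .op ..), wp_op_iff, wp_ite_iff (x := 45), wp_skip_iff, State.reg_setReg,
    BinOp.eval, Nat.reduceEqDiff, if_true, if_false, h₂₂, h₂₃, e₁₆, e₁₇, e₈, e₂, n₁ 45 (by norm_num),
    n₂ 45 (by norm_num), n₂ 37 (by norm_num), hoff, hsh]
  refine ⟨by omega, fun h => ⟨by omega, by omega, by omega, by omega, ?_⟩, fun h => ?_⟩
  · refine wp_seq (WP.mono (wp_bitCmd (P := P) (x := x) (sh := x') (mk := 2 ^ P.N₁ - 1)
      (c := j - 4) (k := P.N₁) ?_ (by simp) (by simp) (by simp) (by simp; omega) (by omega)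
      (by omega) (by have := hF.vars; omega) (by omega) hF.clauses) ?_)
    · refine hE.congr (fun y hy => ?_) rfl rfl
      simp only [State.reg_setReg]
      repeat rw [if_neg (by omega)]
    · rintro s' t ⟨hT, h₃₃, ht⟩
      have hr (y : ℕ) (hy : y < 29 ∨ 45 < y) : s'.reg y = s.reg y := by
        rw [hT.reg y (by omega)]
        simp only [State.reg_setReg]
        repeat rw [if_neg (by omega)]
      have h₄₀ : s'.reg 40 = j - 4 := by
        rw [hT.reg 40 (by norm_num)]; simp; omega
      have h₂₉' : s'.reg 29 = 0 := by
        rw [hT.reg 29 (by norm_num)]; simp [h₂₉]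
      have hcJ : (j - 4) * (P.m + 4) + 4 < 2 ^ w := by
        have := Fits.block_le (P := P) (b := j - 4) (j := P.m + 3) (by omega) (by omega)
        omega
      simp only [wp_seq_iff, wp_ite_iff, wp_op_iff, wp_const_iff, wp_skip_iff, State.reg_setReg,
        State.arr_setReg, State.used_setReg, BinOp.eval, Nat.reduceEqDiff, if_true, if_false, h₃₃,
        h₄₀, (hr 5 (by norm_num)).trans e₅]
      refine ⟨fun hb' => ⟨by omega, by omega, by omega, hT.arr, hT.used, fun y hy => ?_, ?_,
        by omega⟩, fun hb' => ⟨hT.arr, hT.used, hr, ?_, by omega⟩⟩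
      · repeat rw [if_neg (by omega)]
        exact hr y hy
      · rw [if_pos ⟨by omega, by simpa using hb'⟩]
      · rw [if_neg (by simp at hb'; simp [hb']), h₂₉']
  · refine ⟨rfl, rfl, fun y hy => ?_, ?_, by omega⟩
    · rw [if_neg (by omega)]
    · rw [if_neg (by omega), h₂₉]

theorem wp_segCmd {b j : ℕ} {dec : Bool} (hF : Fits P w) (hE : Env P s) (h₂₂ : s.reg 22 = b)
    (h₂₃ : s.reg 23 = j) (hb : b < P.m + 2 * 2 ^ P.N₁ + P.pad) (hj : j < P.m + 4) :
    WP w ω (segCmd P.K dec) s fun s' t => s'.arr = s.arr ∧ s'.used = s.used ∧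
      (∀ y, y < 28 ∨ 46 < y → s'.reg y = s.reg y) ∧
      s'.reg 28 = parBJ P.m (2 ^ P.N₁) b j ∧
      s'.reg 29 = extBJ P.m (2 ^ P.N₁) P.bu P.bv (fun _ => dec) b j ∧ t ≤ 8 * P.K + 40 := by
  have hsegs := hF.segs_lt
  have hB := blocks_le (P := P)
  have hbl := Fits.block_le (j := P.m + 3) hb (by omega)
  have hbJ : b ≤ b * (P.m + 4) := Nat.le_mul_of_pos_right b (by omega)
  have e₁₆ : s.reg 16 = 3 := hE.reg 16 (by norm_num)
  have e₁ : s.reg 1 = P.m := hE.reg 1 (by norm_num)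
  have e₂ : s.reg 2 = 1 := hE.reg 2 (by norm_num)
  have e₅ : s.reg 5 = P.m + 4 := hE.reg 5 (by norm_num)
  have e₉ : s.reg 9 = P.m + 2 ^ P.N₁ := hE.reg 9 (by norm_num)
  have e₁₀ : s.reg 10 = P.m + 2 * 2 ^ P.N₁ := hE.reg 10 (by norm_num)
  have e₁₇ : s.reg 17 = 0 := hE.reg 17 (by norm_num)
  have e₆ : s.reg 6 = P.N₁ := hE.reg 6 (by norm_num)
  have hEnv {s' : State} (ha : s'.arr = s.arr) (hr : ∀ y, y < 28 ∨ 46 < y → s'.reg y = s.reg y) :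
      Env P s' := hE.congr (fun y hy => hr y (by omega)) (by rw [ha]) (by rw [ha])
  have frame {s' s'' : State} (hr : ∀ y, y < 28 ∨ 46 < y → s'.reg y = s.reg y)
      (hr' : ∀ y, y < 29 ∨ 45 < y → s''.reg y = s'.reg y) :
      ∀ y, y < 28 ∨ 46 < y → s''.reg y = s.reg y :=
    fun y hy => (hr' y (by omega)).trans (hr y hy)
  simp only [segCmd, wp_seq_iff (p := .op ..), wp_seq_iff (p := .const ..), wp_op_iff,
    wp_const_iff, wp_ite_iff (x := 44), State.reg_setReg, BinOp.eval, Nat.reduceEqDiff, if_true,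
    if_false, h₂₂, e₁, e₅, e₉, e₁₀]
  refine ⟨by omega, by omega, by omega, by omega, fun h₁ => ?_, fun h₁ => ⟨by omega,
    fun h₂ => ?_, fun h₂ => ⟨by omega, fun h₃ => ?_, fun h₃ => ?_⟩⟩⟩
  · have hb' : b < P.m := by omega
    have hjm : j % 2 * (b * (P.m + 4) + j) < 2 ^ w := by
      rcases Nat.mod_two_eq_zero_or_one j with h | h <;> rw [h] <;> omega
    have hpar : j % 2 * (b * (P.m + 4) + j) = parBJ P.m (2 ^ P.N₁) b j := by
      rw [parBJ, if_pos hb']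
      rcases Nat.mod_two_eq_zero_or_one j with h | h <;> simp [h]
    have hext : extBJ P.m (2 ^ P.N₁) P.bu P.bv (fun _ => dec) b j =
        if j = 3 ∧ dec then b * (P.m + 4) + 2 else 0 := by
      rw [extBJ, if_pos hb']
    rw [hext]
    cases dec
    · simp only [coordCmd, Bool.false_eq_true, and_false, wp_seq_iff, wp_op_iff, wp_skip_iff,
        State.reg_setReg, State.arr_setReg, State.used_setReg, BinOp.eval, Nat.reduceEqDiff,
        if_true, if_false, h₂₃, e₂, Nat.and_one_is_mod, true_and]
      refine ⟨by omega, by omega, hjm, fun y hy => ?_, hpar, by omega⟩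
      repeat rw [if_neg (by omega)]
    · simp only [coordCmd, and_true, wp_seq_iff, wp_op_iff, wp_skip_iff, wp_ite_iff,
        State.reg_setReg, State.arr_setReg, State.used_setReg, BinOp.eval, Nat.reduceEqDiff,
        if_true, if_false, h₂₃, e₂, e₁₆, Nat.and_one_is_mod, true_and]
      refine ⟨by omega, by omega, hjm, by omega, by omega, by omega, fun h => ⟨fun y hy => ?_,
        hpar, ?_, by omega⟩, fun h => ⟨by omega, by omega, fun y hy => ?_, hpar, ?_, by omega⟩⟩
      · repeat rw [if_neg (by omega)]
      · rw [if_neg (by omega)]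
      · repeat rw [if_neg (by omega)]
      · rw [if_pos (by omega)]
  · have hb' : ¬ b < P.m := by omega
    have hb'' : b < P.m + 2 ^ P.N₁ := by omega
    have hpar : parBJ P.m (2 ^ P.N₁) b j = if j = 0 then 0 else b * (P.m + 4) + 1 := by
      rw [parBJ, if_neg hb', if_pos hb'']
    have hext : extBJ P.m (2 ^ P.N₁) P.bu P.bv (fun _ => dec) b j =
        if 4 ≤ j ∧ P.bu (b - P.m) (j - 4) then (j - 4) * (P.m + 4) + 2 else 0 := by
      rw [extBJ, if_neg hb', if_pos hb'']
    rw [hpar, hext]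
    refine wp_seq (WP.mono (Q := fun s' t => s'.arr = s.arr ∧ s'.used = s.used ∧
      (∀ y, y < 28 ∨ 46 < y → s'.reg y = s.reg y) ∧
      s'.reg 28 = (if j = 0 then 0 else b * (P.m + 4) + 1) ∧ s'.reg 29 = 0 ∧ t ≤ 3) ?_ ?_)
    · simp only [wp_op_iff, wp_skip_iff, wp_ite_iff, State.reg_setReg, State.arr_setReg,
        State.used_setReg, BinOp.eval, Nat.reduceEqDiff, if_true, if_false, h₂₃, e₂, true_and]
      refine ⟨fun h => ⟨by omega, fun y hy => ?_, by rw [if_neg h], by omega⟩,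
        fun h => ⟨fun y hy => ?_, by rw [if_pos h], by omega⟩⟩ <;>
      repeat rw [if_neg (by omega)]
    · rintro s₁ t₁ ⟨a₁, u₁, r₁, p₁, x₁, c₁⟩
      refine (wp_extCmd (x := b - P.m) (x' := 0) hF (hEnv a₁ r₁) ((r₁ 22 (by omega)).trans h₂₂)
        ((r₁ 23 (by omega)).trans h₂₃) x₁ (by rw [r₁ 1 (by omega), e₁]) (by omega)
        ((r₁ 17 (by omega)).trans e₁₇) (by omega) (by omega) (by omega) hb hj (by omega)).mono ?_
      rintro s₂ t₂ ⟨a₂, u₂, r₂, x₂, c₂⟩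
      exact ⟨a₂.trans a₁, u₂.trans u₁, frame r₁ r₂, (r₂ 28 (by omega)).trans p₁, x₂, by omega⟩
  · have hb' : ¬ b < P.m := by omega
    have hb'' : ¬ b < P.m + 2 ^ P.N₁ := by omega
    have hb₃ : b < P.m + 2 * 2 ^ P.N₁ := by omega
    have hpar : parBJ P.m (2 ^ P.N₁) b j = if j = 0 then 0 else b * (P.m + 4) + min j 3 := by
      rw [parBJ, if_neg hb', if_neg hb'', if_pos hb₃]
    have hext : extBJ P.m (2 ^ P.N₁) P.bu P.bv (fun _ => dec) b j =
        if 4 ≤ j ∧ P.bv (b - P.m - 2 ^ P.N₁) (j - 4) then (j - 4) * (P.m + 4) + 4 else 0 := by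
      rw [extBJ, if_neg hb', if_neg hb'', if_pos hb₃]
    rw [hpar, hext]
    refine wp_seq (WP.mono (Q := fun s' t => s'.arr = s.arr ∧ s'.used = s.used ∧
      (∀ y, y < 28 ∨ 46 < y → s'.reg y = s.reg y) ∧
      s'.reg 28 = (if j = 0 then 0 else b * (P.m + 4) + min j 3) ∧ s'.reg 29 = 0 ∧ t ≤ 5) ?_ ?_)
    · simp only [wp_op_iff, wp_skip_iff, wp_ite_iff, wp_seq_iff, State.reg_setReg,
        State.arr_setReg, State.used_setReg, BinOp.eval, Nat.reduceEqDiff, if_true, if_false,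
        h₂₃, e₁₆, true_and]
      refine ⟨fun h => ⟨by omega, by omega, by omega, fun y hy => ?_, ?_, by omega⟩,
        fun h => ⟨fun y hy => ?_, by rw [if_pos h], by omega⟩⟩
      · repeat rw [if_neg (by omega)]
      · rw [if_neg h]
        omega
      · repeat rw [if_neg (by omega)]
    · rintro s₁ t₁ ⟨a₁, u₁, r₁, p₁, x₁, c₁⟩
      refine (wp_extCmd (x := b - P.m - 2 ^ P.N₁) (x' := P.N₁) hF (hEnv a₁ r₁)
        ((r₁ 22 (by omega)).trans h₂₂) ((r₁ 23 (by omega)).trans h₂₃) x₁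
        (by rw [r₁ 9 (by omega), e₉]; omega) (by omega)
        ((r₁ 6 (by omega)).trans e₆) (by omega) (by omega) (by omega) hb hj (by omega)).mono ?_
      rintro s₂ t₂ ⟨a₂, u₂, r₂, x₂, c₂⟩
      exact ⟨a₂.trans a₁, u₂.trans u₁, frame r₁ r₂, (r₂ 28 (by omega)).trans p₁, x₂, by omega⟩
  · simp only [wp_skip_iff, State.reg_setReg, State.arr_setReg, State.used_setReg,
      Nat.reduceEqDiff, if_true, if_false, true_and, parBJ, extBJ]
    rw [if_neg (by omega), if_neg (by omega), if_neg (by omega), if_neg (by omega),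
      if_neg (by omega), if_neg (by omega)]
    refine ⟨fun y hy => ?_, rfl, rfl, by omega⟩
    repeat rw [if_neg (by omega)]

end Reduction

/-! ### Writing the edge list into the simulated memory -/

namespace Reduction

open WordRAM

/-- Arrays `6` and `9` represent arrays `0` and `1` of the simulated program, so the list is written
where the algorithm expects its input. -/
def emitCmd (p q : ℕ) : Cmd := .store 6 21 p ;; .store 9 21 q ;; .op 21 .add 21 2

/-- Vertices are numbered consecutively along the segments. Register `20` holds the last number and
`28` the predecessor, which differs from it only for the first edge of a segment. -/
def pathCmd : Cmd :=
  forLoop 24 27 3 (.op 41 .add 20 2 ;; emitCmd 41 28 ;; .op 28 .add 41 17 ;; .op 20 .add 41 17)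

def segmentCmd (K : ℕ) (dec : Bool) : Cmd :=
  segCmd K dec ;; .op 28 .mul 28 3 ;; pathCmd ;; .ite 29 (.op 42 .mul 29 3 ;; emitCmd 20 42) .skip

/-- Write the edge list. -/
def buildCmd (K : ℕ) (dec : Bool) : Cmd :=
  .const 20 0 ;; .const 21 0 ;; forLoop 22 25 11 (forLoop 23 26 5 (segmentCmd K dec))

/-- The arrays for the simulated memory contain the edge list `L`, and nothing else. -/
structure Built (s : State) (L : List (ℕ × ℕ)) : Prop where
  src : ∀ i, s.arr 6 i = (L[i]?.getD (0, 0)).1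
  tgt : ∀ i, s.arr 9 i = (L[i]?.getD (0, 0)).2
  len : s.reg 21 = L.length
  rest : ∀ k, k ≠ 0 → k ≠ 1 → k ≠ 6 → k ≠ 9 → ∀ i, s.arr k i = 0
  used : s.used = 0

variable {P : Params} {w : ℕ} {ω : ℕ → Bool} {s s₀ : State} {L : List (ℕ × ℕ)}

theorem Built.congr {s' : State} (h : Built s L) (ha : s'.arr = s.arr) (hu : s'.used = s.used)
    (hr : s'.reg 21 = s.reg 21) : Built s' L := by
  obtain ⟨h₁, h₂, h₃, h₄, h₅⟩ := h
  exact ⟨by rwa [ha], by rwa [ha], by rwa [hr], by rwa [ha], by rwa [hu]⟩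

theorem Built.setReg (h : Built s L) {x v : ℕ} (hx : x ≠ 21) : Built (s.setReg x v) L :=
  h.congr rfl rfl (by simp [hx.symm])

theorem Env.setReg (h : Env P s) {x v : ℕ} (hx : 19 ≤ x) : Env P (s.setReg x v) :=
  h.congr (fun y hy => by simp; omega) rfl rfl

theorem getElem?_append_one (L : List (ℕ × ℕ)) (p : ℕ × ℕ) (i : ℕ) :
    ((L ++ [p])[i]?.getD (0, 0)) = if i = L.length then p else L[i]?.getD (0, 0) := by
  rcases lt_trichotomy i L.length with h | h | h
  · rw [List.getElem?_append_left h, if_neg h.ne]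
  · rw [if_pos h, h]
    simp
  · rw [if_neg h.ne', List.getElem?_eq_none (by simp; omega), List.getElem?_eq_none h.le]

theorem wp_emitCmd {p q : ℕ} (hB : Built s L) (h₂ : s.reg 2 = 1) (hL : L.length + 1 < 2 ^ w)
    {Q : State → ℕ → Prop}
    (hQ : ∀ s', Built s' (L ++ [(s.reg p, s.reg q)]) → (∀ y, y ≠ 21 → s'.reg y = s.reg y) →
      s'.arr 0 = s.arr 0 → s'.arr 1 = s.arr 1 → Q s' 3) : WP w ω (emitCmd p q) s Q := by
  have hl := hB.len
  simp only [emitCmd, wp_seq_iff, wp_store_iff, wp_op_iff, State.reg_setArr, BinOp.eval, hl, h₂]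
  refine ⟨hL, hQ _ ⟨fun i => ?_, fun i => ?_, by simp, fun k h₀ h₁ h₆ h₉ i => ?_, hB.used⟩
    (fun y hy => by simp [hy]) ?_ ?_⟩
  · rw [getElem?_append_one, State.arr_setReg, State.arr_setArr_of_ne _ _ _ (by norm_num),
      State.arr_setArr, hB.src]
    simp only [true_and]
    split_ifs <;> rfl
  · rw [getElem?_append_one, State.arr_setReg, State.arr_setArr,
      State.arr_setArr_of_ne _ _ _ (by norm_num), hB.tgt]
    simp only [true_and]
    split_ifs <;> rfl
  · rw [State.arr_setReg, State.arr_setArr_of_ne _ _ _ h₉, State.arr_setArr_of_ne _ _ _ h₆]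
    exact hB.rest k h₀ h₁ h₆ h₉ i
  all_goals
    rw [State.arr_setReg, State.arr_setArr_of_ne _ _ _ (by norm_num),
      State.arr_setArr_of_ne _ _ _ (by norm_num)]

theorem wp_pathCmd {c q : ℕ} (hE : Env P s) (hB : Built s L) (h₂₀ : s.reg 20 = c)
    (h₂₈ : s.reg 28 = q) (hc : c + P.a + 1 < 2 ^ w) (hL : L.length + P.a + 1 < 2 ^ w) :
    WP w ω pathCmd s fun s' t => Env P s' ∧
      Built s' (L ++ (List.range P.a).map fun i => (c + i + 1, if i = 0 then q else c + i)) ∧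
      s'.reg 20 = c + P.a ∧ (∀ y, y = 22 ∨ y = 23 ∨ y = 29 → s'.reg y = s.reg y) ∧
      t ≤ 9 * P.a + 3 := by
  have := wp_forLoop_const (w := w) (ω := ω) (i := 24) (j := 27) (n := 3) (N := P.a) (s := s)
    (p := .op 41 .add 20 2 ;; emitCmd 41 28 ;; .op 28 .add 41 17 ;; .op 20 .add 41 17)
    (fun k s' => Env P s' ∧
      Built s' (L ++ (List.range k).map fun i => (c + i + 1, if i = 0 then q else c + i)) ∧
      s'.reg 20 = c + k ∧ s'.reg 28 = (if k = 0 then q else c + k) ∧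
      ∀ y, y = 22 ∨ y = 23 ∨ y = 29 → s'.reg y = s.reg y) 6 (by omega) (by norm_num)
    (by norm_num) (fun k s' h => ⟨h.1.reg 3 (by norm_num), h.1.reg 2 (by norm_num)⟩)
    ?_ ?_ ?_ ⟨hE, by simpa using hB, h₂₀, h₂₈, fun _ _ => rfl⟩
  · refine this.mono fun s' t h => ⟨h.1.1, h.1.2.1, h.1.2.2.1, h.1.2.2.2.2, by omega⟩
  · rintro k s' v ⟨h₁, h₂, h₃, h₄, h₅⟩
    refine ⟨h₁.setReg (by norm_num), h₂.setReg (by norm_num), by simpa using h₃, by simpa using h₄,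
      fun y hy => ?_⟩
    rw [State.reg_setReg, if_neg (by omega), h₅ y hy]
  · rintro k s' v ⟨h₁, h₂, h₃, h₄, h₅⟩
    refine ⟨h₁.setReg (by norm_num), h₂.setReg (by norm_num), by simpa using h₃, by simpa using h₄,
      fun y hy => ?_⟩
    rw [State.reg_setReg, if_neg (by omega), h₅ y hy]
  · rintro k s' hk ⟨h₁, h₂, h₃, h₄, h₅⟩ h₂₄
    have e₂ : s'.reg 2 = 1 := h₁.reg 2 (by norm_num)
    have e₁₇ : s'.reg 17 = 0 := h₁.reg 17 (by norm_num)
    refine wp_seq (wp_op (by simp only [BinOp.eval, h₃, e₂]; omega) (wp_seq (wp_emitCmd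
      (h₂.setReg (by norm_num)) (by simpa using e₂) (by simp; omega) ?_)))
    intro s₁ hB₁ hr₁ ha₀ ha₁
    have f₄₁ : s₁.reg 41 = c + k + 1 := by rw [hr₁ 41 (by norm_num)]; simp [BinOp.eval, h₃, e₂]
    have f₁₇ : s₁.reg 17 = 0 := by rw [hr₁ 17 (by norm_num)]; simp [e₁₇]
    have f (y : ℕ) (hy : y ≠ 21) (hy' : y ≠ 41) : s₁.reg y = s'.reg y := by
      rw [hr₁ y hy, State.reg_setReg, if_neg hy']
    simp only [wp_seq_iff, wp_op_iff, BinOp.eval, State.reg_setReg, Nat.reduceEqDiff, if_true,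
      if_false, f₄₁, f₁₇]
    refine ⟨by omega, by omega, ⟨?_, ?_, by omega, by omega, fun y hy => ?_⟩, ?_, by omega⟩
    · refine Env.setReg (Env.setReg (h₁.congr (fun y hy => f y (by omega) (by omega)) ha₀ ha₁)
        (by norm_num)) (by norm_num)
    · refine Built.setReg (Built.setReg ?_ (by norm_num)) (by norm_num)
      rw [List.range_succ, List.map_append, ← List.append_assoc]
      simpa [BinOp.eval, h₃, h₄, e₂] using hB₁
    · repeat rw [if_neg (by omega)]
      rw [f y (by omega) (by omega), h₅ y hy]
    · rw [f 24 (by norm_num) (by norm_num), h₂₄]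

theorem edgeList_succ (S a : ℕ) (par ext : ℕ → ℕ) : SegGraph.edgeList (S + 1) a par ext =
    SegGraph.edgeList S a par ext ++ SegGraph.segList a par ext S := by
  simp [SegGraph.edgeList, List.range_succ]

/-- The edges of the first `S` segments of the initial graph. -/
def Params.edges (P : Params) (dec : Bool) (S : ℕ) : List (ℕ × ℕ) :=
  SegGraph.edgeList S P.a (par P.m (2 ^ P.N₁)) (ext P.m (2 ^ P.N₁) P.bu P.bv fun _ => dec)

theorem length_edges_le (hF : Fits P w) {dec : Bool} {S : ℕ}
    (hS : S ≤ segs P.m (2 ^ P.N₁) P.pad) : (P.edges dec S).length ≤ 2 * P.n := by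
  refine SegGraph.length_edgeList_le.trans ?_
  have h₁ := Nat.mul_le_mul_right (P.a + 1) hS
  have h₂ := Nat.mul_le_mul_left (segs P.m (2 ^ P.N₁) P.pad) (show 1 ≤ P.a by
    have := hF.two_le; omega)
  unfold Params.n
  rw [mul_add S, mul_add (segs _ _ _)] at h₁
  rw [mul_add S]
  omega

theorem wp_segmentCmd {b j : ℕ} {dec : Bool} (hF : Fits P w) (hE : Env P s) (h₂₂ : s.reg 22 = b)
    (h₂₃ : s.reg 23 = j) (hb : b < P.m + 2 * 2 ^ P.N₁ + P.pad) (hj : j < P.m + 4)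
    (hB : Built s (P.edges dec (b * (P.m + 4) + j)))
    (h₂₀ : s.reg 20 = (b * (P.m + 4) + j) * P.a) :
    WP w ω (segmentCmd P.K dec) s fun s' t => Env P s' ∧
      Built s' (P.edges dec (b * (P.m + 4) + (j + 1))) ∧
      s'.reg 20 = (b * (P.m + 4) + (j + 1)) * P.a ∧
      (∀ y, y = 22 ∨ y = 23 → s'.reg y = s.reg y) ∧ t ≤ 8 * P.K + 9 * P.a + 50 := by
  set σ := b * (P.m + 4) + j with hσ
  have hσS : σ < segs P.m (2 ^ P.N₁) P.pad := Fits.block_le hb hj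
  have hsize := hF.size
  have hlen := length_edges_le hF (dec := dec) hσS.le
  have hmul : (σ + 1) * P.a ≤ segs P.m (2 ^ P.N₁) P.pad * P.a := Nat.mul_le_mul_right _ hσS
  have hn : P.n = segs P.m (2 ^ P.N₁) P.pad * P.a + 1 := rfl
  have hwf : SegGraph.Wf P.a (par P.m (2 ^ P.N₁))
      (ext P.m (2 ^ P.N₁) P.bu P.bv fun _ => dec) := wf hF.two_le
  have hpar : parBJ P.m (2 ^ P.N₁) b j = par P.m (2 ^ P.N₁) σ := (par_eq hj).symm
  have hext : extBJ P.m (2 ^ P.N₁) P.bu P.bv (fun _ => dec) b j =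
      ext P.m (2 ^ P.N₁) P.bu P.bv (fun _ => dec) σ := (ext_eq hj).symm
  have hpar' : par P.m (2 ^ P.N₁) σ * P.a ≤ σ * P.a := Nat.mul_le_mul_right _ (hwf.par_le σ)
  have hext' : ext P.m (2 ^ P.N₁) P.bu P.bv (fun _ => dec) σ * P.a ≤ σ * P.a :=
    Nat.mul_le_mul_right _ (hwf.ext_le σ)
  rw [add_mul, one_mul] at hmul
  refine wp_seq ((wp_segCmd (dec := dec) hF hE h₂₂ h₂₃ hb hj).mono ?_)
  rintro s₁ t₁ ⟨a₁, u₁, r₁, p₁, x₁, c₁⟩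
  rw [hpar] at p₁
  rw [hext] at x₁
  have hE₁ : Env P s₁ := hE.congr (fun y hy => r₁ y (by omega)) (by rw [a₁]) (by rw [a₁])
  have e₃ : s₁.reg 3 = P.a := hE₁.reg 3 (by norm_num)
  refine wp_seq (wp_op (by simp only [BinOp.eval, p₁, e₃]; omega) (wp_seq ?_))
  refine WP.mono (wp_pathCmd (L := P.edges dec σ) (c := σ * P.a)
    (q := par P.m (2 ^ P.N₁) σ * P.a) (hE₁.setReg (by norm_num))
    (Built.setReg (hB.congr a₁ u₁ (r₁ 21 (by norm_num))) (by norm_num))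
    (by simp [r₁, h₂₀]) (by simp [BinOp.eval, p₁, e₃]) (by omega) (by omega)) ?_
  rintro s₂ t₂ ⟨hE₂, hB₂, h₂₀', r₂, c₂⟩
  have f (y : ℕ) (hy : y = 22 ∨ y = 23) : s₂.reg y = s.reg y := by
    rw [r₂ y (by omega), State.reg_setReg, if_neg (by omega), r₁ y (by omega)]
  have f₂₉ : s₂.reg 29 = ext P.m (2 ^ P.N₁) P.bu P.bv (fun _ => dec) σ := by
    rw [r₂ 29 (by omega), State.reg_setReg, if_neg (by omega), x₁]
  have hlist : P.edges dec (b * (P.m + 4) + (j + 1)) = (P.edges dec σ ++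
      (List.range P.a).map fun i => (σ * P.a + i + 1,
        if i = 0 then par P.m (2 ^ P.N₁) σ * P.a else σ * P.a + i)) ++
      if ext P.m (2 ^ P.N₁) P.bu P.bv (fun _ => dec) σ = 0 then [] else
        [((σ + 1) * P.a, ext P.m (2 ^ P.N₁) P.bu P.bv (fun _ => dec) σ * P.a)] := by
    rw [← add_assoc, ← hσ, Params.edges, edgeList_succ, List.append_assoc]
    rfl
  have hcur : (b * (P.m + 4) + (j + 1)) * P.a = σ * P.a + P.a := by
    rw [← add_assoc, ← hσ, add_mul, one_mul]
  rw [hlist, hcur]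
  refine wp_ite (fun h => ?_) fun h => ?_
  · rw [f₂₉] at h
    rw [if_neg h]
    have e₃' : s₂.reg 3 = P.a := hE₂.reg 3 (by norm_num)
    refine wp_seq (wp_op (by simp only [BinOp.eval, f₂₉, e₃']; omega) (wp_emitCmd
      (hB₂.setReg (by norm_num)) (by simp; exact hE₂.reg 2 (by norm_num))
      (by simp; omega) ?_))
    intro s₃ hB₃ r₃ a₃ b₃
    have g (y : ℕ) (hy : y ≠ 21) (hy' : y ≠ 42) : s₃.reg y = s₂.reg y := by
      rw [r₃ y hy, State.reg_setReg, if_neg hy']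
    refine ⟨hE₂.congr (fun y hy => g y (by omega) (by omega)) a₃ b₃, ?_, ?_, fun y hy => ?_,
      by omega⟩
    · simpa [BinOp.eval, f₂₉, e₃', h₂₀', add_mul] using hB₃
    · rw [g 20 (by norm_num) (by norm_num), h₂₀']
    · rw [g y (by omega) (by omega), f y hy]
  · rw [f₂₉] at h
    rw [if_pos h, List.append_nil]
    exact wp_skip ⟨hE₂, hB₂, h₂₀', f, by omega⟩

/-- The running time of `buildCmd`. -/
def Params.buildTime (P : Params) : ℕ :=
  (P.m + 2 * 2 ^ P.N₁ + P.pad) * ((P.m + 4) * (8 * P.K + 9 * P.a + 53) + 3 + 3) + 5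

theorem wp_buildCmd {dec : Bool} (hF : Fits P w) (hE : Env P s)
    (hz : ∀ k, k ≠ 0 → k ≠ 1 → ∀ i, s.arr k i = 0) (hu : s.used = 0) :
    WP w ω (buildCmd P.K dec) s fun s' t => Env P s' ∧
      Built s' (P.edges dec (segs P.m (2 ^ P.N₁) P.pad)) ∧
      s'.reg 20 = segs P.m (2 ^ P.N₁) P.pad * P.a ∧ t ≤ P.buildTime := by
  have hsegs := hF.segs_lt
  have hB := blocks_le (P := P)
  have hpos : 0 < 2 ^ P.N₁ := by positivity
  have hJ : P.m + 4 ≤ segs P.m (2 ^ P.N₁) P.pad := Nat.le_mul_of_pos_left _ (by omega)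
  refine wp_seq (wp_const (by omega) (wp_seq (wp_const (by omega) ?_)))
  have hB₀ : Built ((s.setReg 20 0).setReg 21 0) [] :=
    ⟨fun i => by simp [hz], fun i => by simp [hz], by simp,
      fun k h₀ h₁ _ _ i => by simp [hz, h₀, h₁], hu⟩
  refine WP.mono (wp_forLoop_const (N := P.m + 2 * 2 ^ P.N₁ + P.pad) (fun b s' => Env P s' ∧
    Built s' (P.edges dec (b * (P.m + 4))) ∧ s'.reg 20 = b * (P.m + 4) * P.a)
    ((P.m + 4) * (8 * P.K + 9 * P.a + 53) + 3) (by omega) (by norm_num) (by norm_num)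
    (fun k s' h => ⟨h.1.reg 11 (by norm_num), h.1.reg 2 (by norm_num)⟩)
    (fun k s' v h => ⟨h.1.setReg (by norm_num), h.2.1.setReg (by norm_num), by simpa using h.2.2⟩)
    (fun k s' v h => ⟨h.1.setReg (by norm_num), h.2.1.setReg (by norm_num), by simpa using h.2.2⟩)
    ?_ ?_) ?_
  · rintro b s₁ hb ⟨hE₁, hB₁, h₂₀⟩ h₂₂
    refine WP.mono (wp_forLoop_const (N := P.m + 4) (fun j s' => Env P s' ∧
      Built s' (P.edges dec (b * (P.m + 4) + j)) ∧ s'.reg 20 = (b * (P.m + 4) + j) * P.a ∧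
      s'.reg 22 = b)
      (8 * P.K + 9 * P.a + 50) (by omega) (by norm_num) (by norm_num)
      (fun k s' h => ⟨h.1.reg 5 (by norm_num), h.1.reg 2 (by norm_num)⟩)
      (fun k s' v h => ⟨h.1.setReg (by norm_num), h.2.1.setReg (by norm_num),
        by simpa using h.2.2.1, by simpa using h.2.2.2⟩)
      (fun k s' v h => ⟨h.1.setReg (by norm_num), h.2.1.setReg (by norm_num),
        by simpa using h.2.2.1, by simpa using h.2.2.2⟩) ?_ ⟨hE₁, hB₁, h₂₀, h₂₂⟩) ?_
    · rintro j s₂ hj ⟨hE₂, hB₂, h₂₀', h₂₂'⟩ h₂₃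
      refine (wp_segmentCmd hF hE₂ h₂₂' h₂₃ hb hj hB₂ h₂₀').mono ?_
      rintro s₃ t ⟨h₁, h₂, h₃, h₄, h₅⟩
      exact ⟨⟨h₁, h₂, h₃, (h₄ 22 (by norm_num)).trans h₂₂'⟩, (h₄ 23 (by norm_num)).trans h₂₃, h₅⟩
    · rintro s₂ t ⟨⟨h₁, h₂, h₃, h₄⟩, ht⟩
      have : (b + 1) * (P.m + 4) = b * (P.m + 4) + (P.m + 4) := by rw [add_mul, one_mul]
      rw [this]
      exact ⟨⟨h₁, h₂, h₃⟩, h₄, ht⟩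
  · refine ⟨(hE.setReg (by norm_num)).setReg (by norm_num), ?_, by simp⟩
    simpa [Params.edges, SegGraph.edgeList] using hB₀
  · rintro s' t ⟨⟨h₁, h₂, h₃⟩, ht⟩
    exact ⟨h₁, h₂, h₃, by unfold Params.buildTime; omega⟩

end Reduction

/-! ### Snapshots, resets and the stages of the reduction -/

namespace Reduction

open WordRAM

/-- Array `3` represents the simulated registers and receives the numbers of vertices and edges. The
stage number starts at 1 while all stamps are 0, so the base arrays are the valid ones during
preprocessing. Register `53` is the answer flag. -/
def installCmd : Cmd :=
  .op 41 .add 20 2 ;; .store 3 17 41 ;; .store 3 2 21 ;; .const 50 1 ;; .const 51 0 ;;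
    .const 64 0 ;; .const 65 0 ;; .const 53 0

variable {P : Params} {w : ℕ} {ω : ℕ → Bool} {s s₀ r : State}

/-- The edge list of the initial graph. -/
def Params.finEdges (P : Params) (dec : Bool) : List (Fin (segs P.m (2 ^ P.N₁) P.pad * P.a + 1) ×
      Fin (segs P.m (2 ^ P.N₁) P.pad * P.a + 1)) :=
  SegGraph.finEdgeList (segs P.m (2 ^ P.N₁) P.pad) P.a (par P.m (2 ^ P.N₁))
    (ext P.m (2 ^ P.N₁) P.bu P.bv fun _ => dec)

theorem finEdges_eq (P : Params) (dec : Bool) : P.finEdges dec =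
    (P.edges dec (segs P.m (2 ^ P.N₁) P.pad)).map fun p =>
      (SegGraph.vtx (segs P.m (2 ^ P.N₁) P.pad) P.a p.1,
        SegGraph.vtx (segs P.m (2 ^ P.N₁) P.pad) P.a p.2) := rfl

theorem initState_arr (hF : Fits P w) (dec : Bool) (i : ℕ) :
    (DynGraph.initState (P.finEdges dec)).arr 0 i =
      ((P.edges dec (segs P.m (2 ^ P.N₁) P.pad))[i]?.getD (0, 0)).1 ∧
    (DynGraph.initState (P.finEdges dec)).arr 1 i =
      ((P.edges dec (segs P.m (2 ^ P.N₁) P.pad))[i]?.getD (0, 0)).2 := by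
  have hlen : (P.finEdges dec).length = (P.edges dec (segs P.m (2 ^ P.N₁) P.pad)).length := by
    rw [finEdges_eq, List.length_map]
  by_cases hi : i < (P.finEdges dec).length
  · have hi' : i < (P.edges dec (segs P.m (2 ^ P.N₁) P.pad)).length := hlen ▸ hi
    have hmem := (SegGraph.mem_edgeList.mp (List.getElem_mem hi')).lt (wf hF.two_le)
    rw [List.getElem?_eq_getElem hi']
    simp only [DynGraph.initState, hi, dif_pos, if_true, Option.getD_some, one_ne_zero, if_false]
    simp only [finEdges_eq, List.getElem_map]
    exact ⟨SegGraph.val_vtx (by omega), SegGraph.val_vtx (by omega)⟩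
  · rw [List.getElem?_eq_none (by omega)]
    simp [DynGraph.initState, hi]

theorem wp_installCmd {dec : Bool} (hF : Fits P w) (hE : Env P s)
    (hB : Built s (P.edges dec (segs P.m (2 ^ P.N₁) P.pad)))
    (h₂₀ : s.reg 20 = segs P.m (2 ^ P.N₁) P.pad * P.a) :
    WP w ω installCmd s fun s' t => Env P s' ∧
      Rep ω s' (DynGraph.initState (P.finEdges dec)) ∧ s'.reg 50 = 1 ∧ s'.reg 51 = 0 ∧
      s'.reg 53 = 0 ∧ s'.used = 0 ∧ t = 8 := by
  have hsize := hF.size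
  have e₂ : s.reg 2 = 1 := hE.reg 2 (by norm_num)
  have e₁₇ : s.reg 17 = 0 := hE.reg 17 (by norm_num)
  have hn : P.n = segs P.m (2 ^ P.N₁) P.pad * P.a + 1 := rfl
  have hlen : (P.finEdges dec).length = (P.edges dec (segs P.m (2 ^ P.N₁) P.pad)).length := by
    rw [finEdges_eq, List.length_map]
  simp only [installCmd, wp_seq_iff, wp_op_iff, wp_store_iff, wp_const_iff, State.reg_setReg,
    State.reg_setArr, State.used_setReg, State.used_setArr, BinOp.eval, Nat.reduceEqDiff, if_true,
    if_false, e₂, e₁₇, h₂₀, hB.len, hB.used, true_and, and_true]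
  refine ⟨by omega, by omega, by omega, by omega, by omega, by omega, ?_, ?_⟩
  · refine hE.congr (fun y hy => ?_) ?_ ?_
    · simp only [State.reg_setReg, State.reg_setArr]
      repeat rw [if_neg (by omega)]
    all_goals
      simp only [State.arr_setReg]
      rw [State.arr_setArr_of_ne _ _ _ (by norm_num), State.arr_setArr_of_ne _ _ _ (by norm_num),
        State.arr_setReg]
  · have harr (k i : ℕ) (hk₀ : k ≠ 0) (hk₁ : k ≠ 1) (h₃ : k ≠ 3) (h₆ : k ≠ 6) (h₉ : k ≠ 9) :
        s.arr k i = 0 := hB.rest k hk₀ hk₁ h₆ h₉ i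
    have hstamp (k i : ℕ) : s.arr (3 * k + 5) i = 0 :=
      harr _ _ (by omega) (by omega) (by omega) (by omega) (by omega)
    constructor
    · intro k i
      simp only [State.arr_setReg, State.arr_setArr, State.reg_setReg, Nat.reduceEqDiff, if_true,
        if_false, false_and, hstamp, zero_ne_one]
      rcases k with _ | _ | _ | k
      · simp only [State.mem, DynGraph.initState, hlen]
        rw [hB.rest _ (by norm_num) (by norm_num) (by norm_num) (by norm_num)]
        rcases i with _ | _ | i <;> simp
      · simp only [State.mem, (initState_arr hF dec i).1]
        rw [if_neg (by omega), if_neg (by omega)]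
        exact (hB.src i).symm
      · simp only [State.mem, (initState_arr hF dec i).2]
        rw [if_neg (by omega), if_neg (by omega)]
        exact (hB.tgt i).symm
      · rw [if_neg (by omega), if_neg (by omega), harr _ _ (by omega) (by omega) (by omega)
          (by omega) (by omega)]
        simp [State.mem, DynGraph.initState]
    · intro k i
      simp only [State.arr_setReg, State.arr_setArr, State.reg_setReg, Nat.reduceEqDiff, if_true,
        if_false, false_and, hstamp]
      exact Nat.zero_le _
    · refine fun _ => ⟨by simp, fun k i => ?_⟩
      simp only [State.arr_setReg, State.arr_setArr, Nat.reduceEqDiff, if_false, false_and, hstamp]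
    · simp [DynGraph.initState]
    · simp [hB.used]
    · simp [DynGraph.initState]
    · intro i hi
      simp [hB.used] at hi

/-- The state `r₀` after the preprocessing has been saved. -/
structure Snap (r₀ s : State) : Prop where
  base : ∀ k i, s.arr (3 * k + 3) i = r₀.mem k i
  mode : s.reg 51 = 1
  pos : s.reg 52 = r₀.used
  used : r₀.used ≤ s.used

theorem Snap.frame {r₀ s' : State} (h : Snap r₀ s) (f : SimFrame s s') : Snap r₀ s' :=
  ⟨fun k i => by rw [f.base (by rw [h.mode]; norm_num)]; exact h.base k i,
    (f.reg 51 (by norm_num)).trans h.mode, (f.reg 52 (by norm_num)).trans h.pos,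
    h.used.trans f.used⟩

theorem Env.frame {s' : State} (h : Env P s) (f : SimFrame s s') : Env P s' :=
  h.congr (fun y hy => f.reg y (by omega)) (f.arr 0 (by norm_num)) (f.arr 1 (by norm_num))

/-- Saving copies nothing: from now on the base arrays are read-only, and only the coin position is
stored. -/
def saveCmd : Cmd := .const 51 1 ;; .const 50 2 ;; .op 52 .add 65 17

/-- A new stage number invalidates all cells written since the snapshot at once. The coin position
is rewound as well, so the next stage sees the same flips. -/
def resetCmd : Cmd := .op 50 .add 50 2 ;; .op 65 .add 52 17

theorem wp_saveCmd (hE : Env P s) (hR : Rep ω s r) (h₅₀ : s.reg 50 = 1) (h₅₁ : s.reg 51 = 0)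
    (hr : r.used < 2 ^ w) (hw : 2 < 2 ^ w) :
    WP w ω saveCmd s fun s' t => Env P s' ∧ Rep ω s' r ∧ Snap r s' ∧ s'.reg 50 = 2 ∧
      s'.reg 53 = s.reg 53 ∧ s'.used = s.used ∧ t = 3 := by
  have e₁₇ : s.reg 17 = 0 := hE.reg 17 (by norm_num)
  have hst := (hR.mode h₅₁).2
  have hbase (k i : ℕ) : s.arr (3 * k + 3) i = r.mem k i := by
    rw [hR.mem, if_neg]
    rw [hst, h₅₀]
    norm_num
  simp only [saveCmd, wp_seq_iff, wp_op_iff, wp_const_iff, State.reg_setReg,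
    State.used_setReg, BinOp.eval, Nat.reduceEqDiff, if_true,
    if_false, e₁₇, hR.pos, true_and]
  refine ⟨by omega, by omega, by omega, ?_, ?_, ?_, trivial⟩
  · exact ((hE.setReg (by norm_num)).setReg (by norm_num)).setReg (by norm_num)
  · refine ⟨fun k i => ?_, fun k i => ?_, fun h => ?_, ?_, ?_, hR.le, hR.coins⟩
    · simp [hst, hbase]
    · simp [hst]
    · simp at h
    · simpa using hR.pos
    · simpa using hR.cnt
  · exact ⟨hbase, by simp, by simp, hR.le⟩

theorem wp_resetCmd {r₀ : State} (hE : Env P s) (hR : Rep ω s r) (hS : Snap r₀ s)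
    (h₅₀ : s.reg 50 + 1 < 2 ^ w) (hr : r₀.used < 2 ^ w) :
    WP w ω resetCmd s fun s' t => Env P s' ∧ Rep ω s' r₀ ∧ Snap r₀ s' ∧
      s'.reg 50 = s.reg 50 + 1 ∧ s'.reg 22 = s.reg 22 ∧ s'.reg 53 = s.reg 53 ∧
      s'.used = s.used ∧ t = 2 := by
  have e₁₇ : s.reg 17 = 0 := hE.reg 17 (by norm_num)
  have e₂ : s.reg 2 = 1 := hE.reg 2 (by norm_num)
  simp only [resetCmd, wp_seq_iff, wp_op_iff, State.reg_setReg,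
    State.used_setReg, BinOp.eval, Nat.reduceEqDiff, if_true,
    if_false, e₁₇, e₂, hS.pos, true_and]
  refine ⟨by omega, by omega, ?_, ?_, ?_, trivial⟩
  · exact (hE.setReg (by norm_num)).setReg (by norm_num)
  -- No stamp exceeds the old stage number, so none equals the new one, and every read falls through
  -- to the snapshot.
  · refine ⟨fun k i => ?_, fun k i => ?_, fun h => ?_, by simp, ?_, hS.used, hR.coins⟩
    · have := hR.stamp k i
      simp only [State.arr_setReg, State.reg_setReg, Nat.reduceEqDiff, if_true, if_false]
      rw [if_neg (by omega), hS.base]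
    · have := hR.stamp k i
      simp only [State.arr_setReg, State.reg_setReg, Nat.reduceEqDiff, if_true, if_false]
      omega
    · simp [hS.mode] at h
    · simpa using hR.cnt
  · exact ⟨hS.base, by simpa using hS.mode, by simpa using hS.pos, hS.used⟩

/-- The main loop is running, and the simulated state is `r`. -/
structure Live (P : Params) (ω : ℕ → Bool) (r₀ : State) (B : ℕ) (s r : State) : Prop where
  env : Env P s
  rep : Rep ω s r
  snap : Snap r₀ s
  used : s.used ≤ B

variable {r₀ : State} {B : ℕ}

theorem Live.congr {s' : State} (h : Live P ω r₀ B s r) (ha : s'.arr = s.arr)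
    (hu : s'.used = s.used) (hr : ∀ y, y < 19 ∨ 50 ≤ y ∧ y < 53 ∨ y = 64 ∨ y = 65 →
      s'.reg y = s.reg y) : Live P ω r₀ B s' r := by
  obtain ⟨h₁, ⟨a₁, a₂, a₃, a₄, a₅, a₆, a₇⟩, ⟨b₁, b₂, b₃, b₄⟩, h₄⟩ := h
  refine ⟨h₁.congr (fun y hy => hr y (by omega)) (by rw [ha]) (by rw [ha]),
    ⟨?_, ?_, ?_, ?_, ?_, ?_, ?_⟩, ⟨?_, ?_, ?_, ?_⟩, hu ▸ h₄⟩
  · rwa [ha, hr 50 (by norm_num)]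
  · rwa [ha, hr 50 (by norm_num)]
  · rwa [ha, hr 50 (by norm_num), hr 51 (by norm_num)]
  · rwa [hr 65 (by norm_num)]
  · rwa [hu, hr 64 (by norm_num)]
  · rwa [hu]
  · rwa [hu, ha]
  · rwa [ha]
  · rwa [hr 51 (by norm_num)]
  · rwa [hr 52 (by norm_num)]
  · rwa [hu]

theorem Live.setReg (h : Live P ω r₀ B s r) {x : ℕ} (v : ℕ) (hx : 19 ≤ x) (hx' : x < 50) :
    Live P ω r₀ B (s.setReg x v) r :=
  h.congr rfl rfl fun y hy => by rw [State.reg_setReg, if_neg (by omega)]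

theorem Live.simulate {s' r' : State} (h : Live P ω r₀ B s r) (hR : Rep ω s' r')
    (f : SimFrame s s') (hu : s'.used ≤ B) : Live P ω r₀ B s' r' :=
  ⟨h.env.frame f, hR, h.snap.frame f, hu⟩

theorem wp_simulate_live {w₀ : ℕ} {p : Cmd} {r' : State} {T : ℕ} (hw₀ : w₀ ≤ w)
    (hL : Live P ω r₀ B s r) (he : Exec w₀ ω p r r' T) (h₅₀ : s.reg 50 < 2 ^ w)
    (hp : p.regBound < 2 ^ w) (hB : B < 2 ^ w) (hr' : r'.used ≤ B) :
    WP w ω (simulate p) s fun s' t => Live P ω r₀ B s' r' ∧ (∀ y < 60, s'.reg y = s.reg y) ∧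
      t ≤ 20 * T := by
  refine (wp_simulate hw₀ he hL.rep (hL.env.reg 2 (by norm_num)) h₅₀ hp (hL.used.trans_lt hB)
    (hr'.trans_lt hB)).mono ?_
  rintro s' t ⟨h₁, h₂, h₃, h₄⟩
  have := hL.used
  exact ⟨hL.simulate h₁ h₂ (by omega), h₂.reg, h₄⟩

def opCmd (code : Cmd) : Cmd :=
  .op 43 .mul 23 5 ;; .op 43 .add 43 2 ;; .op 43 .add 43 2 ;; .op 44 .add 43 2 ;;
    .op 44 .add 44 2 ;; .op 43 .mul 43 3 ;; .op 44 .mul 44 3 ;; writeCell 0 17 44 ;;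
    writeCell 0 2 43 ;; simulate code

/-- The arguments of the update at coordinate `c`. -/
def passArgs (P : Params) (c : ℕ) (r : State) : State :=
  (r.setReg 0 ((c * (P.m + 4) + 4) * P.a)).setReg 1 ((c * (P.m + 4) + 2) * P.a)

theorem wp_opCmd {w₀ : ℕ} {code : Cmd} {r' : State} {T c : ℕ} (hF : Fits P w) (hw₀ : w₀ ≤ w)
    (hL : Live P ω r₀ B s r) (h₂₃ : s.reg 23 = c) (hc : c < P.m)
    (he : Exec w₀ ω code (passArgs P c r) r' T) (h₅₀ : s.reg 50 < 2 ^ w)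
    (hp : code.regBound < 2 ^ w) (hB : B < 2 ^ w) (hr' : r'.used ≤ B) :
    WP w ω (opCmd code) s fun s' t => Live P ω r₀ B s' r' ∧
      (∀ y, y < 43 ∨ 44 < y ∧ y < 60 → s'.reg y = s.reg y) ∧ t ≤ 20 * T + 13 := by
  have hsegs := hF.segs_lt
  have hsize := hF.size
  have hbl := Fits.block_le (P := P) (b := c) (j := P.m + 3) (by omega) (by omega)
  have hn : P.n = segs P.m (2 ^ P.N₁) P.pad * P.a + 1 := rfl
  have hk (k : ℕ) (hk : k ≤ 4) : (c * (P.m + 4) + k) * P.a < 2 ^ w := by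
    have := Nat.mul_le_mul_right P.a
      (show c * (P.m + 4) + k ≤ segs P.m (2 ^ P.N₁) P.pad by omega)
    omega
  have hk₂ := hk 2 (by norm_num)
  have hk₄ := hk 4 (by norm_num)
  have e₂ : s.reg 2 = 1 := hL.env.reg 2 (by norm_num)
  have e₃ : s.reg 3 = P.a := hL.env.reg 3 (by norm_num)
  have e₅ : s.reg 5 = P.m + 4 := hL.env.reg 5 (by norm_num)
  have e₁₇ : s.reg 17 = 0 := hL.env.reg 17 (by norm_num)
  simp only [opCmd, wp_seq_iff (p := .op ..), wp_op_iff, State.reg_setReg, BinOp.eval,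
    Nat.reduceEqDiff, if_true, if_false, e₂, e₃, e₅, h₂₃]
  refine ⟨by omega, by omega, by omega, by omega, by omega, hk₂, hk₄, wp_seq ?_⟩
  have hL₁ : Live P ω r₀ B (((((((s.setReg 43 (c * (P.m + 4))).setReg 43
      (c * (P.m + 4) + 1)).setReg 43 (c * (P.m + 4) + 1 + 1)).setReg 44
      (c * (P.m + 4) + 1 + 1 + 1)).setReg 44 (c * (P.m + 4) + 1 + 1 + 1 + 1)).setReg 43
      ((c * (P.m + 4) + 1 + 1) * P.a)).setReg 44 ((c * (P.m + 4) + 1 + 1 + 1 + 1) * P.a)) r :=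
    hL.congr rfl rfl fun y hy => by
      simp only [State.reg_setReg]
      repeat rw [if_neg (by omega)]
  refine wp_writeCell hL₁.rep fun s₁ t₁ R₁ F₁ u₁ g₁ c₁ => ?_
  simp only [State.reg_setReg, Nat.reduceEqDiff, if_true, if_false, e₁₇] at R₁ g₁
  have hL₂ : Live P ω r₀ B s₁ _ := hL₁.simulate R₁ F₁ (by rw [u₁]; exact hL₁.used)
  refine wp_seq (wp_writeCell hL₂.rep fun s₂ t₂ R₂ F₂ u₂ g₂ c₂ => ?_)
  have e₂' : s₁.reg 2 = 1 := hL₂.env.reg 2 (by norm_num)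
  have e₄₃ : s₁.reg 43 = (c * (P.m + 4) + 2) * P.a := by rw [g₁]; simp
  rw [e₂', e₄₃] at R₂
  have hL₃ : Live P ω r₀ B s₂ (passArgs P c r) :=
    hL₂.simulate R₂ F₂ (by rw [u₂]; exact hL₂.used)
  have f (y : ℕ) (hy : y < 43 ∨ 44 < y ∧ y < 60) : s₂.reg y = s.reg y := by
    rw [g₂, g₁]
    simp only [State.reg_setReg]
    repeat rw [if_neg (by omega)]
  refine (wp_simulate_live hw₀ hL₃ he (by rw [f 50 (by norm_num)]; exact h₅₀) hp hB hr').mono ?_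
  rintro s' t ⟨h₁, h₂, h₃⟩
  exact ⟨h₁, fun y hy => (h₂ y (by omega)).trans (f y hy), by omega⟩

/-- For the current stage, update all coordinates whose bit is equal to `pol`. -/
def opsCmd (K : ℕ) (code : Cmd) (pol : Bool) : Cmd :=
  forLoop 23 26 1 (.op 37 .add 22 17 ;; .op 38 .add 15 17 ;; .op 39 .add 14 17 ;;
    .op 40 .add 23 17 ;; bitCmd K ;;
    if pol then .ite 33 (opCmd code) .skip else .ite 33 .skip (opCmd code))

/-- Here `f c` is the state of the simulated algorithm before coordinate `c`; it stands still at
coordinates that need no update. The states are given in advance by a run of the algorithm, and the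
program is shown to follow them. -/
theorem wp_opsCmd {w₀ x σ : ℕ} {code : Cmd} {pol : Bool} {f : ℕ → State} {τ : ℕ → ℕ}
    (hF : Fits P w) (hw₀ : w₀ ≤ w) (hL : Live P ω r₀ B s (f 0)) (h₂₂ : s.reg 22 = x)
    (hx : x < 2 ^ P.N₂) (h₅₀ : s.reg 50 = σ) (hσ : σ < 2 ^ w)
    (hf : ∀ c < P.m, if P.bw x c = pol then
      Exec w₀ ω code (passArgs P c (f c)) (f (c + 1)) (τ c) else f (c + 1) = f c)
    (hp : code.regBound < 2 ^ w) (hB : B < 2 ^ w) (hfB : ∀ c ≤ P.m, (f c).used ≤ B) :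
    WP w ω (opsCmd P.K code pol) s fun s' t => Live P ω r₀ B s' (f P.m) ∧
      (∀ y, y = 22 ∨ y = 50 ∨ y = 53 → s'.reg y = s.reg y) ∧
      t ≤ 20 * (∑ c ∈ Finset.range P.m, τ c) + P.m * (8 * P.K + 30) + 3 := by
  have hsegs := hF.segs_lt
  have hB' := blocks_le (P := P)
  have hv := hF.vars
  have hst := hF.stages
  have hJ : P.m ≤ segs P.m (2 ^ P.N₁) P.pad := by omega
  have hN₁ : 2 * P.N₁ < 2 ^ w := lt_of_le_of_lt (b := w) (by omega) Nat.lt_two_pow_self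
  have body {c : ℕ} {s : State} (hc : c < P.m) (hL : Live P ω r₀ B s (f c)) (h₂₂ : s.reg 22 = x)
      (h₂₃ : s.reg 23 = c) (h₅₀ : s.reg 50 = σ) : WP w ω (.op 37 .add 22 17 ;;
        .op 38 .add 15 17 ;; .op 39 .add 14 17 ;; .op 40 .add 23 17 ;; bitCmd P.K ;;
        if pol then .ite 33 (opCmd code) .skip else .ite 33 .skip (opCmd code)) s fun s' t =>
      Live P ω r₀ B s' (f (c + 1)) ∧ (∀ y, y < 30 ∨ 44 < y ∧ y < 60 → s'.reg y = s.reg y) ∧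
        t ≤ 20 * τ c + (8 * P.K + 27) := by
    have e₁₇ : s.reg 17 = 0 := hL.env.reg 17 (by norm_num)
    have e₁₅ : s.reg 15 = 2 * P.N₁ := hL.env.reg 15 (by norm_num)
    have e₁₄ : s.reg 14 = 2 ^ P.N₂ - 1 := hL.env.reg 14 (by norm_num)
    simp only [wp_seq_iff (p := .op ..), wp_op_iff, State.reg_setReg, BinOp.eval,
      Nat.reduceEqDiff, if_false, e₁₇, e₁₅, e₁₄, h₂₂, h₂₃, add_zero]
    refine ⟨by omega, by omega, by omega, by omega, wp_seq ?_⟩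
    have hL₁ : Live P ω r₀ B ((((s.setReg 37 x).setReg 38 (2 * P.N₁)).setReg 39
        (2 ^ P.N₂ - 1)).setReg 40 c) (f c) := hL.congr rfl rfl fun y hy => by
      simp only [State.reg_setReg]
      repeat rw [if_neg (by omega)]
    refine WP.mono (wp_bitCmd (x := x) (sh := 2 * P.N₁) (mk := 2 ^ P.N₂ - 1) (c := c) (k := P.N₂)
      hL₁.env (by simp) (by simp) (by simp) (by simp) (by omega) (by omega) (by omega) hc
      hF.clauses) ?_
    rintro s₁ t₁ ⟨⟨a₁, u₁, r₁⟩, b₁, c₁⟩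
    have hr (y : ℕ) (hy : y < 30 ∨ 40 < y) : s₁.reg y = s.reg y := by
      rw [r₁ y (by omega)]
      simp only [State.reg_setReg]
      repeat rw [if_neg (by omega)]
    have hL₂ : Live P ω r₀ B s₁ (f c) :=
      hL₁.congr a₁ u₁ fun y hy => r₁ y (by omega)
    have hfc := hf c hc
    rw [show P.bit (2 * P.N₁) (2 ^ P.N₂ - 1) x c = P.bw x c from rfl] at b₁
    have hop (he : P.bw x c = pol) : WP w ω (opCmd code) s₁ fun s' t =>
        Live P ω r₀ B s' (f (c + 1)) ∧ (∀ y, y < 30 ∨ 44 < y ∧ y < 60 → s'.reg y = s.reg y) ∧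
          t ≤ 20 * τ c + 13 := by
      rw [if_pos he] at hfc
      refine (wp_opCmd hF hw₀ hL₂ ((hr 23 (by norm_num)).trans h₂₃) hc hfc
        (by rw [hr 50 (by norm_num), h₅₀]; exact hσ) hp hB (hfB _ hc)).mono ?_
      rintro s' t ⟨h₁, h₂, h₃⟩
      exact ⟨h₁, fun y hy => (h₂ y (by omega)).trans (hr y (by omega)), h₃⟩
    have hskip (he : P.bw x c ≠ pol) : WP w ω .skip s₁ fun s' t =>
        Live P ω r₀ B s' (f (c + 1)) ∧ (∀ y, y < 30 ∨ 44 < y ∧ y < 60 → s'.reg y = s.reg y) ∧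
          t ≤ 20 * τ c + 13 := by
      rw [if_neg he] at hfc
      exact wp_skip ⟨hfc ▸ hL₂, fun y hy => hr y (by omega), by omega⟩
    have hfin {s' : State} {t : ℕ} (h : Live P ω r₀ B s' (f (c + 1)) ∧
        (∀ y, y < 30 ∨ 44 < y ∧ y < 60 → s'.reg y = s.reg y) ∧ t ≤ 20 * τ c + 13) :
        Live P ω r₀ B s' (f (c + 1)) ∧ (∀ y, y < 30 ∨ 44 < y ∧ y < 60 → s'.reg y = s.reg y) ∧
          1 + (1 + (1 + (1 + (t₁ + (t + 1))))) ≤ 20 * τ c + (8 * P.K + 27) :=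
      ⟨h.1, h.2.1, by have := h.2.2; omega⟩
    cases pol
    · refine wp_ite (fun h => (hskip ?_).mono fun s' t => hfin)
        fun h => (hop ?_).mono fun s' t => hfin
      · rintro h'
        simp [b₁, h'] at h
      · cases h' : P.bw x c
        · rfl
        · simp [b₁, h'] at h
    · refine wp_ite (fun h => (hop ?_).mono fun s' t => hfin)
        fun h => (hskip ?_).mono fun s' t => hfin
      · cases h' : P.bw x c
        · simp [b₁, h'] at h
        · rfl
      · rintro h'
        simp [b₁, h'] at h
  refine WP.mono (wp_forLoop (N := P.m) (fun c s' => Live P ω r₀ B s' (f c) ∧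
    ∀ y, y = 22 ∨ y = 50 ∨ y = 53 → s'.reg y = s.reg y)
    (fun c => 20 * τ c + (8 * P.K + 27)) (by omega) (by norm_num) (by norm_num)
    (fun k s' h => ⟨h.1.env.reg 1 (by norm_num), h.1.env.reg 2 (by norm_num)⟩)
    (fun k s' v h => ⟨h.1.setReg v (by norm_num) (by norm_num), fun y hy => by
      rw [State.reg_setReg, if_neg (by omega), h.2 y hy]⟩)
    (fun k s' v h => ⟨h.1.setReg v (by norm_num) (by norm_num), fun y hy => by
      rw [State.reg_setReg, if_neg (by omega), h.2 y hy]⟩) ?_ ⟨hL, fun _ _ => rfl⟩) ?_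
  · rintro c s₁ hc ⟨h₁, h₂⟩ h₂₃
    refine (body hc h₁ ((h₂ 22 (by norm_num)).trans h₂₂) h₂₃
      ((h₂ 50 (by norm_num)).trans h₅₀)).mono ?_
    rintro s₂ t ⟨g₁, g₂, g₃⟩
    exact ⟨⟨g₁, fun y hy => (g₂ y (by omega)).trans (h₂ y hy)⟩, (g₂ 23 (by norm_num)).trans h₂₃,
      g₃⟩
  · rintro s' t ⟨⟨h₁, h₂⟩, h₃⟩
    refine ⟨h₁, h₂, h₃.trans (le_of_eq ?_)⟩
    rw [Finset.sum_add_distrib, Finset.sum_add_distrib, ← Finset.mul_sum]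
    simp
    ring

/-- Look for a large eccentricity. -/
def scanCmd : Cmd :=
  forLoop 24 27 7 (.op 43 .add 1 24 ;; .op 43 .mul 43 5 ;; .op 43 .add 43 2 ;; .op 43 .mul 43 3 ;;
    readCell 44 3 43 ;; .op 44 .sub 18 44 ;; .ite 44 .skip (.const 53 1))

/-- The truncated difference `3 * a + 4 - e` vanishes exactly for estimates `e` of at least `3 * a +
4`. The flag is set but never cleared, so it accumulates over the stages. -/
theorem wp_scanCmd {σ b : ℕ} (hF : Fits P w) (hL : Live P ω r₀ B s r) (h₅₀ : s.reg 50 = σ)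
    (hσ : σ < 2 ^ w) (h₅₃ : s.reg 53 = b) (hthr : 3 * P.a + 4 < 2 ^ w) :
    WP w ω scanCmd s fun s' t => Live P ω r₀ B s' r ∧
      (∀ y, y = 22 ∨ y = 50 → s'.reg y = s.reg y) ∧
      ((∃ u < 2 ^ P.N₁, 3 * P.a + 4 ≤ r.arr 2 (((P.m + u) * (P.m + 4) + 1) * P.a)) →
        s'.reg 53 = 1) ∧
      ((¬ ∃ u < 2 ^ P.N₁, 3 * P.a + 4 ≤ r.arr 2 (((P.m + u) * (P.m + 4) + 1) * P.a)) →
        s'.reg 53 = b) ∧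
      t ≤ 2 ^ P.N₁ * 14 + 3 := by
  have hsegs := hF.segs_lt
  have hsize := hF.size
  have hB' := blocks_le (P := P)
  have hn : P.n = segs P.m (2 ^ P.N₁) P.pad * P.a + 1 := rfl
  set D : ℕ → Prop := fun u => 3 * P.a + 4 ≤ r.arr 2 (((P.m + u) * (P.m + 4) + 1) * P.a) with hD
  refine WP.mono (wp_forLoop_const (N := 2 ^ P.N₁) (fun k s' => Live P ω r₀ B s' r ∧
    (∀ y, y = 22 ∨ y = 50 → s'.reg y = s.reg y) ∧ ((∃ u < k, D u) → s'.reg 53 = 1) ∧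
    ((¬ ∃ u < k, D u) → s'.reg 53 = b)) 11 (by omega) (by norm_num) (by norm_num)
    (fun k s' h => ⟨h.1.env.reg 7 (by norm_num), h.1.env.reg 2 (by norm_num)⟩)
    ?_ ?_ ?_ ⟨hL, fun _ _ => rfl, by simp, fun _ => h₅₃⟩) ?_
  · rintro k s' v ⟨h₁, h₂, h₃, h₄⟩
    refine ⟨h₁.setReg v (by norm_num) (by norm_num), fun y hy => ?_, by simpa using h₃,
      by simpa using h₄⟩
    rw [State.reg_setReg, if_neg (by omega), h₂ y hy]
  · rintro k s' v ⟨h₁, h₂, h₃, h₄⟩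
    refine ⟨h₁.setReg v (by norm_num) (by norm_num), fun y hy => ?_, by simpa using h₃,
      by simpa using h₄⟩
    rw [State.reg_setReg, if_neg (by omega), h₂ y hy]
  · rintro k s₁ hk ⟨h₁, h₂, h₃, h₄⟩ h₂₄
    have e₁ : s₁.reg 1 = P.m := h₁.env.reg 1 (by norm_num)
    have e₂ : s₁.reg 2 = 1 := h₁.env.reg 2 (by norm_num)
    have e₃ : s₁.reg 3 = P.a := h₁.env.reg 3 (by norm_num)
    have e₅ : s₁.reg 5 = P.m + 4 := h₁.env.reg 5 (by norm_num)
    have e₁₈ : s₁.reg 18 = 3 * P.a + 4 := h₁.env.reg 18 (by norm_num)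
    have hbl := Fits.block_le (P := P) (b := P.m + k) (j := 1) (by omega) (by omega)
    have hmul := Nat.mul_le_mul_right P.a hbl
    have hmul' : ((P.m + k) * (P.m + 4) + 1) * P.a ≤
      ((P.m + k) * (P.m + 4) + 1).succ * P.a := Nat.mul_le_mul_right _ (Nat.le_succ _)
    simp only [wp_seq_iff (p := .op ..), wp_op_iff, State.reg_setReg, BinOp.eval,
      Nat.reduceEqDiff, if_true, if_false, e₁, e₂, e₃, e₅, h₂₄]
    refine ⟨by omega, by omega, by omega, by omega, wp_seq (wp_readCell (r := r) ?_ ?_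
      (by norm_num) fun v => ?_)⟩
    · have hL' : Live P ω r₀ B ((((s₁.setReg 43 (P.m + k)).setReg 43
          ((P.m + k) * (P.m + 4))).setReg 43 ((P.m + k) * (P.m + 4) + 1)).setReg 43
          (((P.m + k) * (P.m + 4) + 1) * P.a)) r := h₁.congr rfl rfl fun y hy => by
        simp only [State.reg_setReg]
        repeat rw [if_neg (by omega)]
      exact hL'.rep
    · simpa [h₂, h₅₀] using hσ
    · simp only [wp_seq_iff, wp_op_iff, wp_ite_iff, wp_skip_iff, wp_const_iff, State.reg_setReg,
        BinOp.eval, Nat.reduceEqDiff, if_true, if_false, e₁₈]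
      have hmem : r.mem 3 (((P.m + k) * (P.m + 4) + 1) * P.a) =
        r.arr 2 (((P.m + k) * (P.m + 4) + 1) * P.a) := rfl
      rw [hmem]
      have hsucc : (∃ u < k + 1, D u) ↔ (∃ u < k, D u) ∨ D k := by
        constructor
        · rintro ⟨u, hu, h⟩
          rcases Nat.lt_succ_iff_lt_or_eq.mp hu with hu | rfl
          · exact Or.inl ⟨u, hu, h⟩
          · exact Or.inr h
        · rintro (⟨u, hu, h⟩ | h)
          · exact ⟨u, by omega, h⟩
          · exact ⟨k, by omega, h⟩
      have frame : ∀ y, y ≠ 44 → y ≠ 63 → y ≠ 43 → ((if y = 44 then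
          3 * P.a + 4 - r.arr 2 (((P.m + k) * (P.m + 4) + 1) * P.a) else if y = 44 then
          r.arr 2 (((P.m + k) * (P.m + 4) + 1) * P.a) else if y = 63 then v else
          if y = 43 then ((P.m + k) * (P.m + 4) + 1) * P.a else if y = 43 then
          (P.m + k) * (P.m + 4) + 1 else if y = 43 then (P.m + k) * (P.m + 4) else
          if y = 43 then P.m + k else s₁.reg y) = s₁.reg y) := by
        intro y q₁ q₂ q₃
        simp [q₁, q₂, q₃]
      refine ⟨by omega, fun h => ?_, fun h => ⟨by omega, ?_⟩⟩
      · have hnD : ¬ D k := by simp only [hD]; omega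
        rw [hsucc]
        simp only [hnD, or_false]
        refine ⟨⟨h₁.congr rfl rfl fun y hy => ?_, fun y hy => ?_, h₃, h₄⟩, h₂₄, by omega⟩
        · simp only [State.reg_setReg]
          exact frame y (by omega) (by omega) (by omega)
        · rw [frame y (by omega) (by omega) (by omega), h₂ y hy]
      · have hDk : D k := by simp only [hD]; omega
        rw [hsucc]
        simp only [hDk, or_true, not_true, false_imp_iff, and_true, true_imp_iff]
        refine ⟨⟨h₁.congr rfl rfl fun y hy => ?_, fun y hy => ?_⟩, h₂₄, by omega⟩
        · simp only [State.reg_setReg]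
          rw [if_neg (by omega)]
          exact frame y (by omega) (by omega) (by omega)
        · rw [if_neg (by omega), frame y (by omega) (by omega) (by omega), h₂ y hy]
  · rintro s' t ⟨⟨h₁, h₂, h₃, h₄⟩, h₅⟩
    exact ⟨h₁, h₂, h₃, h₄, h₅⟩

end Reduction

namespace Reduction

open WordRAM

/-! ### The whole program -/

def initCmd (K D a pad : ℕ) : Cmd :=
  .const 2 1 ;; .const 3 a ;; .const 4 K ;; .const 5 4 ;; .op 5 .add 1 5 ;; .const 6 D ;;
    .op 6 .div 0 6 ;; .op 7 .shl 2 6 ;; .op 8 .sub 7 2 ;; .op 9 .add 1 7 ;; .op 10 .add 9 7 ;;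
    .const 11 pad ;; .op 11 .add 10 11 ;; .op 12 .sub 0 6 ;; .op 12 .sub 12 6 ;; .op 13 .shl 2 12 ;;
    .op 14 .sub 13 2 ;; .op 15 .add 6 6 ;; .const 16 3 ;; .const 17 0 ;; .const 18 (3 * a + 4)

/-- The parameters of the reduction for the formula `φ`. -/
def params {K N : ℕ} (D a pad : ℕ) (φ : KSat.Formula K N) : Params where
  K := K
  N := N
  m := φ.clauses.length
  a := a
  pad := pad
  N₁ := N / D
  N₂ := N - N / D - N / D
  var := φ.initState.arr 0
  sgn := φ.initState.arr 1

theorem initState_arr_eq_zero {K N : ℕ} (φ : KSat.Formula K N) {k : ℕ} (h₀ : k ≠ 0) (h₁ : k ≠ 1)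
    (i : ℕ) : φ.initState.arr k i = 0 := by
  simp only [KSat.Formula.initState, h₀, h₁, if_false]
  split_ifs <;> rfl

theorem wp_initCmd {K N D a pad w : ℕ} {ω : ℕ → Bool} (φ : KSat.Formula K N)
    (hF : Fits (params D a pad φ) w) (hc : K + D + 2 * N + 3 * a + pad + 4 < 2 ^ w) :
    WP w ω (initCmd K D a pad) φ.initState fun s' t => Env (params D a pad φ) s' ∧
      s'.arr = φ.initState.arr ∧ s'.used = 0 ∧ t = 21 := by
  have hsegs := hF.segs_lt
  have hB := blocks_le (P := params D a pad φ)
  have hJ : (params D a pad φ).m + 4 ≤ segs (params D a pad φ).m (2 ^ (params D a pad φ).N₁)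
      (params D a pad φ).pad := by
    refine Nat.le_mul_of_pos_left _ ?_
    have : 0 < 2 ^ (params D a pad φ).N₁ := by positivity
    omega
  have hst := hF.stages
  have hdiv : N / D ≤ N := Nat.div_le_self _ _
  set R := segs (params D a pad φ).m (2 ^ (params D a pad φ).N₁) (params D a pad φ).pad
  simp only [params] at hB hJ hst
  have e₀ : φ.initState.reg 0 = N := rfl
  have e₁ : φ.initState.reg 1 = φ.clauses.length := rfl
  have hsh (k : ℕ) : 1 <<< k = 2 ^ k := by rw [Nat.shiftLeft_eq, one_mul]
  simp only [initCmd, wp_seq_iff, wp_op_iff, wp_const_iff, State.reg_setReg, State.used_setReg,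
    State.arr_setReg, BinOp.eval, Nat.reduceEqDiff, if_true, if_false, e₀, e₁, hsh]
  clear e₀ e₁
  have h₁₂ : N - N / D < 2 ^ w := (Nat.sub_le _ _).trans_lt (by omega)
  have h₁₂' : N - N / D - N / D < 2 ^ w := (Nat.sub_le _ _).trans_lt h₁₂
  refine ⟨by omega, by omega, by omega, by omega, by omega, by omega, by omega, by omega,
    by omega, by omega, by omega, by omega, by omega, h₁₂, h₁₂', by omega, by omega,
    by omega, by omega, by omega, by omega, ⟨fun y hy => ?_, rfl, rfl⟩, trivial, ?_⟩
  · interval_cases y <;> simp [Params.reg, params, KSat.Formula.initState] <;> omega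
  · simp [KSat.Formula.initState]

variable {P : Params} {w w₀ : ℕ} {ω : ℕ → Bool} {s r₀ : State} {B : ℕ}

/-- The simulated algorithm has reported a large eccentricity. -/
def Params.Detects (P : Params) (r : State) : Prop :=
  ∃ u < 2 ^ P.N₁, 3 * P.a + 4 ≤ r.arr 2 (((P.m + u) * (P.m + 4) + 1) * P.a)

/-- Run all the stages. -/
def stagesCmd (K : ℕ) (code query fin : Cmd) (pol : Bool) : Cmd :=
  forLoop 22 25 13 (opsCmd K code pol ;; simulate query ;; scanCmd ;; fin)

/-- The three kinds of algorithms differ in `fin`, which leads from the state `q x` after the query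
to the initial state of the next stage: deletions in the fully dynamic case, a reset otherwise. -/
theorem wp_stagesCmd {code query fin : Cmd} {pol : Bool} {f : ℕ → ℕ → State} {q : ℕ → State}
    {τ : ℕ → ℕ → ℕ} {τq τf σ : ℕ → ℕ} (hF : Fits P w) (hw₀ : w₀ ≤ w)
    (hL : Live P ω r₀ B s (f 0 0)) (h₅₀ : s.reg 50 = σ 0) (h₅₃ : s.reg 53 = 0)
    (hσ : ∀ x < 2 ^ P.N₂, σ x < 2 ^ w) (hthr : 3 * P.a + 4 < 2 ^ w)
    (hf : ∀ x < 2 ^ P.N₂, ∀ c < P.m, if P.bw x c = pol then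
      Exec w₀ ω code (passArgs P c (f x c)) (f x (c + 1)) (τ x c) else f x (c + 1) = f x c)
    (hq : ∀ x < 2 ^ P.N₂, Exec w₀ ω query (f x P.m) (q x) (τq x))
    (hfin : ∀ x < 2 ^ P.N₂, ∀ s, Live P ω r₀ B s (q x) → s.reg 22 = x → s.reg 50 = σ x →
      WP w ω fin s fun s' t => Live P ω r₀ B s' (f (x + 1) 0) ∧ s'.reg 22 = x ∧
        s'.reg 53 = s.reg 53 ∧ s'.reg 50 = σ (x + 1) ∧ t ≤ τf x)
    (hp : code.regBound < 2 ^ w) (hpq : query.regBound < 2 ^ w) (hB : B < 2 ^ w)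
    (hfB : ∀ x < 2 ^ P.N₂, ∀ c ≤ P.m, (f x c).used ≤ B) (hqB : ∀ x < 2 ^ P.N₂, (q x).used ≤ B) :
    WP w ω (stagesCmd P.K code query fin pol) s fun s' t => s'.reg 17 = 0 ∧ s'.reg 53 < 2 ^ w ∧
      (s'.reg 53 = 1 ↔ ∃ x < 2 ^ P.N₂, P.Detects (q x)) ∧
      t ≤ ∑ x ∈ Finset.range (2 ^ P.N₂), (20 * ∑ c ∈ Finset.range P.m, τ x c + 20 * τq x + τf x +
        P.m * (8 * P.K + 30) + 2 ^ P.N₁ * 14 + 9) + 3 := by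
  have hst := hF.stages
  refine WP.mono (wp_forLoop (N := 2 ^ P.N₂) (fun x s' => Live P ω r₀ B s' (f x 0) ∧
    s'.reg 50 = σ x ∧ ((∃ y < x, P.Detects (q y)) → s'.reg 53 = 1) ∧
    ((¬ ∃ y < x, P.Detects (q y)) → s'.reg 53 = 0))
    (fun x => 20 * ∑ c ∈ Finset.range P.m, τ x c + 20 * τq x + τf x +
        P.m * (8 * P.K + 30) + 2 ^ P.N₁ * 14 + 6) (by omega) (by norm_num) (by norm_num)
    (fun k s' h => ⟨h.1.env.reg 13 (by norm_num), h.1.env.reg 2 (by norm_num)⟩)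
    (fun k s' v h => ⟨h.1.setReg v (by norm_num) (by norm_num), by simpa using h.2⟩)
    (fun k s' v h => ⟨h.1.setReg v (by norm_num) (by norm_num), by simpa using h.2⟩)
    ?_ ⟨hL, h₅₀, by simp, fun _ => h₅₃⟩) ?_
  · rintro x s₁ hx ⟨L₁, a₁, b₁, c₁⟩ d₁
    refine wp_seq (WP.mono (wp_opsCmd hF hw₀ L₁ d₁ hx a₁ (hσ x hx) (hf x hx) hp hB (hfB x hx)) ?_)
    rintro s₂ t₂ ⟨L₂, r₂, u₂⟩
    refine wp_seq (WP.mono (wp_simulate_live hw₀ L₂ (hq x hx)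
      (by rw [r₂ 50 (by norm_num), a₁]; exact hσ x hx) hpq hB (hqB x hx)) ?_)
    rintro s₃ t₃ ⟨L₃, r₃, u₃⟩
    have e (y : ℕ) (hy : y = 22 ∨ y = 50 ∨ y = 53) : s₃.reg y = s₁.reg y :=
      (r₃ y (by omega)).trans (r₂ y hy)
    refine wp_seq (WP.mono (wp_scanCmd hF L₃ ((e 50 (by norm_num)).trans a₁) (hσ x hx) rfl hthr) ?_)
    rintro s₄ t₄ ⟨L₄, r₄, g₄, g₄', u₄⟩
    refine WP.mono (hfin x hx s₄ L₄
      ((r₄ 22 (by norm_num)).trans ((e 22 (by norm_num)).trans d₁))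
      ((r₄ 50 (by norm_num)).trans ((e 50 (by norm_num)).trans a₁))) ?_
    rintro s₅ t₅ ⟨L₅, a₅, b₅, c₅, u₅⟩
    have hsucc : (∃ y < x + 1, P.Detects (q y)) ↔ (∃ y < x, P.Detects (q y)) ∨ P.Detects (q x) := by
      constructor
      · rintro ⟨u, hu, h⟩
        rcases Nat.lt_succ_iff_lt_or_eq.mp hu with hu | rfl
        · exact Or.inl ⟨u, hu, h⟩
        · exact Or.inr h
      · rintro (⟨u, hu, h⟩ | h)
        · exact ⟨u, by omega, h⟩
        · exact ⟨x, by omega, h⟩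
    refine ⟨⟨L₅, c₅, ?_, ?_⟩, a₅, by omega⟩
    · rw [hsucc, b₅]
      intro h
      by_cases hx' : P.Detects (q x)
      · exact g₄ hx'
      · rw [g₄' hx', e 53 (by norm_num)]
        exact b₁ (h.resolve_right hx')
    · rw [hsucc, b₅]
      intro h
      rw [g₄' fun h' => h (Or.inr h'), e 53 (by norm_num)]
      exact c₁ fun h' => h (Or.inl h')
  · rintro s' t ⟨⟨h₁, h₂, h₃, h₄⟩, h₅⟩
    have hlt : s'.reg 53 < 2 ^ w := by
      by_cases h : ∃ y < 2 ^ P.N₂, P.Detects (q y)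
      · rw [h₃ h]; omega
      · rw [h₄ h]; omega
    refine ⟨h₁.env.reg 17 (by norm_num), hlt, ⟨fun h => ?_, h₃⟩, h₅⟩
    by_contra hn
    rw [h₄ hn] at h
    omega

/-- The reduction for the dynamic algorithm with the given programs. -/
def mainCmd (K D a pad : ℕ) (dec : Bool) (prep code query fin : Cmd) (pol : Bool) : Cmd :=
  initCmd K D a pad ;; buildCmd K dec ;; installCmd ;; simulate prep ;; saveCmd ;;
    stagesCmd K code query fin pol ;; .op 0 .add 53 17

theorem wp_mainCmd {K N D a pad : ℕ} (φ : KSat.Formula K N) {dec : Bool}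
    {prep code query fin : Cmd} {pol : Bool} {f : ℕ → ℕ → State} {q : ℕ → State} {T₀ : ℕ}
    {τ : ℕ → ℕ → ℕ} {τq τf σ : ℕ → ℕ} (hP : P = params D a pad φ) (hF : Fits P w) (hw₀ : w₀ ≤ w)
    (hc : K + D + 2 * N + 3 * a + pad + 4 < 2 ^ w)
    (hr₀ : Exec w₀ ω prep (DynGraph.initState (P.finEdges dec)) r₀ T₀) (hf₀ : f 0 0 = r₀)
    (h₅₀ : σ 0 = 2) (hσ : ∀ x < 2 ^ P.N₂, σ x < 2 ^ w)
    (hf : ∀ x < 2 ^ P.N₂, ∀ c < P.m, if P.bw x c = pol then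
      Exec w₀ ω code (passArgs P c (f x c)) (f x (c + 1)) (τ x c) else f x (c + 1) = f x c)
    (hq : ∀ x < 2 ^ P.N₂, Exec w₀ ω query (f x P.m) (q x) (τq x))
    (hfin : ∀ x < 2 ^ P.N₂, ∀ s, Live P ω r₀ B s (q x) → s.reg 22 = x → s.reg 50 = σ x →
      WP w ω fin s fun s' t => Live P ω r₀ B s' (f (x + 1) 0) ∧ s'.reg 22 = x ∧
        s'.reg 53 = s.reg 53 ∧ s'.reg 50 = σ (x + 1) ∧ t ≤ τf x)
    (hp₀ : prep.regBound < 2 ^ w) (hp : code.regBound < 2 ^ w) (hpq : query.regBound < 2 ^ w)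
    (hB : B < 2 ^ w) (hfB : ∀ x < 2 ^ P.N₂, ∀ c ≤ P.m, (f x c).used ≤ B)
    (hqB : ∀ x < 2 ^ P.N₂, (q x).used ≤ B) :
    WP w ω (mainCmd K D a pad dec prep code query fin pol) φ.initState fun s' t =>
      (s'.reg 0 = 1 ↔ ∃ x < 2 ^ P.N₂, P.Detects (q x)) ∧
      t ≤ 20 * T₀ + ∑ x ∈ Finset.range (2 ^ P.N₂), (20 * ∑ c ∈ Finset.range P.m, τ x c +
        20 * τq x + τf x + P.m * (8 * P.K + 30) + 2 ^ P.N₁ * 14 + 9) + P.buildTime + 36 := by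
  have hK : P.K = K := by rw [hP]; rfl
  have ha : P.a = a := by rw [hP]; rfl
  have hst := hF.stages
  have hu₀ : r₀.used ≤ B := hf₀ ▸ hfB 0 (by positivity) 0 (by omega)
  refine wp_seq (WP.mono (wp_initCmd φ (hP ▸ hF) hc) ?_)
  rw [← hP]
  rintro s₁ t₁ ⟨E₁, a₁, u₁, c₁⟩
  refine wp_seq (WP.mono (hK ▸ wp_buildCmd (dec := dec) hF E₁
    (fun k h₀ h₁ i => by rw [a₁]; exact initState_arr_eq_zero φ h₀ h₁ i) u₁) ?_)
  rintro s₂ t₂ ⟨E₂, B₂, r₂, c₂⟩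
  refine wp_seq (WP.mono (wp_installCmd hF E₂ B₂ r₂) ?_)
  rintro s₃ t₃ ⟨E₃, R₃, a₃, b₃, d₃, u₃, c₃⟩
  refine wp_seq (WP.mono (wp_simulate hw₀ hr₀ R₃ (E₃.reg 2 (by norm_num)) (by rw [a₃]; omega) hp₀
    (by rw [u₃]; positivity) (by omega)) ?_)
  rintro s₄ t₄ ⟨R₄, F₄, u₄, c₄⟩
  have E₄ := E₃.frame F₄
  refine wp_seq (WP.mono (wp_saveCmd E₄ R₄ ((F₄.reg 50 (by norm_num)).trans a₃)
    ((F₄.reg 51 (by norm_num)).trans b₃) (by omega) (by omega)) ?_)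
  rintro s₅ t₅ ⟨E₅, R₅, S₅, a₅, d₅, u₅, c₅⟩
  have L₅ : Live P ω r₀ B s₅ (f 0 0) := ⟨E₅, hf₀ ▸ R₅, S₅, by omega⟩
  refine wp_seq (WP.mono (hK ▸ wp_stagesCmd hF hw₀ L₅ (a₅.trans h₅₀.symm)
    (d₅.trans ((F₄.reg 53 (by norm_num)).trans d₃)) hσ (by omega) hf hq hfin hp hpq hB hfB hqB) ?_)
  rintro s₆ t₆ ⟨e₁₇, hlt, hiff, c₆⟩
  rw [wp_op_iff]
  simp only [BinOp.eval, e₁₇, add_zero, State.reg_setReg, if_true]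
  rw [hK]
  exact ⟨hlt, hiff, by omega⟩

end Reduction

/-! ## Runs of dynamic algorithms -/

namespace DynGraph

open WordRAM

variable {n : ℕ} {A : Algorithm} {ω : ℕ → Bool} {s s' : State} {σ σ₁ σ₂ : List (Op n)} {ts : List ℕ}

theorem Algorithm.RunOps.of_append (h : A.RunOps ω s (σ₁ ++ σ₂) ts s') : ∃ ts₁ ts₂ s₁,
    ts = ts₁ ++ ts₂ ∧ A.RunOps ω s σ₁ ts₁ s₁ ∧ A.RunOps ω s₁ σ₂ ts₂ s' := by
  induction σ₁ generalizing s ts with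
  | nil => exact ⟨[], ts, s, rfl, .nil s, h⟩
  | cons o σ₁ ih =>
    cases h with
    | cons ho hσ =>
      obtain ⟨ts₁, ts₂, s₁, rfl, h₁, h₂⟩ := ih hσ
      exact ⟨_ :: ts₁, ts₂, s₁, rfl, .cons ho h₁, h₂⟩

theorem Algorithm.RunOps.append {ts₁ ts₂ : List ℕ} {s₁ : State} (h₁ : A.RunOps ω s σ₁ ts₁ s₁)
    (h₂ : A.RunOps ω s₁ σ₂ ts₂ s') : A.RunOps ω s (σ₁ ++ σ₂) (ts₁ ++ ts₂) s' := by
  induction h₁ with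
  | nil s => exact h₂
  | cons ho _ ih => exact .cons ho (ih h₂)

theorem Algorithm.RunOps.det {s₁ : State} {ts₁ : List ℕ} (h : A.RunOps ω s σ ts s') :
    A.RunOps ω s σ ts₁ s₁ → ts = ts₁ ∧ s' = s₁ := by
  induction h generalizing ts₁ s₁ with
  | nil s => intro h; cases h; exact ⟨rfl, rfl⟩
  | cons ho _ ih =>
    intro h
    cases h with
    | cons ho' hσ' =>
      obtain ⟨rfl, rfl⟩ := ho.det ho'
      obtain ⟨rfl, rfl⟩ := ih hσ'
      exact ⟨rfl, rfl⟩

@[simp] theorem Op.used_passArgs (o : Op n) : (o.passArgs s).used = s.used := by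
  cases o <;> rfl

theorem Algorithm.RunOps.used_le (h : A.RunOps ω s σ ts s') :
    s.used ≤ s'.used ∧ s'.used ≤ s.used + ts.sum := by
  induction h with
  | nil s => simp
  | cons ho _ ih =>
    have := ho.used_le
    rw [Op.used_passArgs] at this
    rw [List.sum_cons]
    omega

theorem Algorithm.RunOps.flatMap {k : ℕ} {blk : ℕ → List (Op n)}
    (h : A.RunOps ω s ((List.range k).flatMap blk) ts s') :
    ∃ (g : ℕ → State) (tl : ℕ → List ℕ), g 0 = s ∧ g k = s' ∧
      (∀ x < k, A.RunOps ω (g x) (blk x) (tl x) (g (x + 1))) ∧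
      ts.sum = ∑ x ∈ Finset.range k, (tl x).sum := by
  induction k generalizing ts s' with
  | zero =>
    cases h
    exact ⟨fun _ => s, fun _ => [], rfl, rfl, by simp, by simp⟩
  | succ k ih =>
    rw [List.range_succ, List.flatMap_append] at h
    obtain ⟨ts₁, ts₂, s₁, rfl, h₁, h₂⟩ := h.of_append
    obtain ⟨g, tl, rfl, rfl, hg, ht⟩ := ih h₁
    refine ⟨fun x => if x ≤ k then g x else s', fun x => if x < k then tl x else ts₂, by simp,
      by simp, fun x hx => ?_, ?_⟩
    · rcases Nat.lt_succ_iff_lt_or_eq.mp hx with hx | rfl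
      · simpa [hx, hx.le, show x + 1 ≤ k from hx] using hg x hx
      · simpa using h₂
    · rw [List.sum_append, ht, Finset.sum_range_succ]
      congr 1
      · exact Finset.sum_congr rfl fun x hx => by simp [Finset.mem_range.mp hx]
      · simp

/-- Those of the operations `op 0, …, op (m - 1)` that are selected by `p`. -/
def opsList (p : ℕ → Prop) [DecidablePred p] (op : ℕ → Op n) (m : ℕ) : List (Op n) :=
  (List.range m).flatMap fun c => if p c then [op c] else []

section

variable {p : ℕ → Prop} [DecidablePred p] {op : ℕ → Op n} {m : ℕ}

theorem opsList_succ : opsList p op (m + 1) = opsList p op m ++ if p m then [op m] else [] := by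
  simp [opsList, List.range_succ]

theorem length_opsList_le : (opsList p op m).length ≤ m := by
  induction m with
  | zero => simp [opsList]
  | succ m ih =>
    rw [opsList_succ, List.length_append]
    split_ifs <;> simp <;> omega

theorem mem_opsList {o : Op n} : o ∈ opsList p op m ↔ ∃ c < m, p c ∧ o = op c := by
  simp only [opsList, List.mem_flatMap, List.mem_range]
  refine exists_congr fun c => and_congr_right fun _ => ?_
  split_ifs with h <;> simp [h]

theorem Algorithm.RunOps.steps (h : A.RunOps ω s (opsList p op m) ts s') :
    ∃ (f : ℕ → State) (τ : ℕ → ℕ), f 0 = s ∧ f m = s' ∧ (∀ c < m, if p c then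
      Exec (A.wordLength n) ω (A.code (op c)) ((op c).passArgs (f c)) (f (c + 1)) (τ c)
      else f (c + 1) = f c) ∧ ts.sum = ∑ c ∈ Finset.range m, τ c := by
  obtain ⟨g, tl, h₀, h₁, h₂, h₃⟩ := h.flatMap
  refine ⟨g, fun c => (tl c).sum, h₀, h₁, fun c hc => ?_, h₃⟩
  have := h₂ c hc
  split_ifs at this ⊢ with hp
  · obtain ⟨t, ht⟩ : ∃ t, t = tl c := ⟨_, rfl⟩
    show Exec _ _ _ _ _ (tl c).sum
    rw [← ht] at this ⊢
    cases this with
    | cons ho hσ => cases hσ; simpa using ho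
  · generalize tl c = t at this
    generalize g c = s₁ at this
    generalize g (c + 1) = s₂ at this
    cases this
    rfl

/-- Reassembles a run from single steps; by determinism it can then be identified with the run
promised for a prefix. -/
theorem Algorithm.RunOps.of_steps {f : ℕ → State} {τ : ℕ → ℕ} (h : ∀ c < m, if p c then
      Exec (A.wordLength n) ω (A.code (op c)) ((op c).passArgs (f c)) (f (c + 1)) (τ c)
      else f (c + 1) = f c) : ∃ ts, A.RunOps ω (f 0) (opsList p op m) ts (f m) := by
  induction m with
  | zero => exact ⟨[], .nil _⟩
  | succ m ih =>
    obtain ⟨ts, hts⟩ := ih fun c hc => h c (by omega)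
    have := h m (by omega)
    rw [opsList_succ]
    split_ifs at this ⊢ with hp
    · exact ⟨_, hts.append (.cons this (.nil _))⟩
    · rw [this]
      exact ⟨_, hts.append (.nil _)⟩

end

theorem Algorithm.RunOps.singleton {o : Op n} (h : A.RunOps ω s [o] ts s') :
    ∃ t, ts = [t] ∧ Exec (A.wordLength n) ω (A.code o) (o.passArgs s) s' t := by
  cases h with
  | cons ho hσ => cases hσ; exact ⟨_, rfl, ho⟩

/-! ### Sequences of graphs -/

variable {C : ℕ} {G : SimpleGraph (Fin n)}

theorem applyAll_append : applyAll G (σ₁ ++ σ₂) = applyAll (applyAll G σ₁) σ₂ :=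
  List.foldl_append ..

theorem Legal.append (h₁ : Legal C G σ₁) (h₂ : Legal C (applyAll G σ₁) σ₂) :
    Legal C G (σ₁ ++ σ₂) := by
  induction σ₁ generalizing G with
  | nil => exact h₂
  | cons o σ₁ ih => exact ⟨h₁.1, h₁.2.1, ih h₁.2.2 h₂⟩

theorem Legal.flatMap {k : ℕ} {blk : ℕ → List (Op n)} {H : ℕ → SimpleGraph (Fin n)}
    (h₀ : (H 0).Connected ∧ (H 0).edgeSet.ncard ≤ C * n)
    (h : ∀ x < k, Legal C (H x) (blk x) ∧ applyAll (H x) (blk x) = H (x + 1)) :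
    Legal C (H 0) ((List.range k).flatMap blk) ∧
      applyAll (H 0) ((List.range k).flatMap blk) = H k := by
  induction k with
  | zero => exact ⟨h₀, rfl⟩
  | succ k ih =>
    obtain ⟨h₁, h₂⟩ := ih fun x hx => h x (by omega)
    obtain ⟨h₃, h₄⟩ := h k (by omega)
    rw [List.range_succ, List.flatMap_append, List.flatMap_singleton]
    refine ⟨h₁.append (by rwa [h₂]), ?_⟩
    rw [applyAll_append, h₂, h₄]

theorem Legal.opsList {p : ℕ → Prop} [DecidablePred p] {op : ℕ → Op n} {m : ℕ}
    {H : ℕ → SimpleGraph (Fin n)} (hH : ∀ c, (H c).Connected ∧ (H c).edgeSet.ncard ≤ C * n)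
    (h : ∀ c < m, if p c then (op c).Allowed (H c) ∧ (op c).apply (H c) = H (c + 1)
      else H (c + 1) = H c) :
    Legal C (H 0) (opsList p op m) ∧ applyAll (H 0) (DynGraph.opsList p op m) = H m := by
  refine Legal.flatMap (hH 0) fun c hc => ?_
  have := h c hc
  split_ifs at this ⊢ with hp
  · refine ⟨⟨hH c, this.1, ?_⟩, this.2⟩
    rw [this.2]
    exact hH _
  · exact ⟨hH c, this.symm⟩

end DynGraph

namespace Reduction

open WordRAM

/-! ### Assignments -/

/-- The assignment that consists of `u`, `v` and `x`. -/
def Params.assign (P : Params) (u v x : ℕ) (i : ℕ) : Bool :=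
  if i < P.N₁ then u.testBit i else if i < 2 * P.N₁ then v.testBit (i - P.N₁)
  else x.testBit (i - 2 * P.N₁)

variable {P : Params}

/-- Outside the window of `k` bits starting at `sh` both shifted numbers vanish, so literals of
foreign variables count as false whatever their sign. -/
theorem Params.lit_iff {sh k x p : ℕ} (hx : x < 2 ^ k) :
    P.lit (x <<< sh) ((2 ^ k - 1 - x) <<< sh) p = true ↔
      sh ≤ P.var p ∧ P.var p < sh + k ∧ x.testBit (P.var p - sh) = decide (P.sgn p ≠ 0) := by
  have hsub : 2 ^ k - 1 - x = 2 ^ k - (x + 1) := by omega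
  unfold Params.lit
  by_cases h : P.sgn p = 0
  · simp only [h, hsub, ne_eq, not_true, if_false, Nat.testBit_shiftLeft,
      Nat.testBit_two_pow_sub_succ hx, Bool.and_eq_true, decide_eq_true_eq, Bool.not_eq_true',
      decide_false]
    constructor
    · exact fun ⟨h₁, h₂, h₃⟩ => ⟨h₁, by omega, h₃⟩
    · exact fun ⟨h₁, h₂, h₃⟩ => ⟨h₁, by omega, h₃⟩
  · simp only [h, ne_eq, not_false_iff, if_true, Nat.testBit_shiftLeft, Bool.and_eq_true,
      decide_eq_true_eq, decide_true]
    refine ⟨fun ⟨h₁, h₂⟩ => ⟨h₁, ?_, h₂⟩, fun ⟨h₁, _, h₂⟩ => ⟨h₁, h₂⟩⟩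
    by_contra hlt
    rw [Nat.testBit_lt_two_pow (hx.trans_le (Nat.pow_le_pow_right (by norm_num) (by omega)))] at h₂
    exact absurd h₂ (by simp)

theorem Params.bit_eq_false_iff {sh k x c : ℕ} (hx : x < 2 ^ k) :
    P.bit sh (2 ^ k - 1) x c = false ↔ ∃ i < P.K, sh ≤ P.var (c * P.K + i) ∧
      P.var (c * P.K + i) < sh + k ∧
      x.testBit (P.var (c * P.K + i) - sh) = decide (P.sgn (c * P.K + i) ≠ 0) := by
  rw [Params.bit, decide_eq_false_iff_not]
  push Not
  refine exists_congr fun i => and_congr_right fun _ => ?_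
  rw [Bool.ne_false_iff]
  exact Params.lit_iff hx

/-- Each variable belongs to exactly one part, so a true literal of the clause is a true literal for
that part. -/
theorem Params.bits_iff {u v x c : ℕ} (hu : u < 2 ^ P.N₁) (hv : v < 2 ^ P.N₁) (hx : x < 2 ^ P.N₂)
    (hN : ∀ i < P.K, P.var (c * P.K + i) < 2 * P.N₁ + P.N₂) :
    ¬ (P.bu u c ∧ P.bv v c ∧ P.bw x c) ↔ ∃ i < P.K,
      P.assign u v x (P.var (c * P.K + i)) = decide (P.sgn (c * P.K + i) ≠ 0) := by
  have h (b₁ b₂ b₃ : Bool) : ¬ (b₁ = true ∧ b₂ = true ∧ b₃ = true) ↔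
      b₁ = false ∨ b₂ = false ∨ b₃ = false := by
    cases b₁ <;> cases b₂ <;> cases b₃ <;> simp
  rw [h, Params.bu, Params.bv, Params.bw, Params.bit_eq_false_iff hu, Params.bit_eq_false_iff hv,
    Params.bit_eq_false_iff hx]
  unfold Params.assign
  constructor
  · rintro (⟨i, hi, h₁, h₂, h₃⟩ | ⟨i, hi, h₁, h₂, h₃⟩ | ⟨i, hi, h₁, h₂, h₃⟩) <;>
      refine ⟨i, hi, ?_⟩
    · rw [if_pos (by omega)]
      simpa using h₃
    · rw [if_neg (by omega), if_pos (by omega)]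
      exact h₃
    · rw [if_neg (by omega), if_neg (by omega)]
      exact h₃
  · rintro ⟨i, hi, h⟩
    have := hN i hi
    split_ifs at h with h₁ h₂
    · exact Or.inl ⟨i, hi, by omega, by omega, by simpa using h⟩
    · exact Or.inr (Or.inl ⟨i, hi, by omega, by omega, h⟩)
    · exact Or.inr (Or.inr ⟨i, hi, by omega, by omega, h⟩)

theorem initState_clause {K N : ℕ} (φ : KSat.Formula K N) {c i : ℕ} (hc : c < φ.clauses.length)
    (hi : i < K) : φ.initState.arr 0 (c * K + i) = ((φ.clauses[c]) ⟨i, hi⟩).1.val ∧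
      φ.initState.arr 1 (c * K + i) = ((φ.clauses[c]) ⟨i, hi⟩).2.toNat := by
  obtain ⟨h₁, h₂⟩ := divmod (b := c) hi
  have h : (c * K + i) / K < φ.clauses.length ∧ 0 < K := ⟨by rw [h₁]; exact hc, by omega⟩
  have e : φ.clauses[(c * K + i) / K]'h.1 = φ.clauses[c] := by simp only [h₁]
  have h' : c < φ.clauses.length ∧ 0 < K := ⟨hc, h.2⟩
  simp only [KSat.Formula.initState, if_true, one_ne_zero, if_false, h₁, h₂, dif_pos h',
    List.get_eq_getElem, e, and_self]

theorem exists_testBit (k : ℕ) (f : ℕ → Bool) : ∃ u < 2 ^ k, ∀ i < k, u.testBit i = f i :=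
  ⟨Nat.ofBits fun i : Fin k => f i, Nat.ofBits_lt_two_pow _, fun i hi => by
    rw [Nat.testBit_ofBits_lt _ _ hi]⟩

/-- Every assignment is obtained by reading off the bits of three numbers, so searching triples
searches all assignments. -/
theorem satisfiable_iff {K N D a pad : ℕ} (φ : KSat.Formula K N) (hP : P = params D a pad φ)
    (hN : 2 * P.N₁ + P.N₂ = N) : φ.Satisfiable ↔ ∃ x < 2 ^ P.N₂, ∃ u < 2 ^ P.N₁, ∃ v < 2 ^ P.N₁,
      ∀ c < P.m, ¬ (P.bu u c ∧ P.bv v c ∧ P.bw x c) := by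
  have hK : P.K = K := by rw [hP]; rfl
  have hm : P.m = φ.clauses.length := by rw [hP]; rfl
  have hvar : P.var = φ.initState.arr 0 := by rw [hP]; rfl
  have hsgn : P.sgn = φ.initState.arr 1 := by rw [hP]; rfl
  have key {x u v : ℕ} (hx : x < 2 ^ P.N₂) (hu : u < 2 ^ P.N₁) (hv : v < 2 ^ P.N₁) :
      (∀ c < P.m, ¬ (P.bu u c ∧ P.bv v c ∧ P.bw x c)) ↔
        ∀ c ∈ φ.clauses, ∃ i : Fin K, P.assign u v x (c i).1 = (c i).2 := by
    have h₁ (c : ℕ) (hc : c < φ.clauses.length) : ¬ (P.bu u c ∧ P.bv v c ∧ P.bw x c) ↔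
        ∃ i : Fin K, P.assign u v x (φ.clauses[c] i).1 = (φ.clauses[c] i).2 := by
      rw [Params.bits_iff hu hv hx, hK, hvar, hsgn]
      · constructor
        · rintro ⟨i, hi, h⟩
          obtain ⟨e₁, e₂⟩ := initState_clause φ hc hi
          rw [e₁, e₂] at h
          exact ⟨⟨i, hi⟩, h.trans (by cases (φ.clauses[c] ⟨i, hi⟩).2 <;> rfl)⟩
        · rintro ⟨⟨i, hi⟩, h⟩
          obtain ⟨e₁, e₂⟩ := initState_clause φ hc hi
          refine ⟨i, hi, ?_⟩
          rw [e₁, e₂]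
          exact h.trans (by cases (φ.clauses[c] ⟨i, hi⟩).2 <;> rfl)
      · intro i hi
        rw [hK] at hi ⊢
        rw [hvar, (initState_clause φ hc hi).1, hN]
        exact Fin.is_lt _
    rw [hm]
    constructor
    · intro h c hc
      obtain ⟨k, hk, rfl⟩ := List.getElem_of_mem hc
      exact (h₁ k hk).mp (h k hk)
    · exact fun h c hc => (h₁ c hc).mpr (h _ (List.getElem_mem hc))
  constructor
  · rintro ⟨y, hy⟩
    set y' : ℕ → Bool := fun i => if h : i < N then y ⟨i, h⟩ else false with hy'
    obtain ⟨u, hu, hu'⟩ := exists_testBit P.N₁ y'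
    obtain ⟨v, hv, hv'⟩ := exists_testBit P.N₁ fun i => y' (i + P.N₁)
    obtain ⟨x, hx, hx'⟩ := exists_testBit P.N₂ fun i => y' (i + 2 * P.N₁)
    have hass (i : Fin N) : P.assign u v x i = y i := by
      have e : y' i = y i := by simp [hy']
      have := i.is_lt
      rw [← e, Params.assign]
      split_ifs with h₁ h₂
      · exact hu' _ h₁
      · rw [hv' _ (by omega)]; congr 1; omega
      · rw [hx' _ (by omega)]; congr 1; omega
    refine ⟨x, hx, u, hu, v, hv, (key hx hu hv).mpr fun c hc => ?_⟩
    obtain ⟨i, hi⟩ := hy c hc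
    exact ⟨i, by rw [hass, hi]⟩
  · rintro ⟨x, hx, u, hu, v, hv, h⟩
    exact ⟨fun i => P.assign u v x i, (key hx hu hv).mp h⟩

/-! ### What the answers tell -/

theorem val_node {a m M pad k : ℕ} (hk : k ≤ segs m M pad) : (node a m M pad k).val = k * a :=
  SegGraph.val_vtx (Nat.mul_le_mul_right a hk)

/-- An estimate above the threshold certifies an eccentricity above `3 * a + 3`. Conversely, an
eccentricity of at least `5 * a` cannot be covered by `α` times an estimate of at most `3 * a + 3`.
-/
theorem detects_iff {α : ℝ} {T : ℕ → Bool} {x : ℕ} {r : State} (ha : 2 ≤ P.a)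
    (hα : α * (3 * P.a + 3 : ℕ) < (5 * P.a : ℕ)) (hT : ∀ c < P.m, T c = P.bw x c)
    (h : DynGraph.ApproxEcc α (stageGraph P.a P.m (2 ^ P.N₁) P.pad P.bu P.bv T) r) :
    P.Detects r ↔ ∃ u < 2 ^ P.N₁, ∃ v < 2 ^ P.N₁,
      ∀ c < P.m, ¬ (P.bu u c ∧ P.bv v c ∧ P.bw x c) := by
  have hval {u : ℕ} (hu : u < 2 ^ P.N₁) : (node P.a P.m (2 ^ P.N₁) P.pad
      ((P.m + u) * (P.m + 4) + 1)).val = ((P.m + u) * (P.m + 4) + 1) * P.a :=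
    val_node (Fits.block_le (by omega) (by omega)).le
  constructor
  · rintro ⟨u, hu, h₁⟩
    by_contra hn
    push Not at hn
    have h₂ := eccent_le (a := P.a) (pad := P.pad) (T := T) ha (fun u hu v hv => by
      obtain ⟨c, hc, h₃, h₄, h₅⟩ := hn u hu v hv
      exact ⟨c, hc, h₃, h₄, by rw [hT c hc]; exact h₅⟩) hu
    have h₃ := (h (node P.a P.m (2 ^ P.N₁) P.pad ((P.m + u) * (P.m + 4) + 1))).1
    rw [hval hu] at h₃
    have h₄ := ENat.toNat_le_of_le_natCast h₂
    omega
  · rintro ⟨u, hu, v, hv, h₁⟩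
    refine ⟨u, hu, ?_⟩
    have h₂ := le_eccent (a := P.a) (pad := P.pad) (T := T) (bu := P.bu) (bv := P.bv) ha hu hv
      fun c hc => by rw [hT c hc]; exact h₁ c hc
    have hc : (stageGraph P.a P.m (2 ^ P.N₁) P.pad P.bu P.bv T).Connected := stageGraph_connected ha
    have htop : (stageGraph P.a P.m (2 ^ P.N₁) P.pad P.bu P.bv T).eccent
        (node P.a P.m (2 ^ P.N₁) P.pad ((P.m + u) * (P.m + 4) + 1)) ≠ ⊤ :=
      ne_top_of_le_ne_top (SimpleGraph.connected_iff_ediam_ne_top.mp hc)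
        SimpleGraph.eccent_le_ediam
    have h₃ : 5 * P.a ≤ _ := (ENat.natCast_le_natCast.mp ((ENat.natCast_toNat htop).symm ▸ h₂))
    have h₄ := (h (node P.a P.m (2 ^ P.N₁) P.pad ((P.m + u) * (P.m + 4) + 1))).2
    rw [hval hu] at h₄
    set e := r.arr 2 (((P.m + u) * (P.m + 4) + 1) * P.a)
    by_contra hlt
    have h₅ : (e : ℝ) ≤ (3 * P.a + 3 : ℕ) := by exact_mod_cast (by omega : e ≤ 3 * P.a + 3)
    have h₆ : ((5 * P.a : ℕ) : ℝ) ≤ α * e := le_trans (by exact_mod_cast h₃) h₄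
    have h₇ : (0 : ℝ) < (5 * P.a : ℕ) := by exact_mod_cast (by omega : 0 < 5 * P.a)
    -- The factor `5 / 3 - ε` may be negative; then no positive eccentricity can be approximated at
    -- all.
    rcases le_or_gt 0 α with h₀ | h₀
    · have := mul_le_mul_of_nonneg_left h₅ h₀
      linarith
    · have := mul_nonpos_of_nonpos_of_nonneg h₀.le (Nat.cast_nonneg e : (0 : ℝ) ≤ e)
      linarith

end Reduction

namespace DynGraph

open WordRAM

variable {n : ℕ} {A : Algorithm} {ω : ℕ → Bool}

theorem Algorithm.RunOps.of_flatMap {k : ℕ} {blk : ℕ → List (Op n)} {g : ℕ → State}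
    {tl : ℕ → List ℕ} (h : ∀ x < k, A.RunOps ω (g x) (blk x) (tl x) (g (x + 1))) :
    ∃ ts, A.RunOps ω (g 0) ((List.range k).flatMap blk) ts (g k) := by
  induction k with
  | zero => exact ⟨[], .nil _⟩
  | succ k ih =>
    obtain ⟨ts, hts⟩ := ih fun x hx => h x (by omega)
    rw [List.range_succ, List.flatMap_append, List.flatMap_singleton]
    exact ⟨_, hts.append (h k (by omega))⟩

/-- With the coin flips `ω`, the algorithm keeps its promises for the sequence `σ`. -/
def Algorithm.Succeeds (A : Algorithm) (α : ℝ) (G : SimpleGraph (Fin n))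
    (L : List (Fin n × Fin n)) (time : List (Op n) → ℕ → List ℕ → Prop) (σ : List (Op n))
    (ω : ℕ → Bool) : Prop :=
  ∃ (t₀ : ℕ) (ts : List ℕ) (s : State),
    A.Run ω L σ t₀ ts s ∧ time σ t₀ ts ∧ LastAnswerCorrect α G σ s

end DynGraph

/-! ### From runs of the algorithm to a run of the reduction -/

namespace Reduction

open WordRAM DynGraph

theorem le_of_step {u : ℕ → ℕ} {m : ℕ} (h : ∀ c < m, u c ≤ u (c + 1)) {c : ℕ} (hc : c ≤ m) :
    u c ≤ u m := by
  induction m with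
  | zero => rw [Nat.le_zero.mp hc]
  | succ m ih =>
    rcases Nat.le_succ_iff.mp hc with hc | rfl
    · exact (ih (fun c hc => h c (by omega)) hc).trans (h m (by omega))
    · exact le_rfl

/-- The graph of the stage `T`. -/
def Params.graph (P : Params) (T : ℕ → Bool) :
    SimpleGraph (Fin (segs P.m (2 ^ P.N₁) P.pad * P.a + 1)) :=
  stageGraph P.a P.m (2 ^ P.N₁) P.pad P.bu P.bv T

def Params.ins (P : Params) (c : ℕ) : Op (segs P.m (2 ^ P.N₁) P.pad * P.a + 1) :=
  .insert (node P.a P.m (2 ^ P.N₁) P.pad (c * (P.m + 4) + 4))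
    (node P.a P.m (2 ^ P.N₁) P.pad (c * (P.m + 4) + 2))

def Params.del (P : Params) (c : ℕ) : Op (segs P.m (2 ^ P.N₁) P.pad * P.a + 1) :=
  .delete (node P.a P.m (2 ^ P.N₁) P.pad (c * (P.m + 4) + 4))
    (node P.a P.m (2 ^ P.N₁) P.pad (c * (P.m + 4) + 2))

variable {P : Params} {A : Algorithm} {α : ℝ} {ω : ℕ → Bool} {w : ℕ}

theorem passArgs_ins {c : ℕ} (hc : c < P.m) (s : State) : (P.ins c).passArgs s = passArgs P c s := by
  rw [Params.ins, Op.passArgs, val_node (block_lt (by omega) (by omega)).le,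
    val_node (block_lt (by omega) (by omega)).le, passArgs]

theorem passArgs_del {c : ℕ} (hc : c < P.m) (s : State) : (P.del c).passArgs s = passArgs P c s := by
  rw [Params.del, Op.passArgs, val_node (block_lt (by omega) (by omega)).le,
    val_node (block_lt (by omega) (by omega)).le, passArgs]

/-- The number of steps of the reduction, besides the simulation of the algorithm. -/
def Params.overhead (P : Params) : ℕ :=
  2 ^ P.N₂ * (2 * (P.m * (8 * P.K + 30) + 3) + 2 ^ P.N₁ * 14 + 9) + P.buildTime + 36

section Full

variable {D a pad K N : ℕ}

/-- The sequence of operations for the stage `x`. -/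
def Params.block (P : Params) (x : ℕ) : List (Op (segs P.m (2 ^ P.N₁) P.pad * P.a + 1)) :=
  opsList (fun c => P.bw x c = true) P.ins P.m ++
    .query :: opsList (fun c => P.bw x c = true) P.del P.m

/-- The operations up to the query of the stage `x`. -/
def Params.upTo (P : Params) (x : ℕ) : List (Op (segs P.m (2 ^ P.N₁) P.pad * P.a + 1)) :=
  (List.range x).flatMap P.block ++ (opsList (fun c => P.bw x c = true) P.ins P.m ++ [.query])

/-- One long run serves all stages. The promise for the complete sequence supplies the run and the
total time; the promises for the prefixes ending with a query supply the correctness of each answer.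
-/
theorem exists_exec_full {R : ℕ}
    {time : List (Op (segs P.m (2 ^ P.N₁) P.pad * P.a + 1)) → ℕ → List ℕ → Prop}
    (φ : KSat.Formula K N) (hP : P = params D a pad φ) (hN : 2 * P.N₁ + P.N₂ = N) (hF : Fits P w)
    (hw : A.wordLength (segs P.m (2 ^ P.N₁) P.pad * P.a + 1) ≤ w)
    (hc : K + D + 2 * N + 3 * a + pad + 4 < 2 ^ w)
    (hα : α * (3 * P.a + 3 : ℕ) < (5 * P.a : ℕ)) (hp₀ : A.preprocess.regBound < 2 ^ w)
    (hi : A.insert.regBound < 2 ^ w) (hd : A.delete.regBound < 2 ^ w)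
    (hq : A.query.regBound < 2 ^ w) (hR : R < 2 ^ w)
    (htime : ∀ t₀ ts, time ((List.range (2 ^ P.N₂)).flatMap P.block) t₀ ts → t₀ + ts.sum ≤ R)
    (hgraph : ∀ x < 2 ^ P.N₂, applyAll (P.graph fun _ => false) (P.upTo x) =
      P.graph fun c => decide (c < P.m) && P.bw x c)
    (hS : A.Succeeds α (P.graph fun _ => false) (P.finEdges false) time
      ((List.range (2 ^ P.N₂)).flatMap P.block) ω)
    (hS' : ∀ x < 2 ^ P.N₂, A.Succeeds α (P.graph fun _ => false) (P.finEdges false) time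
      (P.upTo x) ω) :
    ∃ s t, Exec w ω (mainCmd K D a pad false A.preprocess A.insert A.query
      (opsCmd K A.delete true) true) φ.initState s t ∧ t ≤ 20 * R + P.overhead ∧
        (s.reg 0 = 1 ↔ φ.Satisfiable) := by
  have hK : P.K = K := by rw [hP]; rfl
  have hst := hF.stages
  have ha : P.a = a := by rw [hP]; rfl
  obtain ⟨t₀, ts, s', ⟨r₀, he₀, hruns⟩, ht, -⟩ := hS
  have htR := htime _ _ ht
  obtain ⟨g, tl, rfl, rfl, hg, hsum⟩ := hruns.flatMap
  -- Stated for all `x`, with dummy values beyond the last stage, so that functions of `x` can be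
  -- chosen.
  have hstage (x : ℕ) : ∃ (f f' : ℕ → State) (τ τ' : ℕ → ℕ) (q : State) (τq : ℕ), f 0 = g x ∧
      (x < 2 ^ P.N₂ → (∀ c < P.m, if P.bw x c = true then
        Exec (A.wordLength (segs P.m (2 ^ P.N₁) P.pad * P.a + 1)) ω A.insert (passArgs P c (f c))
          (f (c + 1)) (τ c) else f (c + 1) = f c) ∧
        Exec (A.wordLength (segs P.m (2 ^ P.N₁) P.pad * P.a + 1)) ω A.query (f P.m) q τq ∧
        f' 0 = q ∧ f' P.m = g (x + 1) ∧ (∀ c < P.m, if P.bw x c = true then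
        Exec (A.wordLength (segs P.m (2 ^ P.N₁) P.pad * P.a + 1)) ω A.delete (passArgs P c (f' c))
          (f' (c + 1)) (τ' c) else f' (c + 1) = f' c) ∧
        (∃ ts₁, A.RunOps ω (g x) (opsList (fun c => P.bw x c = true) P.ins P.m ++ [.query]) ts₁ q) ∧
        (tl x).sum = ∑ c ∈ Finset.range P.m, τ c + τq + ∑ c ∈ Finset.range P.m, τ' c) := by
    by_cases hx : x < 2 ^ P.N₂
    · obtain ⟨ts₁, ts₂, s₁, e, h₁, h₂⟩ := (hg x hx).of_append
      obtain ⟨ts₃, ts₄, s₂, e', h₃, h₄⟩ := h₂.of_append (σ₁ := [.query])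
      obtain ⟨τq, rfl, hq⟩ := h₃.singleton
      obtain ⟨f, τ, k₁, k₂, k₃, k₄⟩ := h₁.steps
      obtain ⟨f', τ', l₁, l₂, l₃, l₄⟩ := h₄.steps
      refine ⟨f, f', τ, τ', s₂, τq, k₁, fun _ => ⟨fun c hc => ?_, k₂ ▸ hq, l₁, l₂, fun c hc => ?_,
        ⟨_, h₁.append h₃⟩, ?_⟩⟩
      · have := k₃ c hc
        rwa [passArgs_ins hc] at this
      · have := l₃ c hc
        rwa [passArgs_del hc] at this
      · rw [e, e', List.sum_append, List.sum_append, k₄, l₄, List.sum_singleton, add_assoc]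
    · exact ⟨fun _ => g x, fun _ => g x, fun _ => 0, fun _ => 0, g x, 0, rfl, fun h => absurd h hx⟩
  choose f f' τ τ' q τq hf₀ hrest using hstage
  have hstep {u u' : State} {T c : ℕ} {cmd : Cmd} {b : Bool} (h : if b = true then
      Exec (A.wordLength (segs P.m (2 ^ P.N₁) P.pad * P.a + 1)) ω cmd (passArgs P c u) u' T
      else u' = u) : u.used ≤ u'.used := by
    split_ifs at h
    · exact h.used_le.1
    · rw [h]
  have hfm (x : ℕ) (hx : x < 2 ^ P.N₂) (c : ℕ) (hc : c ≤ P.m) :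
      (f x c).used ≤ (f x P.m).used :=
    le_of_step (u := fun c => (f x c).used) (fun c hc => hstep ((hrest x hx).1 c hc)) hc
  have hfm' (x : ℕ) (hx : x < 2 ^ P.N₂) (c : ℕ) (hc : c ≤ P.m) :
      (f' x c).used ≤ (f' x P.m).used :=
    le_of_step (u := fun c => (f' x c).used)
      (fun c hc => hstep ((hrest x hx).2.2.2.2.1 c hc)) hc
  have hgR (x : ℕ) (hx : x ≤ 2 ^ P.N₂) : (g x).used ≤ R := by
    have h₁ : (g x).used ≤ (g (2 ^ P.N₂)).used :=
      le_of_step (u := fun x => (g x).used) (fun x hx => (hg x hx).used_le.1) hx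
    have h₂ := hruns.used_le.2
    have h₃ := he₀.used_le.2
    have h₄ : (initState (P.finEdges false)).used = 0 := rfl
    omega
  have hf'R (x : ℕ) (hx : x < 2 ^ P.N₂) (c : ℕ) (hc : c ≤ P.m) : (f' x c).used ≤ R := by
    have := hfm' x hx c hc
    rw [(hrest x hx).2.2.2.1] at this
    exact this.trans (hgR _ hx)
  have hqR (x : ℕ) (hx : x < 2 ^ P.N₂) : (q x).used ≤ R := by
    have := hf'R x hx 0 (Nat.zero_le _)
    rwa [(hrest x hx).2.2.1] at this
  have hfR (x : ℕ) (hx : x < 2 ^ P.N₂) (c : ℕ) (hc : c ≤ P.m) : (f x c).used ≤ R :=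
    (hfm x hx c hc).trans ((hrest x hx).2.1.used_le.1.trans (hqR x hx))
  have hans (x : ℕ) (hx : x < 2 ^ P.N₂) : P.Detects (q x) ↔ ∃ u < 2 ^ P.N₁, ∃ v < 2 ^ P.N₁,
      ∀ c < P.m, ¬ (P.bu u c ∧ P.bv v c ∧ P.bw x c) := by
    -- By determinism the run promised for this prefix is the beginning of the long run, so the
    -- correct answer is the one found in `q x`.
    obtain ⟨t₁, ts₁, s₁, ⟨r₁, he₁, hr₁⟩, -, hl⟩ := hS' x hx
    obtain ⟨rfl, -⟩ := he₀.det he₁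
    obtain ⟨ts₂, h₂⟩ := Algorithm.RunOps.of_flatMap (k := x) (blk := P.block)
      fun y hy => hg y (by omega)
    obtain ⟨ts₃, h₃⟩ := (hrest x hx).2.2.2.2.2.1
    obtain ⟨-, rfl⟩ := (h₂.append h₃).det hr₁
    have := hl .query (by simp [Params.upTo]) trivial
    rw [hgraph x hx] at this
    exact detects_iff hF.two_le hα (fun c hc => by simp [hc]) this
  -- There are no resets here: the stage number remains 2 throughout.
  refine (WP.mono (wp_mainCmd φ (B := R) (f := f) (q := q) (τ := τ) (τq := τq)
    (σ := fun _ => 2) (τf := fun x => 20 * (∑ c ∈ Finset.range P.m, τ' x c) +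
      P.m * (8 * P.K + 30) + 3) hP hF hw hc he₀ (hf₀ 0) rfl (fun _ _ => by omega)
    (fun x hx => (hrest x hx).1) (fun x hx => (hrest x hx).2.1) ?_ hp₀ hi hq hR hfR hqR) ?_)
  · intro x hx s hL h₂₂ h₅₀
    refine WP.mono (hK ▸ wp_opsCmd hF hw ((hrest x hx).2.2.1.symm ▸ hL) h₂₂ hx h₅₀ (by omega)
      (hrest x hx).2.2.2.2.1 hd hR (hf'R x hx)) ?_
    rintro s' t ⟨h₁, h₂, h₃⟩
    rw [show f' x P.m = f (x + 1) 0 by rw [hf₀, (hrest x hx).2.2.2.1]] at h₁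
    exact ⟨h₁, (h₂ 22 (by norm_num)).trans h₂₂, h₂ 53 (by norm_num),
      (h₂ 50 (by norm_num)).trans h₅₀, by rw [hK]; exact h₃⟩
  · rintro s t ⟨h₁, h₂⟩
    refine ⟨?_, h₁.trans ?_⟩
    · refine h₂.trans ?_
      have key : ∑ x ∈ Finset.range (2 ^ P.N₂), (20 * ∑ c ∈ Finset.range P.m, τ x c + 20 * τq x +
          (20 * (∑ c ∈ Finset.range P.m, τ' x c) + P.m * (8 * P.K + 30) + 3) +
          P.m * (8 * P.K + 30) + 2 ^ P.N₁ * 14 + 9) =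
          20 * ts.sum + 2 ^ P.N₂ * (2 * (P.m * (8 * P.K + 30) + 3) + 2 ^ P.N₁ * 14 + 6) := by
        have : ∑ x ∈ Finset.range (2 ^ P.N₂),
            (2 * (P.m * (8 * P.K + 30) + 3) + 2 ^ P.N₁ * 14 + 6) =
            2 ^ P.N₂ * (2 * (P.m * (8 * P.K + 30) + 3) + 2 ^ P.N₁ * 14 + 6) := by simp
        rw [← this, hsum, Finset.mul_sum, ← Finset.sum_add_distrib]
        refine Finset.sum_congr rfl fun x hx => ?_
        rw [(hrest x (Finset.mem_range.mp hx)).2.2.2.2.2.2]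
        ring
      rw [key]
      have := Nat.mul_le_mul_left (2 ^ P.N₂)
        (show 2 * (P.m * (8 * P.K + 30) + 3) + 2 ^ P.N₁ * 14 + 6 ≤
          2 * (P.m * (8 * P.K + 30) + 3) + 2 ^ P.N₁ * 14 + 9 by omega)
      unfold Params.overhead
      omega
    · rw [satisfiable_iff φ hP hN]
      exact exists_congr fun x => and_congr_right fun hx => hans x hx

end Full

section Monotone

variable {D a pad K N : ℕ}

/-- Every stage restarts from the state after preprocessing with the same coins, so it is a genuine
run on its own short sequence. Since `WorstCaseTime` bounds only the last operation, the time of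
each update is taken from the promise for the prefix that ends with it. -/
theorem exists_exec_monotone {Rp Ru Rq : ℕ} {p u q : ℕ → ℝ} {dec pol : Bool} {code : Cmd}
    {op : ℕ → Op (segs P.m (2 ^ P.N₁) P.pad * P.a + 1)} {T : ℕ → ℕ → Bool}
    (φ : KSat.Formula K N) (hP : P = params D a pad φ) (hN : 2 * P.N₁ + P.N₂ = N) (hF : Fits P w)
    (hw : A.wordLength (segs P.m (2 ^ P.N₁) P.pad * P.a + 1) ≤ w)
    (hc : K + D + 2 * N + 3 * a + pad + 4 < 2 ^ w)
    (hα : α * (3 * P.a + 3 : ℕ) < (5 * P.a : ℕ)) (hp₀ : A.preprocess.regBound < 2 ^ w)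
    (hcode : ∀ c, A.code (op c) = code) (hop : ∀ c, ¬ (op c).IsQuery)
    (hargs : ∀ c < P.m, ∀ s, (op c).passArgs s = passArgs P c s)
    (hi : code.regBound < 2 ^ w) (hq : A.query.regBound < 2 ^ w)
    (hR : Rp + 2 ^ P.N₂ * (P.m * Ru + Rq) < 2 ^ w)
    (hRp : ∀ t : ℕ, (t : ℝ) ≤ p (segs P.m (2 ^ P.N₁) P.pad * P.a + 1) → t ≤ Rp)
    (hRu : ∀ t : ℕ, (t : ℝ) ≤ u (segs P.m (2 ^ P.N₁) P.pad * P.a + 1) → t ≤ Ru)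
    (hRq : ∀ t : ℕ, (t : ℝ) ≤ q (segs P.m (2 ^ P.N₁) P.pad * P.a + 1) → t ≤ Rq)
    (hT : ∀ x < 2 ^ P.N₂, ∀ c < P.m, T x c = P.bw x c)
    (hgraph : ∀ x < 2 ^ P.N₂, applyAll (P.graph fun _ => dec)
      (opsList (fun c => P.bw x c = pol) op P.m ++ [.query]) = P.graph (T x))
    (hS : ∀ x < 2 ^ P.N₂, ∀ c ≤ P.m, A.Succeeds α (P.graph fun _ => dec) (P.finEdges dec)
      (WorstCaseTime p u q) (opsList (fun c => P.bw x c = pol) op c) ω)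
    (hS' : ∀ x < 2 ^ P.N₂, A.Succeeds α (P.graph fun _ => dec) (P.finEdges dec)
      (WorstCaseTime p u q) (opsList (fun c => P.bw x c = pol) op P.m ++ [.query]) ω) :
    ∃ s t, Exec w ω (mainCmd K D a pad dec A.preprocess code A.query resetCmd pol) φ.initState s t ∧
      t ≤ 20 * (Rp + 2 ^ P.N₂ * (P.m * Ru + Rq)) + P.overhead ∧
        (s.reg 0 = 1 ↔ φ.Satisfiable) := by
  have hst := hF.stages
  have hpos : 0 < 2 ^ P.N₂ := by positivity
  obtain ⟨T₀, -, -, ⟨r₀, he₀, -⟩, ⟨hT₀, -⟩, -⟩ := hS 0 hpos 0 (Nat.zero_le _)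
  have hstage (x : ℕ) : ∃ (f : ℕ → State) (τ : ℕ → ℕ) (r : State) (τq : ℕ), f 0 = r₀ ∧
      (x < 2 ^ P.N₂ → (∀ c < P.m, if P.bw x c = pol then
        Exec (A.wordLength (segs P.m (2 ^ P.N₁) P.pad * P.a + 1)) ω code (passArgs P c (f c))
          (f (c + 1)) (τ c) else f (c + 1) = f c) ∧ (∀ c < P.m, τ c ≤ Ru) ∧
        Exec (A.wordLength (segs P.m (2 ^ P.N₁) P.pad * P.a + 1)) ω A.query (f P.m) r τq ∧
        τq ≤ Rq ∧ (P.Detects r ↔ ∃ u < 2 ^ P.N₁, ∃ v < 2 ^ P.N₁,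
          ∀ c < P.m, ¬ (P.bu u c ∧ P.bv v c ∧ P.bw x c))) := by
    by_cases hx : x < 2 ^ P.N₂
    · obtain ⟨T₁, ts, r, ⟨r₁, he₁, hr⟩, ht, hl⟩ := hS' x hx
      obtain ⟨rfl, -⟩ := he₀.det he₁
      obtain ⟨ts₁, ts₂, s₁, rfl, h₁, h₂⟩ := hr.of_append
      obtain ⟨τq, rfl, hq⟩ := h₂.singleton
      obtain ⟨f, τ, k₁, k₂, k₃, -⟩ := h₁.steps
      -- Coordinates without an update are assigned time 0, so that the bound by `Ru` holds for all
      -- of them.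
      refine ⟨f, fun c => if P.bw x c = pol then τ c else 0, r, τq, k₁,
        fun _ => ⟨fun c hc => ?_, fun c hc => ?_, k₂ ▸ hq, ?_, ?_⟩⟩
      · have := k₃ c hc
        rw [hargs c hc, hcode] at this
        dsimp only
        split_ifs at this ⊢
        · exact this
        · exact this
      · dsimp only
        split_ifs with hb
        -- The first `c + 1` coordinates give a sequence whose last operation is the update at `c`;
        -- determinism shows that its last time is `τ c`.
        · obtain ⟨T₂, ts', r', ⟨r₂, he₂, hr'⟩, ⟨-, ht'⟩, -⟩ := hS x hx (c + 1) hc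
          obtain ⟨rfl, -⟩ := he₀.det he₂
          obtain ⟨ts₃, h₃⟩ := Algorithm.RunOps.of_steps (p := fun c => P.bw x c = pol) (op := op)
            (m := c) fun d hd => k₃ d (by omega)
          have h₄ := k₃ c hc
          rw [if_pos hb] at h₄
          rw [opsList_succ, if_pos hb] at hr' ht'
          obtain ⟨rfl, -⟩ := (h₃.append (.cons h₄ (.nil _))).det (k₁.symm ▸ hr')
          exact hRu _ ((ht' (op c) (by simp) (τ c) (by simp)).1 (hop c))
        · exact Nat.zero_le _
      · exact hRq _ ((ht.2 .query (by simp) τq (by simp)).2 trivial)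
      · have := hl .query (by simp) trivial
        rw [hgraph x hx] at this
        exact detects_iff hF.two_le hα (hT x hx) this
    · exact ⟨fun _ => r₀, fun _ => 0, r₀, 0, rfl, fun h => absurd h hx⟩
  choose f τ r τq hf₀ hrest using hstage
  -- The coins needed for preprocessing and a single stage are enough, because they are replayed in
  -- each stage.
  set B := Rp + (P.m * Ru + Rq) with hB
  have hBw : B < 2 ^ w := by
    have := Nat.le_mul_of_pos_left (P.m * Ru + Rq) hpos
    omega
  have hr₀ : r₀.used ≤ Rp := by
    have h₃ := he₀.used_le.2
    have h₄ : (initState (P.finEdges dec)).used = 0 := rfl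
    have := hRp _ hT₀
    omega
  have hfR (x : ℕ) (hx : x < 2 ^ P.N₂) (c : ℕ) (hc : c ≤ P.m) : (f x c).used ≤ Rp + c * Ru := by
    induction c with
    | zero => rw [hf₀]; omega
    | succ c ih =>
      have h₁ := ih (by omega)
      have h₂ := (hrest x hx).1 c hc
      have h₃ := (hrest x hx).2.1 c hc
      rw [add_mul]
      split_ifs at h₂
      · have : (f x (c + 1)).used ≤ (f x c).used + τ x c := h₂.used_le.2
        omega
      · rw [h₂]; omega
  have hqR (x : ℕ) (hx : x < 2 ^ P.N₂) : (r x).used ≤ B := by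
    have h₁ := hfR x hx P.m le_rfl
    have h₂ := (hrest x hx).2.2.1.used_le.2
    have h₃ := (hrest x hx).2.2.2.1
    omega
  have hfB (x : ℕ) (hx : x < 2 ^ P.N₂) (c : ℕ) (hc : c ≤ P.m) : (f x c).used ≤ B := by
    have h₁ := hfR x hx c hc
    have h₂ := Nat.mul_le_mul_right Ru hc
    omega
  refine (WP.mono (wp_mainCmd φ (B := B) (f := f) (q := r) (τ := τ) (τq := τq)
    (σ := fun x => 2 + x) (τf := fun _ => 2) hP hF hw hc he₀ (hf₀ 0) rfl (fun _ _ => by omega)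
    (fun x hx => (hrest x hx).1) (fun x hx => (hrest x hx).2.2.1) ?_ hp₀ hi hq hBw hfB hqR) ?_)
  · intro x hx s hL h₂₂ h₅₀
    refine WP.mono (wp_resetCmd hL.env hL.rep hL.snap (by rw [h₅₀]; omega) (by omega)) ?_
    rintro s' t ⟨h₁, h₂, h₃, h₄, h₅, h₆, h₇, h₈⟩
    refine ⟨⟨h₁, (hf₀ _).symm ▸ h₂, h₃, h₇ ▸ hL.used⟩, h₅.trans h₂₂, h₆, ?_, h₈.le⟩
    rw [h₄, h₅₀, add_assoc]
  · rintro s t ⟨h₁, h₂⟩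
    refine ⟨?_, h₁.trans ?_⟩
    · refine h₂.trans ?_
      have key : ∑ x ∈ Finset.range (2 ^ P.N₂), (20 * ∑ c ∈ Finset.range P.m, τ x c + 20 * τq x +
          2 + P.m * (8 * P.K + 30) + 2 ^ P.N₁ * 14 + 9) ≤ 2 ^ P.N₂ * (20 * (P.m * Ru + Rq) +
            (2 * (P.m * (8 * P.K + 30) + 3) + 2 ^ P.N₁ * 14 + 9)) := by
        refine (Finset.sum_le_card_nsmul _ _ (20 * (P.m * Ru + Rq) +
            (2 * (P.m * (8 * P.K + 30) + 3) + 2 ^ P.N₁ * 14 + 9)) fun x hx => ?_).trans (by simp)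
        have hx := Finset.mem_range.mp hx
        have h₃ := (hrest x hx).2.2.2.1
        have h₄ : ∑ c ∈ Finset.range P.m, τ x c ≤ P.m * Ru := by
          refine (Finset.sum_le_card_nsmul _ _ Ru fun c hc =>
            (hrest x hx).2.1 c (Finset.mem_range.mp hc)).trans (by simp)
        omega
      have hT := hRp _ hT₀
      have e (x y z : ℕ) : x * (20 * y + z) = 20 * (x * y) + x * z := by ring
      rw [e] at key
      unfold Params.overhead
      omega
    · rw [satisfiable_iff φ hP hN]
      exact exists_congr fun x => and_congr_right fun hx => (hrest x hx).2.2.2.2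

end Monotone

end Reduction

namespace Reduction

open WordRAM DynGraph MeasureTheory

variable {P : Params}

/-! ### The sequences of operations are legal -/

theorem graph_good (ha : 2 ≤ P.a) (T : ℕ → Bool) : (P.graph T).Connected ∧
    (P.graph T).edgeSet.ncard ≤ 2 * (segs P.m (2 ^ P.N₁) P.pad * P.a + 1) :=
  ⟨stageGraph_connected ha, stageGraph_ncard_le ha⟩

theorem legal_query (ha : 2 ≤ P.a) (T : ℕ → Bool) : Legal 2 (P.graph T) [.query] :=
  ⟨graph_good ha T, trivial, graph_good ha T⟩

theorem legal_ins (ha : 2 ≤ P.a) (x : ℕ) {k : ℕ} (hk : k ≤ P.m) :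
    Legal 2 (P.graph fun _ => false) (opsList (fun c => P.bw x c = true) P.ins k) ∧
    applyAll (P.graph fun _ => false) (opsList (fun c => P.bw x c = true) P.ins k) =
      P.graph fun c => decide (c < k) && P.bw x c := by
  have h := Legal.opsList (C := 2) (p := fun c => P.bw x c = true) (op := P.ins) (m := k)
    (H := fun k => P.graph fun c => decide (c < k) && P.bw x c) (fun _ => graph_good ha _)
    fun c hc => by
      split_ifs with hb
      · have h := stageGraph_insert (a := P.a) (pad := P.pad) (M := 2 ^ P.N₁) (bu := P.bu)
          (bv := P.bv) (T := fun i => decide (i < c) && P.bw x i) ha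
          (show c < P.m by omega) (by simp)
        refine ⟨h.1, h.2.trans (congrArg P.graph (funext fun i => ?_))⟩
        rw [Function.update_apply]
        split_ifs with hi
        · simp [hi, hb]
        · simp [show i < c + 1 ↔ i < c by omega]
      · refine congrArg P.graph (funext fun i => ?_)
        by_cases hi : i = c
        · simp [hi, hb]
        · simp [show i < c + 1 ↔ i < c by omega]
  simpa using h

theorem legal_del (ha : 2 ≤ P.a) (x : ℕ) :
    Legal 2 (P.graph fun c => decide (c < P.m) && P.bw x c)
      (opsList (fun c => P.bw x c = true) P.del P.m) ∧
    applyAll (P.graph fun c => decide (c < P.m) && P.bw x c)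
      (opsList (fun c => P.bw x c = true) P.del P.m) = P.graph fun _ => false := by
  have h := Legal.opsList (C := 2) (p := fun c => P.bw x c = true) (op := P.del) (m := P.m)
    (H := fun k => P.graph fun c => decide (k ≤ c) && (decide (c < P.m) && P.bw x c))
    (fun _ => graph_good ha _) fun c hc => by
      split_ifs with hb
      · have h := stageGraph_delete (a := P.a) (pad := P.pad) (M := 2 ^ P.N₁) (bu := P.bu)
          (bv := P.bv) (T := fun i => decide (c ≤ i) && (decide (i < P.m) && P.bw x i)) ha
          hc (by simp [hc, hb])
        refine ⟨h.1, h.2.trans (congrArg P.graph (funext fun i => ?_))⟩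
        rw [Function.update_apply]
        split_ifs with hi
        · simp [hi]
        · simp [show c + 1 ≤ i ↔ c ≤ i by omega]
      · refine congrArg P.graph (funext fun i => ?_)
        by_cases hi : i = c
        · simp [hi, hb]
        · simp [show c + 1 ≤ i ↔ c ≤ i by omega]
  -- The bits from `m` on are kept false during the stage, so that the description of the initial
  -- graph is recovered exactly.
  have e : (fun c => decide (P.m ≤ c) && (decide (c < P.m) && P.bw x c)) = fun _ => false := by
    funext c
    by_cases hc : c < P.m <;> simp [hc]
  rw [e] at h
  simpa using h

theorem legal_del_of_full (ha : 2 ≤ P.a) (x : ℕ) {k : ℕ} (hk : k ≤ P.m) :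
    Legal 2 (P.graph fun _ => true) (opsList (fun c => P.bw x c = false) P.del k) ∧
    applyAll (P.graph fun _ => true) (opsList (fun c => P.bw x c = false) P.del k) =
      P.graph fun c => decide (k ≤ c) || P.bw x c := by
  have h := Legal.opsList (C := 2) (p := fun c => P.bw x c = false) (op := P.del) (m := k)
    (H := fun k => P.graph fun c => decide (k ≤ c) || P.bw x c)
    (fun _ => graph_good ha _) fun c hc => by
      split_ifs with hb
      · have h := stageGraph_delete (a := P.a) (pad := P.pad) (M := 2 ^ P.N₁) (bu := P.bu)
          (bv := P.bv) (T := fun i => decide (c ≤ i) || P.bw x i) ha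
          (show c < P.m by omega) (by simp)
        refine ⟨h.1, h.2.trans (congrArg P.graph (funext fun i => ?_))⟩
        rw [Function.update_apply]
        split_ifs with hi
        · simp [hi, hb]
        · simp [show c + 1 ≤ i ↔ c ≤ i by omega]
      · refine congrArg P.graph (funext fun i => ?_)
        by_cases hi : i = c
        · simp [hi, hb]
        · simp [show c + 1 ≤ i ↔ c ≤ i by omega]
  simpa using h

theorem legal_block (ha : 2 ≤ P.a) (x : ℕ) : Legal 2 (P.graph fun _ => false) (P.block x) ∧
    applyAll (P.graph fun _ => false) (P.block x) = P.graph fun _ => false := by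
  obtain ⟨h₁, h₂⟩ := legal_ins ha x le_rfl
  obtain ⟨h₃, h₄⟩ := legal_del ha x
  refine ⟨h₁.append ?_, ?_⟩
  · rw [h₂]
    exact ⟨graph_good ha _, trivial, h₃⟩
  · rw [Params.block, applyAll_append, h₂]
    exact h₄

theorem legal_blocks (ha : 2 ≤ P.a) (k : ℕ) :
    Legal 2 (P.graph fun _ => false) ((List.range k).flatMap P.block) ∧
    applyAll (P.graph fun _ => false) ((List.range k).flatMap P.block) = P.graph fun _ => false :=
  Legal.flatMap (H := fun _ => P.graph fun _ => false) (graph_good ha _) fun x _ => legal_block ha x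

theorem legal_upTo (ha : 2 ≤ P.a) (x : ℕ) : Legal 2 (P.graph fun _ => false) (P.upTo x) ∧
    applyAll (P.graph fun _ => false) (P.upTo x) =
      P.graph fun c => decide (c < P.m) && P.bw x c := by
  obtain ⟨h₁, h₂⟩ := legal_ins ha x le_rfl
  obtain ⟨h₃, h₄⟩ := legal_blocks ha x
  refine ⟨h₃.append ?_, ?_⟩
  · rw [h₄]
    refine h₁.append ?_
    rw [h₂]
    exact legal_query ha _
  · rw [Params.upTo, applyAll_append, applyAll_append, h₄, h₂]
    rfl

theorem length_block_le (x : ℕ) : (P.block x).length ≤ 2 * P.m + 1 := by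
  have h₁ := length_opsList_le (p := fun c => P.bw x c = true) (op := P.ins) (m := P.m)
  have h₂ := length_opsList_le (p := fun c => P.bw x c = true) (op := P.del) (m := P.m)
  rw [Params.block, List.length_append, List.length_cons]
  omega

theorem length_blocks_le (k : ℕ) :
    ((List.range k).flatMap P.block).length ≤ k * (2 * P.m + 1) := by
  induction k with
  | zero => simp
  | succ k ih =>
    have := length_block_le (P := P) k
    rw [List.range_succ, List.flatMap_append, List.flatMap_singleton, List.length_append, add_mul]
    omega

theorem length_upTo_le {x k : ℕ} (hx : x < k) : (P.upTo x).length ≤ k * (2 * P.m + 1) := by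
  have h₁ := length_opsList_le (p := fun c => P.bw x c = true) (op := P.ins) (m := P.m)
  have h₂ := length_blocks_le (P := P) x
  have h₃ := Nat.mul_le_mul_right (2 * P.m + 1) (show x + 1 ≤ k from hx)
  rw [Params.upTo, List.length_append, List.length_append, List.length_singleton]
  rw [add_mul] at h₃
  omega

theorem presents_finEdges (ha : 2 ≤ P.a) (dec : Bool) :
    Presents (P.finEdges dec) (P.graph fun _ => dec) :=
  SegGraph.presents (wf ha)

/-! ### The failure probability -/

/-- Union bound over finitely many fixed sequences; since they share their coins, nothing better
than subadditivity is available or needed. -/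
theorem coinMeasure_le {ι β : Type*} {n c : ℕ} {I : Finset ι} {σ : ι → β}
    {S : β → (ℕ → Bool) → Prop} (hn : 0 < n)
    (h : ∀ i ∈ I, coinMeasure {ω | ¬ S (σ i) ω} ≤ ENNReal.ofReal (1 / (n : ℝ) ^ c))
    (hcard : 3 * I.card ≤ n ^ c) {F : Set (ℕ → Bool)}
    (hF : ∀ ω, (∀ i ∈ I, S (σ i) ω) → ω ∉ F) : coinMeasure F ≤ 1 / 3 := by
  have hsub : F ⊆ ⋃ i ∈ I, {ω | ¬ S (σ i) ω} := by
    intro ω hω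
    by_contra hn
    refine hF ω (fun i hi => ?_) hω
    by_contra h'
    exact hn (Set.mem_biUnion hi h')
  have hpos : (0 : ℝ) < (n : ℝ) ^ c := by positivity
  calc coinMeasure F ≤ ∑ i ∈ I, coinMeasure {ω | ¬ S (σ i) ω} :=
        (measure_mono hsub).trans (measure_biUnion_finset_le _ _)
    _ ≤ ∑ _i ∈ I, ENNReal.ofReal (1 / (n : ℝ) ^ c) := Finset.sum_le_sum h
    _ = ENNReal.ofReal (I.card * (1 / (n : ℝ) ^ c)) := by
        rw [Finset.sum_const, nsmul_eq_mul, ENNReal.ofReal_mul (by positivity),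
          ENNReal.ofReal_natCast]
    _ ≤ ENNReal.ofReal (1 / 3) := by
        refine ENNReal.ofReal_le_ofReal ?_
        have : (3 * I.card : ℝ) ≤ (n : ℝ) ^ c := by exact_mod_cast hcard
        rw [mul_one_div, div_le_div_iff₀ hpos (by norm_num)]
        linarith
    _ = 1 / 3 := by
        rw [ENNReal.ofReal_div_of_pos (by norm_num)]
        simp

end Reduction

namespace Reduction

open WordRAM DynGraph

/-! ## Sizes and running times -/

/-- Clauses are distinct, so their number is polynomial in `N` for fixed width. -/
theorem length_clauses_le {K N : ℕ} (φ : KSat.Formula K N) :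
    φ.clauses.length ≤ 2 ^ K * (N + 1) ^ K := by
  refine φ.nodup.length_le_card.trans ?_
  rw [Fintype.card_fun, Fintype.card_prod, Fintype.card_fin, Fintype.card_fin, Fintype.card_bool,
    mul_comm, mul_pow]
  exact Nat.mul_le_mul_left _ (Nat.pow_le_pow_left (by omega) _)

/-- The constant factor in the bound for the number of vertices. -/
def sizeConst (K a pad : ℕ) : ℕ := (2 ^ K + 2 + pad) * (2 ^ K + 4) * a + 1

theorem params_n_le {K N : ℕ} (D a pad : ℕ) (φ : KSat.Formula K N) :
    (params D a pad φ).n ≤ 2 ^ (N / D) * (sizeConst K a pad * (N + 1) ^ (2 * K)) := by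
  have hm := length_clauses_le φ
  have hZ : 1 ≤ (N + 1) ^ K := Nat.one_le_pow _ _ (by omega)
  have hM : 1 ≤ 2 ^ (N / D) := Nat.one_le_pow _ _ (by omega)
  have hZ2 : (N + 1) ^ (2 * K) = (N + 1) ^ K * (N + 1) ^ K := by rw [two_mul, pow_add]
  rw [hZ2]
  change (φ.clauses.length + 2 * 2 ^ (N / D) + pad) * (φ.clauses.length + 4) * a + 1 ≤ _
  generalize φ.clauses.length = m at hm ⊢
  generalize (N + 1) ^ K = Z at hm hZ ⊢
  generalize 2 ^ (N / D) = M at hM ⊢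
  have h₁ : m + 2 * M + pad ≤ M * Z * (2 ^ K + 2 + pad) := by
    have e₁ : 1 ≤ M * Z := Nat.mul_pos hM hZ
    have e₂ : m ≤ M * Z * 2 ^ K := hm.trans (by
      rw [mul_comm (M * Z)]
      exact Nat.mul_le_mul_left _ (Nat.le_mul_of_pos_left _ hM))
    have e₃ : M * 2 ≤ M * Z * 2 := Nat.mul_le_mul_right _ (Nat.le_mul_of_pos_right _ hZ)
    have e₄ : pad ≤ M * Z * pad := Nat.le_mul_of_pos_left _ e₁
    rw [mul_add, mul_add]
    omega
  have h₂ : m + 4 ≤ Z * (2 ^ K + 4) := by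
    rw [mul_add, mul_comm Z (2 ^ K)]
    omega
  have h₃ : 1 ≤ M * (Z * Z) := Nat.mul_pos hM (Nat.mul_pos hZ hZ)
  calc (m + 2 * M + pad) * (m + 4) * a + 1
      ≤ (M * Z * (2 ^ K + 2 + pad)) * (Z * (2 ^ K + 4)) * a + M * (Z * Z) :=
        add_le_add (Nat.mul_le_mul_right _ (Nat.mul_le_mul h₁ h₂)) h₃
    _ = M * (sizeConst K a pad * (Z * Z)) := by unfold sizeConst; ring

/-- The decisive count: `N₂ + (2 - e) * N₁ = N - e * N₁`, and `N₁` is `N / D` up to rounding.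
Rounding costs at most `2 ^ e ≤ 2`; `y` collects the polynomial factors. -/
theorem rpow_size_le {n N N₁ N₂ D : ℕ} {y e : ℝ} (hn : (n : ℝ) ≤ 2 ^ N₁ * y) (hy : 1 ≤ y)
    (he : 0 < e) (he' : e ≤ 1) (hN : 2 * N₁ + N₂ = N) (hD : N < D * (N₁ + 1)) :
    (2 : ℝ) ^ N₂ * (n : ℝ) ^ (2 - e) ≤ 2 * y ^ 2 * (2 : ℝ) ^ ((1 - e / D) * (N : ℝ)) := by
  have hD0 : (0 : ℝ) < D := by
    rcases Nat.eq_zero_or_pos D with rfl | h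
    · simp at hD
    · exact_mod_cast h
  have h₁ : (n : ℝ) ^ (2 - e) ≤ (2 : ℝ) ^ ((N₁ : ℝ) * (2 - e)) * y ^ 2 := by
    calc (n : ℝ) ^ (2 - e) ≤ (2 ^ N₁ * y) ^ (2 - e) :=
          Real.rpow_le_rpow (Nat.cast_nonneg n) hn (by linarith)
      _ = (2 : ℝ) ^ ((N₁ : ℝ) * (2 - e)) * y ^ (2 - e) := by
          rw [Real.mul_rpow (by positivity) (by linarith), ← Real.rpow_natCast 2 N₁,
            ← Real.rpow_mul (by norm_num)]
      _ ≤ _ := by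
          refine mul_le_mul_of_nonneg_left ?_ (by positivity)
          rw [← Real.rpow_natCast y 2]
          exact Real.rpow_le_rpow_of_exponent_le hy (by push_cast; linarith)
  have h₂ : (2 : ℝ) ^ N₂ * (2 : ℝ) ^ ((N₁ : ℝ) * (2 - e)) ≤
      2 * (2 : ℝ) ^ ((1 - e / D) * (N : ℝ)) := by
    have hN' : (2 : ℝ) * N₁ + N₂ = N := by exact_mod_cast hN
    have hlt : (N : ℝ) ≤ D * (N₁ + 1) := by exact_mod_cast hD.le
    have h₃ : e / D * N ≤ e * (N₁ + 1) := by
      rw [div_mul_eq_mul_div, div_le_iff₀ hD0]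
      nlinarith
    calc (2 : ℝ) ^ N₂ * (2 : ℝ) ^ ((N₁ : ℝ) * (2 - e))
        = (2 : ℝ) ^ ((N₂ : ℝ) + (N₁ : ℝ) * (2 - e)) := by
          rw [Real.rpow_add (by norm_num), Real.rpow_natCast]
      _ ≤ (2 : ℝ) ^ (1 + (1 - e / D) * (N : ℝ)) := by
          refine Real.rpow_le_rpow_of_exponent_le (by norm_num) ?_
          nlinarith
      _ = _ := by rw [Real.rpow_add (by norm_num), Real.rpow_one]
  calc (2 : ℝ) ^ N₂ * (n : ℝ) ^ (2 - e)
      ≤ (2 : ℝ) ^ N₂ * ((2 : ℝ) ^ ((N₁ : ℝ) * (2 - e)) * y ^ 2) :=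
        mul_le_mul_of_nonneg_left h₁ (by positivity)
    _ = ((2 : ℝ) ^ N₂ * (2 : ℝ) ^ ((N₁ : ℝ) * (2 - e))) * y ^ 2 := by ring
    _ ≤ (2 * (2 : ℝ) ^ ((1 - e / D) * (N : ℝ))) * y ^ 2 :=
        mul_le_mul_of_nonneg_right h₂ (by positivity)
    _ = _ := by ring

/-- Preprocessing happens once and costs about `2 ^ (t * N / D)`; the choice `t + e ≤ D` makes this
small enough. -/
theorem rpow_preprocessing_le {n N N₁ D : ℕ} {y e t : ℝ} (hn : (n : ℝ) ≤ 2 ^ N₁ * y) (hy : 1 ≤ y)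
    (ht : 0 < t) (hte : t + e ≤ D) (he : 0 < e) (hD : N₁ * D ≤ N) :
    (n : ℝ) ^ t ≤ y ^ ⌈t⌉₊ * (2 : ℝ) ^ ((1 - e / D) * (N : ℝ)) := by
  have hD0 : (0 : ℝ) < D := by linarith
  calc (n : ℝ) ^ t ≤ (2 ^ N₁ * y) ^ t := Real.rpow_le_rpow (Nat.cast_nonneg n) hn ht.le
    _ = y ^ t * (2 : ℝ) ^ ((N₁ : ℝ) * t) := by
        rw [Real.mul_rpow (by positivity) (by linarith), ← Real.rpow_natCast 2 N₁,
          ← Real.rpow_mul (by norm_num), mul_comm]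
    _ ≤ y ^ ⌈t⌉₊ * (2 : ℝ) ^ ((1 - e / D) * (N : ℝ)) := by
        refine mul_le_mul ?_ (Real.rpow_le_rpow_of_exponent_le (by norm_num) ?_) (by positivity)
          (by positivity)
        · rw [← Real.rpow_natCast]
          exact Real.rpow_le_rpow_of_exponent_le hy (Nat.le_ceil t)
        · have h : (N₁ : ℝ) * D ≤ N := by exact_mod_cast hD
          have h₁ : (N₁ : ℝ) ≤ N / D := by rwa [le_div_iff₀ hD0]
          have h₂ : t ≤ D - e := by linarith
          calc (N₁ : ℝ) * t ≤ N / D * (D - e) := by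
                exact mul_le_mul h₁ h₂ ht.le (by positivity)
            _ = (1 - e / D) * N := by field_simp

/-- The cost of running the dynamic algorithm in all stages. -/
noncomputable def Params.cost (P : Params) (t e : ℝ) : ℝ :=
  (P.m + 1) * (2 ^ P.N₂ * (P.n : ℝ) ^ (2 - e)) + (P.n : ℝ) ^ t

theorem params_split {K N D a pad : ℕ} (hD : 2 ≤ D) (φ : KSat.Formula K N) :
    2 * (params D a pad φ).N₁ + (params D a pad φ).N₂ = N := by
  have h : N / D * 2 ≤ N := (Nat.mul_le_mul_left _ hD).trans (Nat.div_mul_le_self _ _)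
  simp only [params]
  omega

theorem cost_le {K D a pad : ℕ} {t e c₀ : ℝ} (hD : 2 ≤ D) (ht : 0 < t) (he : 0 < e) (he' : e ≤ 1)
    (hte : t + e ≤ D) : ∃ C k : ℕ, ∀ (N : ℕ) (φ : KSat.Formula K N),
      c₀ * (params D a pad φ).cost t e ≤
        (2 : ℝ) ^ ((1 - e / D) * (N : ℝ)) * (C * ((N : ℝ) + 1) ^ k) := by
  set c₁ := sizeConst K a pad with hc₁
  -- The number of clauses contributes degree `K` and `y` has degree `2 * K`: hence `K + 2 * (2 *
  -- K)` for the stages, `2 * K * ⌈t⌉₊` for preprocessing, and their sum dominates both.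
  refine ⟨⌈c₀⌉₊ * ((2 ^ K + 1) * (2 * c₁ ^ 2) + c₁ ^ ⌈t⌉₊), 5 * K + 2 * K * ⌈t⌉₊, fun N φ => ?_⟩
  set P := params D a pad φ with hP
  set y : ℝ := c₁ * ((N : ℝ) + 1) ^ (2 * K) with hy
  set E : ℝ := (2 : ℝ) ^ ((1 - e / D) * (N : ℝ)) with hE
  have hE0 : 0 ≤ E := by positivity
  have hx : (1 : ℝ) ≤ (N : ℝ) + 1 := by linarith [(Nat.cast_nonneg N : (0 : ℝ) ≤ N)]
  have hc1 : (1 : ℝ) ≤ c₁ := by exact_mod_cast (show 1 ≤ sizeConst K a pad by unfold sizeConst; omega)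
  have hy1 : 1 ≤ y := one_le_mul_of_one_le_of_one_le hc1 (one_le_pow₀ hx)
  have hn : (P.n : ℝ) ≤ 2 ^ P.N₁ * y := by
    have := params_n_le D a pad φ
    rw [hy]
    exact_mod_cast this
  have hDlt : N < D * (P.N₁ + 1) := by
    rw [mul_add, mul_one]
    exact Nat.lt_mul_div_succ N (by omega)
  have h₁ := rpow_size_le hn hy1 he he' (params_split hD φ) hDlt
  have h₂ := rpow_preprocessing_le hn hy1 ht hte he (Nat.div_mul_le_self N D)
  have hm : (P.m : ℝ) + 1 ≤ (2 ^ K + 1) * ((N : ℝ) + 1) ^ K := by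
    have h : (P.m : ℝ) ≤ 2 ^ K * ((N : ℝ) + 1) ^ K := by exact_mod_cast length_clauses_le φ
    have := one_le_pow₀ hx (n := K)
    linarith
  have h₃ : P.cost t e ≤ ((2 ^ K + 1) * ((N : ℝ) + 1) ^ K * (2 * y ^ 2) + y ^ ⌈t⌉₊) * E := by
    calc P.cost t e ≤ (2 ^ K + 1) * ((N : ℝ) + 1) ^ K * (2 * y ^ 2 * E) + y ^ ⌈t⌉₊ * E :=
          add_le_add (mul_le_mul hm h₁ (by positivity) (by positivity)) h₂
      _ = _ := by ring
  have h₄ : (2 ^ K + 1) * ((N : ℝ) + 1) ^ K * (2 * y ^ 2) + y ^ ⌈t⌉₊ ≤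
      ((2 ^ K + 1) * (2 * c₁ ^ 2) + c₁ ^ ⌈t⌉₊) * ((N : ℝ) + 1) ^ (5 * K + 2 * K * ⌈t⌉₊) := by
    have e₁ : (2 ^ K + 1) * ((N : ℝ) + 1) ^ K * (2 * y ^ 2) =
        ((2 ^ K + 1) * (2 * c₁ ^ 2)) * ((N : ℝ) + 1) ^ (5 * K) := by
      rw [hy, mul_pow, ← pow_mul, show 5 * K = K + 2 * K * 2 by ring, pow_add]
      ring
    have e₂ : y ^ ⌈t⌉₊ = c₁ ^ ⌈t⌉₊ * ((N : ℝ) + 1) ^ (2 * K * ⌈t⌉₊) := by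
      rw [hy, mul_pow, ← pow_mul]
    rw [e₁, e₂]
    refine (add_le_add (mul_le_mul_of_nonneg_left (pow_le_pow_right₀ hx ?_) (by positivity))
      (mul_le_mul_of_nonneg_left (pow_le_pow_right₀ hx ?_) (by positivity))).trans_eq
        (add_mul _ _ _).symm <;> omega
  calc c₀ * P.cost t e
      ≤ ⌈c₀⌉₊ * ((((2 ^ K + 1) * (2 * c₁ ^ 2) + c₁ ^ ⌈t⌉₊) *
          ((N : ℝ) + 1) ^ (5 * K + 2 * K * ⌈t⌉₊)) * E) :=
        mul_le_mul (Nat.le_ceil c₀) (h₃.trans (mul_le_mul_of_nonneg_right h₄ hE0))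
          (by unfold Params.cost; positivity) (by positivity)
    _ = _ := by push_cast; ring

/-- The time bound itself fits into a word of linear length; the other size conditions on words are
derived from this. -/
theorem bound_lt {C k D : ℕ} {e : ℝ} (he : 0 < e) (N : ℕ) :
    (2 : ℝ) ^ ((1 - e / D) * (N : ℝ)) * (C * ((N : ℝ) + 1) ^ k) < 2 ^ ((1 + C + k) * (N + 1)) := by
  have h₁ : (2 : ℝ) ^ ((1 - e / D) * (N : ℝ)) ≤ 2 ^ (N + 1) := by
    rw [← Real.rpow_natCast]
    refine Real.rpow_le_rpow_of_exponent_le (by norm_num) ?_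
    push_cast
    have : 0 ≤ e / D * N := by positivity
    linarith
  have h₂ : (C : ℝ) < 2 ^ (C * (N + 1)) := by
    have : C < 2 ^ (C * (N + 1)) :=
      Nat.lt_two_pow_self.trans_le (Nat.pow_le_pow_right (by norm_num) (by nlinarith))
    exact_mod_cast this
  have h₃ : ((N : ℝ) + 1) ^ k ≤ 2 ^ (k * (N + 1)) := by
    rw [mul_comm, pow_mul]
    refine pow_le_pow_left₀ (by positivity) ?_ _
    have : N + 1 ≤ 2 ^ (N + 1) := Nat.lt_two_pow_self.le
    exact_mod_cast this
  have h₄ : (0 : ℝ) < ((N : ℝ) + 1) ^ k := by positivity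
  have h₅ : C * ((N : ℝ) + 1) ^ k < 2 ^ (C * (N + 1)) * 2 ^ (k * (N + 1)) :=
    mul_lt_mul h₂ h₃ h₄ (by positivity)
  calc (2 : ℝ) ^ ((1 - e / D) * (N : ℝ)) * (C * ((N : ℝ) + 1) ^ k)
      ≤ 2 ^ (N + 1) * (C * ((N : ℝ) + 1) ^ k) := mul_le_mul_of_nonneg_right h₁ (by positivity)
    _ < 2 ^ (N + 1) * (2 ^ (C * (N + 1)) * 2 ^ (k * (N + 1))) :=
        mul_lt_mul_of_pos_left h₅ (by positivity)
    _ = 2 ^ ((1 + C + k) * (N + 1)) := by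
        rw [← pow_add, ← pow_add]
        congr 1
        ring

variable {P : Params}

theorem Params.le_n (ha : 2 ≤ P.a) :
    (P.m + 2 * 2 ^ P.N₁ + P.pad) * (P.m + 4) * 2 ≤ P.n ∧
    8 * (P.m + 2 * 2 ^ P.N₁ + P.pad) ≤ P.n := by
  have h₁ : (P.m + 2 * 2 ^ P.N₁ + P.pad) * (P.m + 4) * 2 ≤
    (P.m + 2 * 2 ^ P.N₁ + P.pad) * (P.m + 4) * P.a := Nat.mul_le_mul_left _ ha
  have h₂ : (P.m + 2 * 2 ^ P.N₁ + P.pad) * 4 ≤ (P.m + 2 * 2 ^ P.N₁ + P.pad) * (P.m + 4) :=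
    Nat.mul_le_mul_left _ (by omega)
  have h₃ : P.n = (P.m + 2 * 2 ^ P.N₁ + P.pad) * (P.m + 4) * P.a + 1 := rfl
  omega

/-- Building the graph is linear in its size, and each stage scans clauses and vectors, of which
there are fewer than vertices. As `n ≤ n ^ (2 - e)` for `e ≤ 1`, this is absorbed by the cost of the
dynamic algorithm. -/
theorem overhead_le (ha : 2 ≤ P.a) :
    P.overhead ≤ (24 * P.K + 9 * P.a + 200) * ((P.m + 1) * (2 ^ P.N₂ * P.n)) := by
  obtain ⟨h₁, h₂⟩ := Params.le_n ha
  have hW : 1 ≤ 2 ^ P.N₂ := Nat.one_le_pow _ _ (by norm_num)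
  have hM : 1 ≤ 2 ^ P.N₁ := Nat.one_le_pow _ _ (by norm_num)
  unfold Params.overhead Params.buildTime
  generalize 2 ^ P.N₂ = W at *
  generalize 2 ^ P.N₁ = M at *
  generalize P.n = n at *
  have hWn : n ≤ W * n := Nat.le_mul_of_pos_left _ hW
  have hQ : W * n ≤ (P.m + 1) * (W * n) := Nat.le_mul_of_pos_left _ (by omega)
  set Q := (P.m + 1) * (W * n) with hQd
  have hWm : W * (P.m + 1) ≤ Q := by
    rw [hQd, mul_comm W (P.m + 1)]
    exact Nat.mul_le_mul_left _ (Nat.le_mul_of_pos_right _ (by omega))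
  have hWM : W * M ≤ Q := (Nat.mul_le_mul_left W (show M ≤ n by omega)).trans hQ
  have e₁ : W * (2 * (P.m * (8 * P.K + 30) + 3) + M * 14 + 9) ≤ (16 * P.K + 75 + 14) * Q := by
    calc W * (2 * (P.m * (8 * P.K + 30) + 3) + M * 14 + 9)
        ≤ W * ((16 * P.K + 75) * (P.m + 1) + M * 14) := Nat.mul_le_mul_left _ (by
          have : (16 * P.K + 75) * (P.m + 1) = P.m * (16 * P.K + 75) + 16 * P.K + 75 := by ring
          have h' : P.m * (16 * P.K + 75) = 2 * (P.m * (8 * P.K + 30)) + P.m * 15 := by ring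
          omega)
      _ = (16 * P.K + 75) * (W * (P.m + 1)) + 14 * (W * M) := by ring
      _ ≤ (16 * P.K + 75) * Q + 14 * Q :=
          add_le_add (Nat.mul_le_mul_left _ hWm) (Nat.mul_le_mul_left _ hWM)
      _ = _ := by ring
  have e₂ : (P.m + 2 * M + P.pad) * ((P.m + 4) * (8 * P.K + 9 * P.a + 53) + 3 + 3) ≤
      (8 * P.K + 9 * P.a + 59) * Q := by
    calc (P.m + 2 * M + P.pad) * ((P.m + 4) * (8 * P.K + 9 * P.a + 53) + 3 + 3)
        = (8 * P.K + 9 * P.a + 53) * ((P.m + 2 * M + P.pad) * (P.m + 4)) +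
          6 * (P.m + 2 * M + P.pad) := by ring
      _ ≤ (8 * P.K + 9 * P.a + 53) * Q + 6 * Q :=
          add_le_add (Nat.mul_le_mul_left _ (by omega)) (Nat.mul_le_mul_left _ (by omega))
      _ = _ := by ring
  have e₃ : (24 * P.K + 9 * P.a + 200) * Q = (16 * P.K + 75 + 14) * Q +
    (8 * P.K + 9 * P.a + 59) * Q + 52 * Q := by ring
  omega

theorem mul_n_le_cost {t e : ℝ} (he' : e ≤ 1) :
    (((P.m + 1) * (2 ^ P.N₂ * P.n) : ℕ) : ℝ) ≤ P.cost t e := by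
  have hn : (1 : ℝ) ≤ P.n := by
    exact_mod_cast (show 1 ≤ P.n from Nat.succ_le_succ (Nat.zero_le _))
  have h : (P.n : ℝ) ≤ (P.n : ℝ) ^ (2 - e) := by
    conv_lhs => rw [← Real.rpow_one (P.n : ℝ)]
    exact Real.rpow_le_rpow_of_exponent_le hn (by linarith)
  have h₂ : (0 : ℝ) ≤ (P.n : ℝ) ^ t := by positivity
  have h₁ : ((P.m : ℝ) + 1) * (2 ^ P.N₂ * P.n) ≤ (P.m + 1) * (2 ^ P.N₂ * (P.n : ℝ) ^ (2 - e)) :=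
    mul_le_mul_of_nonneg_left (mul_le_mul_of_nonneg_left h (by positivity)) (by positivity)
  push_cast
  unfold Params.cost
  linarith

/-- What the reduction needs to know about an instance. -/
structure Ready (A : Algorithm) (D : ℕ) (P : Params) (w : ℕ) : Prop where
  fits : Fits P w
  split : 2 * P.N₁ + P.N₂ = P.N
  word : A.wordLength P.n ≤ w
  const : P.K + D + 2 * P.N + 3 * P.a + P.pad + 4 < 2 ^ w
  preprocess : A.preprocess.regBound < 2 ^ w
  insert : A.insert.regBound < 2 ^ w
  delete : A.delete.regBound < 2 ^ w
  query : A.query.regBound < 2 ^ w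
  count : 2 ^ P.N₂ * (6 * (P.m + 2)) ≤ P.n ^ (D + 3)

/-- The numbers of vertices, clauses and stages are bounded by the running time, so a word length
that accommodates `c₀` times the cost accommodates them too; `K + 5 ≤ c₀` leaves room for the
constants in `Fits`. -/
theorem exists_ready (A : Algorithm) {K D a pad : ℕ} {t e c₀ : ℝ} (ha : 2 ≤ a) (hD : 2 ≤ D)
    (ht : 0 < t) (he : 0 < e) (he' : e ≤ 1) (hte : t + e ≤ D) (hc₀ : (K : ℝ) + 5 ≤ c₀) :
    ∃ b C k : ℕ, ∀ (N : ℕ) (φ : KSat.Formula K N),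
      Ready A D (params D a pad φ) (b * (N + 1)) ∧
      c₀ * (params D a pad φ).cost t e ≤
        (2 : ℝ) ^ ((1 - e / D) * (N : ℝ)) * (C * ((N : ℝ) + 1) ^ k) ∧
      (2 : ℝ) ^ ((1 - e / D) * (N : ℝ)) * (C * ((N : ℝ) + 1) ^ k) < 2 ^ (b * (N + 1)) := by
  have hK0 : (0 : ℝ) ≤ K := Nat.cast_nonneg K
  obtain ⟨C, k, hCk⟩ := cost_le (K := K) (a := a) (pad := pad) (c₀ := c₀) hD ht he he' hte
  set b₁ := 1 + C + k with hb₁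
  set k₀ := K + D + 3 * a + pad + 4 with hk₀
  set b := b₁ + A.b * b₁ + (k₀ + 2) + A.preprocess.regBound + A.insert.regBound +
    A.delete.regBound + A.query.regBound with hb
  refine ⟨b, C, k, fun N φ => ?_⟩
  have hpow {r : ℕ} (hr : r ≤ b) : r * (N + 1) ≤ b * (N + 1) := Nat.mul_le_mul_right _ hr
  have hreg {r : ℕ} (hr : r ≤ b) : r < 2 ^ (b * (N + 1)) :=
    Nat.lt_two_pow_self.trans_le (Nat.pow_le_pow_right (by norm_num)
      ((Nat.le_mul_of_pos_right r (by omega)).trans (hpow hr)))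
  have hlt : (2 : ℝ) ^ ((1 - e / D) * (N : ℝ)) * (C * ((N : ℝ) + 1) ^ k) < 2 ^ (b₁ * (N + 1)) :=
    bound_lt he N
  have hlt' : (2 : ℝ) ^ (b₁ * (N + 1)) ≤ 2 ^ (b * (N + 1)) :=
    pow_le_pow_right₀ (by norm_num) (hpow (by omega))
  have hcost := hCk N φ
  refine ⟨?_, hcost, hlt.trans_le hlt'⟩
  set P := params D a pad φ with hP
  have ha' : 2 ≤ P.a := ha
  have hQ := mul_n_le_cost (P := P) (t := t) he'
  obtain ⟨hn₁, hn₂⟩ := Params.le_n ha'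
  have hQ' : (K + 5) * ((P.m + 1) * (2 ^ P.N₂ * P.n)) < 2 ^ (b₁ * (N + 1)) := by
    have : (((K + 5) * ((P.m + 1) * (2 ^ P.N₂ * P.n)) : ℕ) : ℝ) < 2 ^ (b₁ * (N + 1)) := by
      rw [Nat.cast_mul]
      refine lt_of_le_of_lt ?_ (hcost.trans_lt hlt)
      refine mul_le_mul (by push_cast; exact hc₀) hQ (by positivity) (by linarith)
    exact_mod_cast this
  have hW : 1 ≤ 2 ^ P.N₂ := Nat.one_le_pow _ _ (by norm_num)
  have hM : 1 ≤ 2 ^ P.N₁ := Nat.one_le_pow _ _ (by norm_num)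
  have hle : 2 ^ (b₁ * (N + 1)) ≤ 2 ^ (b * (N + 1)) :=
    Nat.pow_le_pow_right (by norm_num) (hpow (by omega))
  have hWn : P.n ≤ 2 ^ P.N₂ * P.n := Nat.le_mul_of_pos_left _ hW
  have hWn' : 2 ^ P.N₂ ≤ 2 ^ P.N₂ * P.n := Nat.le_mul_of_pos_right _ (by omega)
  have hq₁ : 2 ^ P.N₂ * P.n ≤ (P.m + 1) * (2 ^ P.N₂ * P.n) := Nat.le_mul_of_pos_left _ (by omega)
  have hq₂ : P.m + 1 ≤ (P.m + 1) * (2 ^ P.N₂ * P.n) := Nat.le_mul_of_pos_right _ (by omega)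
  set Q := (P.m + 1) * (2 ^ P.N₂ * P.n) with hQd
  have hKQ : P.m * K ≤ Q * K := Nat.mul_le_mul_right _ (by omega)
  rw [add_mul, mul_comm K Q] at hQ'
  have hsplit : 2 * P.N₁ + P.N₂ = N := params_split hD φ
  refine ⟨⟨ha', by omega, ?_, ?_, by omega⟩, hsplit, ?_, ?_, hreg (by omega), hreg (by omega),
    hreg (by omega), hreg (by omega), ?_⟩
  · change P.m * K + 1 < _
    omega
  · have : N + 1 ≤ b * (N + 1) := Nat.le_mul_of_pos_left _ (by omega)
    omega
  · have h₁ : Nat.log 2 P.n < b₁ * (N + 1) := Nat.log_lt_of_lt_pow (by omega) (by omega)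
    calc A.b * (Nat.log 2 P.n + 1) ≤ A.b * (b₁ * (N + 1)) := Nat.mul_le_mul_left _ h₁
      _ = A.b * b₁ * (N + 1) := (mul_assoc ..).symm
      _ ≤ b * (N + 1) := hpow (by omega)
  · change K + D + 2 * N + 3 * a + pad + 4 < _
    have h₁ : K + D + 2 * N + 3 * a + pad + 4 ≤ (k₀ + 2) * (N + 1) := by
      have : k₀ ≤ k₀ * (N + 1) := Nat.le_mul_of_pos_right _ (by omega)
      rw [add_mul]
      omega
    exact (h₁.trans (hpow (by omega))).trans_lt Nat.lt_two_pow_self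
  -- The stages number at most `2 ^ (D * (N₁ + 1)) ≤ n ^ D`, and `6 * (m + 2) ≤ n ^ 3`; this is why
  -- the exponent in the failure probability is `D + 3`.
  · have hDlt : N < D * (P.N₁ + 1) := by
      rw [mul_add, mul_one]
      exact Nat.lt_mul_div_succ N (by omega)
    calc 2 ^ P.N₂ * (6 * (P.m + 2)) ≤ P.n ^ D * P.n ^ 3 := by
          refine Nat.mul_le_mul ?_ ?_
          · calc 2 ^ P.N₂ ≤ 2 ^ (D * (P.N₁ + 1)) := Nat.pow_le_pow_right (by norm_num) (by omega)
              _ = (2 ^ (P.N₁ + 1)) ^ D := by rw [mul_comm, pow_mul]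
              _ ≤ P.n ^ D := Nat.pow_le_pow_left (by rw [pow_succ]; omega) D
          · calc 6 * (P.m + 2) ≤ P.n * P.n := Nat.mul_le_mul (by omega) (by omega)
              _ ≤ P.n ^ 3 := by
                rw [← pow_two]
                exact Nat.pow_le_pow_right (by omega) (by norm_num)
      _ = P.n ^ (D + 3) := (pow_add ..).symm

end Reduction

namespace Reduction

open WordRAM DynGraph

/-! ## The lower bounds -/

theorem exists_bound_of_isBigO {f : ℕ → ℝ} {s : ℝ}
    (h : Asymptotics.IsBigO Filter.atTop f fun n : ℕ => (n : ℝ) ^ s) :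
    ∃ c : ℝ, 0 ≤ c ∧ ∃ n₀ : ℕ, ∀ n ≥ n₀, |f n| ≤ c * (n : ℝ) ^ s := by
  obtain ⟨c, hc, h⟩ := h.exists_pos
  obtain ⟨n₀, hn₀⟩ := Filter.eventually_atTop.mp h.bound
  refine ⟨c, hc.le, n₀, fun n hn => (hn₀ n hn).trans_eq ?_⟩
  rw [Real.norm_of_nonneg (by positivity)]

variable {A : Algorithm} {K D a n₀ : ℕ} {α t e Cp Cu Cq : ℝ} {p u q : ℕ → ℝ}

/-- The bounds for the running times of the dynamic algorithm. -/
structure TimeBounds (t e Cp Cu Cq : ℝ) (n₀ : ℕ) (p u q : ℕ → ℝ) : Prop where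
  nonneg : 0 ≤ Cp ∧ 0 ≤ Cu ∧ 0 ≤ Cq
  preprocess : ∀ n ≥ n₀, |p n| ≤ Cp * (n : ℝ) ^ t
  update : ∀ n ≥ n₀, |u n| ≤ Cu * (n : ℝ) ^ (2 - e)
  query : ∀ n ≥ n₀, |q n| ≤ Cq * (n : ℝ) ^ (2 - e)

/-- The constant factor in the running time of the reduction. -/
def timeConst (K a : ℕ) (Cp Cu Cq : ℝ) : ℝ := 20 * (Cp + 2 * Cu + 2 * Cq) + (24 * K + 9 * a + 200)

theorem le_cost {P : Params} (ha : 2 ≤ P.a) (he' : e ≤ 1) {R : ℕ}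
    (hR : (R : ℝ) ≤ (Cp + 2 * Cu + 2 * Cq) * P.cost t e) :
    ((20 * R + P.overhead : ℕ) : ℝ) ≤ timeConst P.K P.a Cp Cu Cq * P.cost t e := by
  have h₁ : (P.overhead : ℝ) ≤ (24 * P.K + 9 * P.a + 200) * P.cost t e := by
    calc (P.overhead : ℝ)
        ≤ (((24 * P.K + 9 * P.a + 200) * ((P.m + 1) * (2 ^ P.N₂ * P.n)) : ℕ) : ℝ) := by
          exact_mod_cast overhead_le ha
      _ = (24 * P.K + 9 * P.a + 200) * (((P.m + 1) * (2 ^ P.N₂ * P.n) : ℕ) : ℝ) := by push_cast; ring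
      _ ≤ _ := mul_le_mul_of_nonneg_left (mul_n_le_cost he') (by positivity)
  unfold timeConst
  push_cast
  linarith

theorem timeConst_ge (hCp : 0 ≤ Cp) (hCu : 0 ≤ Cu) (hCq : 0 ≤ Cq) :
    (K : ℝ) + 5 ≤ timeConst K a Cp Cu Cq := by
  have h₁ : (0 : ℝ) ≤ K := Nat.cast_nonneg K
  have h₂ : (0 : ℝ) ≤ a := Nat.cast_nonneg a
  unfold timeConst
  linarith

/-- The algorithm promises nothing for small graphs. With `n₀` padding blocks even the smallest
formulas give graphs of at least that size. -/
theorem le_params_n (D : ℕ) (ha : 2 ≤ a) {N : ℕ} (φ : KSat.Formula K N) :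
    n₀ ≤ (params D a n₀ φ).n := by
  have h := (Params.le_n (P := params D a n₀ φ) ha).2
  have : (params D a n₀ φ).pad = n₀ := rfl
  omega

/-- The amortized bound is applied once, to the concatenation of all stages, which has at most `2 *
m + 1` operations per stage. -/
theorem exists_solves_full (ha : 2 ≤ a) (hD : 2 ≤ D) (ht : 0 < t) (he : 0 < e) (he' : e ≤ 1)
    (hte : t + e ≤ D) (hα : α * (3 * a + 3 : ℕ) < (5 * a : ℕ))
    (hT : TimeBounds t e Cp Cu Cq n₀ p u q)
    (hM : ∀ n ≥ n₀, ∀ (G : SimpleGraph (Fin n)) (L : List (Fin n × Fin n)), Presents L G →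
      ∀ σ : List (Op n), Legal 2 G σ → σ.length ≤ n ^ (D + 3) →
        coinMeasure {ω | ¬ A.Succeeds α G L (AmortizedTime p u q) σ ω} ≤
          ENNReal.ofReal (1 / (n : ℝ) ^ (D + 3))) :
    ∃ (M : Cmd) (b C k : ℕ), KSat.Solves K M b fun N =>
      (2 : ℝ) ^ ((1 - e / D) * (N : ℝ)) * (C * ((N : ℝ) + 1) ^ k) := by
  obtain ⟨hCp, hCu, hCq⟩ := hT.nonneg
  obtain ⟨b, C, k, hr⟩ := exists_ready A (K := K) (pad := n₀) ha hD ht he he' hte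
    (timeConst_ge (a := a) hCp hCu hCq)
  refine ⟨mainCmd K D a n₀ false A.preprocess A.insert A.query (opsCmd K A.delete true) true,
    b, C, k, fun N φ => ?_⟩
  obtain ⟨hR, hcost, hlt⟩ := hr N φ
  have hn₀ := le_params_n (n₀ := n₀) D ha φ
  obtain ⟨P, hP⟩ : ∃ P, P = params D a n₀ φ := ⟨_, rfl⟩
  rw [← hP] at hR hcost hn₀
  have ePK : P.K = K := by rw [hP]; rfl
  have ePa : P.a = a := by rw [hP]; rfl
  have ePN : P.N = N := by rw [hP]; rfl
  have epad : P.pad = n₀ := by rw [hP]; rfl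
  have ha' : 2 ≤ P.a := by rwa [ePa]
  have hnd : segs P.m (2 ^ P.N₁) P.pad * P.a + 1 = P.n := rfl
  set R := ⌊(Cp + 2 * Cu + 2 * Cq) * P.cost t e⌋₊ with hRd
  have hcost0 : 0 ≤ P.cost t e := by unfold Params.cost; positivity
  have hR' : (R : ℝ) ≤ (Cp + 2 * Cu + 2 * Cq) * P.cost t e := Nat.floor_le (by positivity)
  have htot₀ := le_cost ha' he' hR'
  rw [ePK, ePa] at htot₀
  have htot := htot₀.trans hcost
  have hRw : R < 2 ^ (b * (N + 1)) := by
    have h := htot.trans_lt hlt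
    have h' : 20 * R + P.overhead < 2 ^ (b * (N + 1)) := by exact_mod_cast h
    omega
  have hcnt := hR.count
  have hlen : 2 ^ P.N₂ * (2 * P.m + 1) ≤ P.n ^ (D + 3) :=
    (Nat.mul_le_mul_left _ (by omega)).trans hcnt
  have hmeas (σ : List (Op (segs P.m (2 ^ P.N₁) P.pad * P.a + 1)))
      (hσ : Legal 2 (P.graph fun _ => false) σ) (hl : σ.length ≤ 2 ^ P.N₂ * (2 * P.m + 1)) :=
    hM _ hn₀ _ _ (presents_finEdges ha' false) σ hσ (hl.trans hlen)
  -- One sequence per query for the answers, and the index `2 ^ N₂` for the complete sequence, which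
  -- is needed for the total time.
  refine coinMeasure_le (I := Finset.range (2 ^ P.N₂ + 1))
    (σ := fun x => if x < 2 ^ P.N₂ then P.upTo x else (List.range (2 ^ P.N₂)).flatMap P.block)
    (S := A.Succeeds α (P.graph fun _ => false) (P.finEdges false) (AmortizedTime p u q))
    (c := D + 3) (n := P.n) (Nat.succ_pos _) (fun x _ => ?_) ?_ fun ω hω => ?_
  · split_ifs with hx
    · exact hmeas _ (legal_upTo ha' x).1 (length_upTo_le hx)
    · exact hmeas _ (legal_blocks ha' _).1 (length_blocks_le _)
  · rw [Finset.card_range]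
    refine le_trans ?_ hcnt
    have : 2 ^ P.N₂ * 6 ≤ 2 ^ P.N₂ * (6 * (P.m + 2)) := Nat.mul_le_mul_left _ (by omega)
    have : 1 ≤ 2 ^ P.N₂ := Nat.one_le_pow _ _ (by norm_num)
    omega
  · rw [Set.mem_ofPred_eq, not_not]
    have hconst := hR.const
    rw [ePK, ePN, ePa, epad] at hconst
    refine (exists_exec_full (α := α) (R := R)
      (time := AmortizedTime p u q) φ hP (hR.split.trans ePN) hR.fits hR.word
      hconst (by rw [ePa]; exact hα) hR.preprocess hR.insert hR.delete hR.query hRw ?_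
      (fun x _ => (legal_upTo ha' x).2) ?_ ?_).imp fun s h => h.imp fun T h =>
        ⟨h.1, le_trans (by exact_mod_cast h.2.1) htot, h.2.2⟩
    · intro t₀ ts ht'
      refine Nat.le_floor (le_trans ht' ?_)
      set σ := (List.range (2 ^ P.N₂)).flatMap P.block with hσ
      have hσl : σ.length ≤ 2 ^ P.N₂ * (2 * P.m + 1) := length_blocks_le _
      have hcount (Q : Op (segs P.m (2 ^ P.N₁) P.pad * P.a + 1) → Bool) {c v : ℝ} (hc : 0 ≤ c)
          (hv : |v| ≤ c * (P.n : ℝ) ^ (2 - e)) : (σ.countP Q : ℝ) * v ≤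
          2 * c * ((P.m + 1) * (2 ^ P.N₂ * (P.n : ℝ) ^ (2 - e))) := by
        have h₁ : (σ.countP Q : ℝ) ≤ 2 ^ P.N₂ * (2 * (P.m + 1)) := by
          have : σ.countP Q ≤ 2 ^ P.N₂ * (2 * (P.m + 1)) := List.countP_le_length.trans
            (hσl.trans (Nat.mul_le_mul_left _ (by omega)))
          exact_mod_cast this
        calc (σ.countP Q : ℝ) * v ≤ σ.countP Q * (c * (P.n : ℝ) ^ (2 - e)) :=
              mul_le_mul_of_nonneg_left ((le_abs_self v).trans hv) (by positivity)
          _ ≤ (2 ^ P.N₂ * (2 * (P.m + 1))) * (c * (P.n : ℝ) ^ (2 - e)) :=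
              mul_le_mul_of_nonneg_right h₁ (by positivity)
          _ = _ := by ring
      have k₁ := (le_abs_self _).trans (hT.preprocess P.n hn₀)
      have hX : 0 ≤ (P.m + 1) * (2 ^ P.N₂ * (P.n : ℝ) ^ (2 - e)) := by positivity
      have hY : 0 ≤ (P.n : ℝ) ^ t := by positivity
      have k₄ : (Cp + 2 * Cu + 2 * Cq) * P.cost t e = Cp * (P.n : ℝ) ^ t +
          2 * Cu * ((P.m + 1) * (2 ^ P.N₂ * (P.n : ℝ) ^ (2 - e))) +
          2 * Cq * ((P.m + 1) * (2 ^ P.N₂ * (P.n : ℝ) ^ (2 - e))) +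
          (Cp * ((P.m + 1) * (2 ^ P.N₂ * (P.n : ℝ) ^ (2 - e))) +
            (2 * Cu + 2 * Cq) * (P.n : ℝ) ^ t) := by
        unfold Params.cost
        ring
      rw [k₄]
      refine le_add_of_le_of_nonneg (add_le_add (add_le_add k₁ ?_) ?_) (by positivity)
      · exact hcount _ hCu (hT.update P.n hn₀)
      · exact hcount _ hCq (hT.query P.n hn₀)
    · have := hω (2 ^ P.N₂) (by simp)
      simpa using this
    · intro x hx
      have := hω x (by simp; omega)
      simpa [hx] using this

theorem exists_solves_monotone {dec pol : Bool} {code : Cmd}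
    {op : ∀ P : Params, ℕ → Op (segs P.m (2 ^ P.N₁) P.pad * P.a + 1)}
    {T : Params → ℕ → ℕ → ℕ → Bool} {kind : ∀ n, Op n → Prop}
    (ha : 2 ≤ a) (hD : 2 ≤ D) (ht : 0 < t) (he : 0 < e) (he' : e ≤ 1)
    (hte : t + e ≤ D) (hα : α * (3 * a + 3 : ℕ) < (5 * a : ℕ))
    (hT : TimeBounds t e Cp Cu Cq n₀ p u q)
    (hcode : ∀ P c, A.code (op P c) = code) (hop : ∀ P c, ¬ (op P c).IsQuery)
    (hargs : ∀ P : Params, ∀ c < P.m, ∀ s, (op P c).passArgs s = passArgs P c s)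
    (hcode' : code = A.insert ∨ code = A.delete)
    (hkind : ∀ P c, kind _ (op P c)) (hkind' : ∀ n, kind n .query)
    (hlegal : ∀ P : Params, 2 ≤ P.a → ∀ x, ∀ k ≤ P.m,
      Legal 2 (P.graph fun _ => dec) (opsList (fun c => P.bw x c = pol) (op P) k) ∧
      applyAll (P.graph fun _ => dec) (opsList (fun c => P.bw x c = pol) (op P) k) =
        P.graph (T P x k))
    (hTbw : ∀ P : Params, ∀ x, ∀ c < P.m, T P x P.m c = P.bw x c)
    (hM : ∀ n ≥ n₀, ∀ (G : SimpleGraph (Fin n)) (L : List (Fin n × Fin n)), Presents L G →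
      ∀ σ : List (Op n), Legal 2 G σ → (∀ o ∈ σ, kind n o) → σ.length ≤ n ^ (D + 3) →
        coinMeasure {ω | ¬ A.Succeeds α G L (WorstCaseTime p u q) σ ω} ≤
          ENNReal.ofReal (1 / (n : ℝ) ^ (D + 3))) :
    ∃ (M : Cmd) (b C k : ℕ), KSat.Solves K M b fun N =>
      (2 : ℝ) ^ ((1 - e / D) * (N : ℝ)) * (C * ((N : ℝ) + 1) ^ k) := by
  obtain ⟨hCp, hCu, hCq⟩ := hT.nonneg
  obtain ⟨b, C, k, hr⟩ := exists_ready A (K := K) (pad := n₀) ha hD ht he he' hte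
    (timeConst_ge (a := a) hCp hCu hCq)
  refine ⟨mainCmd K D a n₀ dec A.preprocess code A.query resetCmd pol, b, C, k, fun N φ => ?_⟩
  obtain ⟨hR, hcost, hlt⟩ := hr N φ
  have hn₀ := le_params_n (n₀ := n₀) D ha φ
  obtain ⟨P, hP⟩ : ∃ P, P = params D a n₀ φ := ⟨_, rfl⟩
  rw [← hP] at hR hcost hn₀
  have ePK : P.K = K := by rw [hP]; rfl
  have ePa : P.a = a := by rw [hP]; rfl
  have ePN : P.N = N := by rw [hP]; rfl
  have epad : P.pad = n₀ := by rw [hP]; rfl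
  have ha' : 2 ≤ P.a := by rwa [ePa]
  set Y := (P.n : ℝ) ^ (2 - e) with hY
  have hY0 : 0 ≤ Y := by positivity
  have hpt : 0 ≤ (P.n : ℝ) ^ t := by positivity
  set Rp := ⌊Cp * (P.n : ℝ) ^ t⌋₊ with hRp
  set Ru := ⌊Cu * Y⌋₊ with hRu
  set Rq := ⌊Cq * Y⌋₊ with hRq
  have hRp' : (Rp : ℝ) ≤ Cp * (P.n : ℝ) ^ t := Nat.floor_le (by positivity)
  have hRu' : (Ru : ℝ) ≤ Cu * Y := Nat.floor_le (by positivity)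
  have hRq' : (Rq : ℝ) ≤ Cq * Y := Nat.floor_le (by positivity)
  have hR' : ((Rp + 2 ^ P.N₂ * (P.m * Ru + Rq) : ℕ) : ℝ) ≤
      (Cp + 2 * Cu + 2 * Cq) * P.cost t e := by
    have k₁ : (2 : ℝ) ^ P.N₂ * (P.m * Ru + Rq) ≤ 2 ^ P.N₂ * (P.m * (Cu * Y) + Cq * Y) :=
      mul_le_mul_of_nonneg_left
        (add_le_add (mul_le_mul_of_nonneg_left hRu' (by positivity)) hRq') (by positivity)
    have k₂ : (Cp + 2 * Cu + 2 * Cq) * P.cost t e = Cp * (P.n : ℝ) ^ t +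
        2 ^ P.N₂ * (P.m * (Cu * Y) + Cq * Y) + ((2 * Cu + 2 * Cq) * (P.n : ℝ) ^ t +
          2 ^ P.N₂ * Y * (Cp * (P.m + 1) + Cu * (P.m + 2) + Cq * (2 * P.m + 1))) := by
      unfold Params.cost
      ring
    rw [k₂]
    push_cast
    exact le_add_of_le_of_nonneg (add_le_add hRp' k₁) (by positivity)
  have htot₀ := le_cost ha' he' hR'
  rw [ePK, ePa] at htot₀
  have htot := htot₀.trans hcost
  have hRw : Rp + 2 ^ P.N₂ * (P.m * Ru + Rq) < 2 ^ (b * (N + 1)) := by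
    have h := htot.trans_lt hlt
    have h' : 20 * (Rp + 2 ^ P.N₂ * (P.m * Ru + Rq)) + P.overhead < 2 ^ (b * (N + 1)) := by
      exact_mod_cast h
    omega
  have hcnt := hR.count
  have hW : 1 ≤ 2 ^ P.N₂ := Nat.one_le_pow _ _ (by norm_num)
  have hlen : P.m + 1 ≤ P.n ^ (D + 3) := by
    refine le_trans ?_ hcnt
    have : 6 * (P.m + 2) ≤ 2 ^ P.N₂ * (6 * (P.m + 2)) := Nat.le_mul_of_pos_left _ hW
    omega
  have hleg (x : ℕ) : Legal 2 (P.graph fun _ => dec)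
      (opsList (fun c => P.bw x c = pol) (op P) P.m ++ [.query]) :=
    (hlegal P ha' x P.m le_rfl).1.append
      ((hlegal P ha' x P.m le_rfl).2 ▸ legal_query ha' _)
  -- For each stage: the prefixes for `0, …, m` coordinates, which bound the times, and at index `m
  -- + 1` the sequence that ends with the query.
  refine coinMeasure_le (I := Finset.range (2 ^ P.N₂) ×ˢ Finset.range (P.m + 2))
    (σ := fun i => if i.2 ≤ P.m then opsList (fun c => P.bw i.1 c = pol) (op P) i.2 else
      opsList (fun c => P.bw i.1 c = pol) (op P) P.m ++ [.query])
    (S := A.Succeeds α (P.graph fun _ => dec) (P.finEdges dec) (WorstCaseTime p u q))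
    (c := D + 3) (n := P.n) (Nat.succ_pos _) (fun i _ => ?_) ?_ fun ω hω => ?_
  · split_ifs with hx
    · refine hM (segs P.m (2 ^ P.N₁) P.pad * P.a + 1) hn₀ _ _ (presents_finEdges ha' dec) _ (hlegal P ha' i.1 i.2 hx).1 ?_
        (length_opsList_le.trans (le_trans (by omega : i.2 ≤ P.m + 1) hlen))
      intro o ho
      obtain ⟨c, -, -, rfl⟩ := mem_opsList.mp ho
      exact hkind P c
    · refine hM (segs P.m (2 ^ P.N₁) P.pad * P.a + 1) hn₀ _ _ (presents_finEdges ha' dec) _ (hleg i.1) ?_ ?_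
      · intro o ho
        rcases List.mem_append.mp ho with ho | ho
        · obtain ⟨c, -, -, rfl⟩ := mem_opsList.mp ho
          exact hkind P c
        · rw [List.mem_singleton.mp ho]
          exact hkind' _
      · rw [List.length_append, List.length_singleton]
        have := length_opsList_le (p := fun c => P.bw i.1 c = pol) (op := op P) (m := P.m)
        exact le_trans (by omega) hlen
  · rw [Finset.card_product, Finset.card_range, Finset.card_range]
    refine le_trans ?_ hcnt
    rw [mul_left_comm]
    exact Nat.mul_le_mul_left _ (by omega)
  · rw [Set.mem_ofPred_eq, not_not]
    have hconst := hR.const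
    rw [ePK, ePN, ePa, epad] at hconst
    refine (exists_exec_monotone (α := α) (Rp := Rp) (Ru := Ru) (Rq := Rq)
      (p := p) (u := u) (q := q) (dec := dec) (pol := pol) (code := code) (op := op P)
      (T := fun x => T P x P.m) φ hP (hR.split.trans ePN) hR.fits hR.word hconst
      (by rw [ePa]; exact hα) hR.preprocess (hcode P) (hop P) (hargs P)
      (hcode'.elim (fun h => h ▸ hR.insert) fun h => h ▸ hR.delete) hR.query hRw
      (fun t h => Nat.le_floor (h.trans ((le_abs_self _).trans (hT.preprocess P.n hn₀))))
      (fun t h => Nat.le_floor (h.trans ((le_abs_self _).trans (hT.update P.n hn₀))))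
      (fun t h => Nat.le_floor (h.trans ((le_abs_self _).trans (hT.query P.n hn₀))))
      (fun x _ => hTbw P x) (fun x _ => ?_) (fun x hx c hc => ?_) (fun x hx => ?_)).imp
        fun s h => h.imp fun τ h => ⟨h.1, le_trans (by exact_mod_cast h.2.1) htot, h.2.2⟩
    · rw [applyAll_append, (hlegal P ha' x P.m le_rfl).2]
      rfl
    · have := hω (x, c) (by simp; omega)
      simpa [hc] using this
    · have := hω (x, P.m + 1) (by simp; omega)
      simpa using this

end Reduction

/-! ### Choice of the constants and the three lower bounds -/

namespace Reduction

open WordRAM DynGraph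

/-- The left side is `5 * a + 5 - 3 * ε * (a + 1)`, so any `a` with `3 * ε * (a + 1) > 5` will do.
-/
theorem exists_segment_length {ε : ℝ} (hε : 0 < ε) :
    ∃ a : ℕ, 2 ≤ a ∧ (5 / 3 - ε) * (3 * a + 3 : ℕ) < (5 * a : ℕ) := by
  refine ⟨⌈5 / (3 * ε)⌉₊ + 2, by omega, ?_⟩
  have h := Nat.le_ceil (5 / (3 * ε))
  rw [div_le_iff₀ (by positivity)] at h
  push_cast
  nlinarith

theorem isBigO_rpow_of_le {r s : ℝ} (h : r ≤ s) :
    Asymptotics.IsBigO Filter.atTop (fun n : ℕ => (n : ℝ) ^ r) fun n : ℕ => (n : ℝ) ^ s := by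
  refine Asymptotics.IsBigO.of_bound 1 (Filter.eventually_atTop.mpr ⟨1, fun n hn => ?_⟩)
  rw [Real.norm_of_nonneg (by positivity), Real.norm_of_nonneg (by positivity), one_mul]
  exact Real.rpow_le_rpow_of_exponent_le (by exact_mod_cast hn) h

theorem exists_timeBounds {t e : ℝ} {p u q : ℕ → ℝ}
    (hp : Asymptotics.IsBigO Filter.atTop p fun n : ℕ => (n : ℝ) ^ t)
    (hu : Asymptotics.IsBigO Filter.atTop u fun n : ℕ => (n : ℝ) ^ (2 - e))
    (hq : Asymptotics.IsBigO Filter.atTop q fun n : ℕ => (n : ℝ) ^ (2 - e)) :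
    ∃ (Cp Cu Cq : ℝ) (n₁ : ℕ), ∀ n₀ ≥ n₁, TimeBounds t e Cp Cu Cq n₀ p u q := by
  obtain ⟨Cp, h₁, m₁, k₁⟩ := exists_bound_of_isBigO hp
  obtain ⟨Cu, h₂, m₂, k₂⟩ := exists_bound_of_isBigO hu
  obtain ⟨Cq, h₃, m₃, k₃⟩ := exists_bound_of_isBigO hq
  refine ⟨Cp, Cu, Cq, m₁ + m₂ + m₃, fun n₀ hn₀ => ⟨⟨h₁, h₂, h₃⟩, fun n hn => k₁ n ?_,
    fun n hn => k₂ n ?_, fun n hn => k₃ n ?_⟩⟩ <;> omega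

variable {A : Algorithm} {D : ℕ} {ε t e : ℝ} {p u q : ℕ → ℝ}

theorem not_fullyDynamic (hε : 0 < ε) (ht : 0 < t) (he : 0 < e) (he' : e ≤ 1) (hD : 2 ≤ D)
    (hte : t + e ≤ D) (hseth : KSat.SETH)
    (hp : Asymptotics.IsBigO Filter.atTop p fun n : ℕ => (n : ℝ) ^ t)
    (hu : Asymptotics.IsBigO Filter.atTop u fun n : ℕ => (n : ℝ) ^ (2 - e))
    (hq : Asymptotics.IsBigO Filter.atTop q fun n : ℕ => (n : ℝ) ^ (2 - e)) :
    ¬ A.FullyDynamic (5 / 3 - ε) 2 (D + 3) p u q := by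
  rintro ⟨n₂, hA⟩
  obtain ⟨a, ha, hα⟩ := exists_segment_length hε
  obtain ⟨Cp, Cu, Cq, n₁, hT⟩ := exists_timeBounds hp hu hq
  obtain ⟨K, hK⟩ := hseth (e / D) (by positivity)
  exact hK (exists_solves_full (A := A) ha hD ht he he' hte hα (hT (max n₁ n₂) (le_max_left _ _))
    fun n hn G L hL σ hσ hl => hA n ((le_max_right _ _).trans hn) G L hL σ hσ (fun _ _ => trivial) hl)

theorem not_incremental (hε : 0 < ε) (ht : 0 < t) (he : 0 < e) (he' : e ≤ 1) (hD : 2 ≤ D)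
    (hte : t + e ≤ D) (hseth : KSat.SETH)
    (hp : Asymptotics.IsBigO Filter.atTop p fun n : ℕ => (n : ℝ) ^ t)
    (hu : Asymptotics.IsBigO Filter.atTop u fun n : ℕ => (n : ℝ) ^ (2 - e))
    (hq : Asymptotics.IsBigO Filter.atTop q fun n : ℕ => (n : ℝ) ^ (2 - e)) :
    ¬ A.Incremental (5 / 3 - ε) 2 (D + 3) p u q := by
  rintro ⟨n₂, hA⟩
  obtain ⟨a, ha, hα⟩ := exists_segment_length hε
  obtain ⟨Cp, Cu, Cq, n₁, hT⟩ := exists_timeBounds hp hu hq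
  obtain ⟨K, hK⟩ := hseth (e / D) (by positivity)
  exact hK (exists_solves_monotone (A := A) (dec := false) (pol := true) (code := A.insert)
    (op := Params.ins) (T := fun P x k c => decide (c < k) && P.bw x c)
    (kind := fun _ o => o.IsInsert ∨ o.IsQuery) ha hD ht he he' hte hα
    (hT (max n₁ n₂) (le_max_left _ _)) (fun _ _ => rfl) (fun _ _ => id)
    (fun P c hc s => passArgs_ins hc s) (Or.inl rfl) (fun _ _ => Or.inl trivial)
    (fun _ => Or.inr trivial) (fun P ha x k hk => legal_ins ha x hk)
    (fun P x c hc => by simp [hc])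
    fun n hn G L hL σ hσ hk hl => hA n ((le_max_right _ _).trans hn) G L hL σ hσ hk hl)

theorem not_decremental (hε : 0 < ε) (ht : 0 < t) (he : 0 < e) (he' : e ≤ 1) (hD : 2 ≤ D)
    (hte : t + e ≤ D) (hseth : KSat.SETH)
    (hp : Asymptotics.IsBigO Filter.atTop p fun n : ℕ => (n : ℝ) ^ t)
    (hu : Asymptotics.IsBigO Filter.atTop u fun n : ℕ => (n : ℝ) ^ (2 - e))
    (hq : Asymptotics.IsBigO Filter.atTop q fun n : ℕ => (n : ℝ) ^ (2 - e)) :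
    ¬ A.Decremental (5 / 3 - ε) 2 (D + 3) p u q := by
  rintro ⟨n₂, hA⟩
  obtain ⟨a, ha, hα⟩ := exists_segment_length hε
  obtain ⟨Cp, Cu, Cq, n₁, hT⟩ := exists_timeBounds hp hu hq
  obtain ⟨K, hK⟩ := hseth (e / D) (by positivity)
  exact hK (exists_solves_monotone (A := A) (dec := true) (pol := false) (code := A.delete)
    (op := Params.del) (T := fun P x k c => decide (k ≤ c) || P.bw x c)
    (kind := fun _ o => o.IsDelete ∨ o.IsQuery) ha hD ht he he' hte hα
    (hT (max n₁ n₂) (le_max_left _ _)) (fun _ _ => rfl) (fun _ _ => id)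
    (fun P c hc s => passArgs_del hc s) (Or.inr rfl) (fun _ _ => Or.inl trivial)
    (fun _ => Or.inr trivial) (fun P ha x k hk => legal_del_of_full ha x hk)
    (fun P x c hc => by simp [hc])
    fun n hn G L hL σ hσ hk hl => hA n ((le_max_right _ _).trans hn) G L hL σ hσ hk hl)

end Reduction

theorem mainTheorem3 :
    (∃ C : ℕ, ∀ t ε ε' : ℝ, 0 < t → 0 < ε → 0 < ε' → KSat.SETH →
      ∃ c : ℕ, ∀ p u q : ℕ → ℝ,
        Asymptotics.IsBigO Filter.atTop p (fun n : ℕ => (n : ℝ) ^ t) →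
        Asymptotics.IsBigO Filter.atTop u (fun n : ℕ => (n : ℝ) ^ (2 - ε')) →
        Asymptotics.IsBigO Filter.atTop q (fun n : ℕ => (n : ℝ) ^ (2 - ε')) →
        (¬ ∃ A : DynGraph.Algorithm, A.FullyDynamic (5 / 3 - ε) C c p u q) ∧
        (¬ ∃ A : DynGraph.Algorithm, A.Incremental (5 / 3 - ε) C c p u q) ∧
        (¬ ∃ A : DynGraph.Algorithm, A.Decremental (5 / 3 - ε) C c p u q)) ∧
    (∀ (a d : ℕ), 1 ≤ a → ∀ (U V : Finset (Fin d → Bool)) (w : Fin d → Bool),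
      (∀ (u : U) (v : V), Gadget.inner3 u.val v.val w = 0 →
        ((5 * a + 1 : ℕ) : ℕ∞) ≤ (Gadget.graph a U V w).eccent (.inl (.uEnd u))) ∧
      (Gadget.Nondegenerate U V → (∀ (u : U) (v : V), Gadget.inner3 u.val v.val w ≠ 0) →
        ∀ u : U, (Gadget.graph a U V w).eccent (.inl (.uEnd u)) ≤ ((3 * a + 2 : ℕ) : ℕ∞))) := by
  -- Segment graphs have at most twice as many edges as vertices. The exponent is `D + 3` with `D =
  -- ⌈t + min ε' 1⌉₊ + 2`. Replacing `ε'` by `min ε' 1` only weakens the assumed time bounds and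
  -- keeps the exponent `2 - e` at least 1.
  refine ⟨⟨2, fun t ε ε' ht hε hε' hseth => ⟨⌈t + min ε' 1⌉₊ + 2 + 3, fun p u q hp hu hq => ?_⟩⟩,
    fun a d ha U V w => ⟨fun u v h => Gadget.le_eccent_of_inner3_eq_zero ha h,
      fun hnd h u => Gadget.eccent_le_of_inner3_ne_zero ha hnd h u⟩⟩
  have he : 0 < min ε' 1 := lt_min hε' one_pos
  have hte : t + min ε' 1 ≤ ((⌈t + min ε' 1⌉₊ + 2 : ℕ) : ℝ) := by
    have := Nat.le_ceil (t + min ε' 1)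
    push_cast
    linarith
  have hle := Reduction.isBigO_rpow_of_le (show 2 - ε' ≤ 2 - min ε' 1 by
    linarith [min_le_left ε' 1])
  have hu' := hu.trans hle
  have hq' := hq.trans hle
  have he' := min_le_right ε' 1
  refine ⟨?_, ?_, ?_⟩ <;> rintro ⟨A, hA⟩
  · exact Reduction.not_fullyDynamic hε ht he he' (by omega) hte hseth hp hu' hq' hA
  · exact Reduction.not_incremental hε ht he he' (by omega) hte hseth hp hu' hq' hA
  · exact Reduction.not_decremental hε ht he he' (by omega) hte hseth hp hu' hq' hA
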